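/- **Corollary (a priori estimates of the weights).** Let $\mathcal T$ be a finite mesh of closed axis-parallel squares $T\subset\mathbb R^2$ with edge lengths $h(T)$ and pairwise disjoint interiors. Local refinement is allowed with at most one hanging node per edge: if two elements meet in more than one point, then their intersection is an edge of the one that is not larger, and an edge or one of the two halves of an edge of the other. Let $D$ be the interior of $\bigcup_{T\in\mathcal T}T$, and assume that $D$ has no pinch points: any two elements that contain a point $z$ are linked by a chain of elements of $\mathcal T$ containing $z$, in which consecutive elements meet in more than one point. Let $\mathcal V_h^{(2)}$ be the space of continuous, piecewise bi-quadratic functions with values in $\mathbb R^2$. Let $\omega_T=\omega_{\partial T}$ be the union of all elements that meet $T$ or meet an element $T'$ with $h(T')>h(T)$ that shares more than one point with $T$ (if there are no hanging nodes, this is the union of all elements that meet $T$). Let $u\in W^{2,\infty}(D;\mathbb R^2)$ be represented by the function that is continuous on $\overline D$. 1. *(Primal weights.)* There is a function $\tilde u_h\in\mathcal V_h^{(2)}$ such that for all $T\in\mathcal T$ $$\omega_T^{(u)}=\|u-\tilde u_h\|_{0,2,T}\le C\,h(T)\,|u|_{1,2,\omega_T},\qquad \omega_{\partial T}^{(u)}=\|u-\tilde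 u_h\|_{0,2,\partial T}\le C\,h(T)^{1/2}\,|u|_{1,2,\omega_{\partial T}},$$ with a constant $C$ that is independent of the mesh $\mathcal T$ and of $u$. 2. *(Control weights.)* Let $\lambda,\mu$ be Lamé parameters with $\mu>0$ and $\kappa:=\lambda+\mu>0$, and let $l>0$. For a symmetric matrix $\sigma\in\mathbb R^{2\times2}$ with eigenvalues $\lambda_1\ge\lambda_2$ put $$m[\sigma]=\frac{|\lambda_2|}{|\lambda_1|+|\lambda_2|},\qquad \theta[\sigma]=\min\Big\{1,\sqrt{\tfrac{2\mu+\lambda}{4\mu(\mu+\lambda)l}}\,\big(|\lambda_1|+|\lambda_2|\big)\Big\},$$ and let $\alpha[\sigma]$ be an angle for which $(\cos\alpha,\sin\alpha)$ is an eigenvector of $\sigma$ for $\lambda_1$. For $q=(\alpha,m,\theta)$ let $$C^*_{ijkl}[q]=\sum_{a,b,c,d}Q_{ia}Q_{jb}Q_{kc}Q_{ld}\,\bar C_{abcd}[m,\theta],$$ where $Q$ is the rotation by $\alpha$ and, with $N=4\kappa\mu m(1-m)\theta^2+(\kappa+\mu)^2(1-\theta)$, $$\bar C_{1111}=\frac{4\kappa\mu(\kappa+\mu)\theta(1-\theta(1-m))(1-m)}{N},\quad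 \bar C_{2222}=\frac{4\kappa\mu(\kappa+\mu)\theta(1-\theta m)m}{N},\quad \bar C_{1122}=\bar C_{2211}=\frac{4\kappa\mu\lambda\theta^2m(1-m)}{N},$$ all other entries of $\bar C$ being $0$. Assume that $q=(\alpha,m,\theta)$ are the optimal lamination parameters of $u$, that is, almost everywhere in $D$ one has $q=q[\sigma]$ for $\sigma=C^*[q]\,\varepsilon(u)$, $\varepsilon(u)=\frac12(Du+Du^\top)$, and that $\theta\ge\theta_0$ almost everywhere for a threshold $\theta_0>0$. For each $T$ let $I_Tu$ be the bi-quadratic Lagrange interpolant of $u$ on $T$ (nodes: the vertices, the edge midpoints and the centre of $T$), and on $T$ put $\sigma_h=C^*[q]\,\varepsilon(I_Tu)$, $\tilde m_h=m[\sigma_h]$, $\tilde\theta_h=\theta[\sigma_h]$. Let $0<h_0<1$. Then for all $T\in\mathcal T$ with $h(T)\le h_0$ $$\omega_T^{(m)}=\|m-\tilde m_h\|_{0,\infty,T}\le C\,h(T)\,|\ln h(T)|\,|u|_{2,\infty,T},\qquad \omega_T^{(\theta)}=\|\theta-\tilde\theta_h\|_{0,\infty,T}\le C\,h(T)\,|\ln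 h(T)|\,|u|_{2,\infty,T},$$ with a constant $C$ that depends only on $\lambda,\mu,l,\theta_0,h_0$, and not on $\mathcal T$, $T$, $u$ or $q$. -/

import Mathlib

open MeasureTheory
open scoped ENNReal ContDiff

noncomputable section

namespace Laminate

/-- The Euclidean plane. -/
abbrev Plane := EuclideanSpace ℝ (Fin 2)

/-- The `k`-th coordinate direction. -/
def dir (k : Fin 2) : Plane := EuclideanSpace.single k (1 : ℝ)

/-! ### Weak derivatives and the space `W^{2,∞}` -/

/-- `g` is the weak partial derivative `∂_k f` on the open set `D`. -/
def HasWeakPartial (D : Set Plane) (f g : Plane → ℝ) (k : Fin 2) : Prop :=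
  LocallyIntegrableOn f D ∧ LocallyIntegrableOn g D ∧
    ∀ φ : Plane → ℝ, ContDiff ℝ ∞ φ → HasCompactSupport φ → tsupport φ ⊆ D →
      ∫ x in D, f x * fderiv ℝ φ x (dir k) = -∫ x in D, g x * φ x

/-- `u ∈ W^{2,∞}(D; ℝ²)` with weak Jacobian `G = Du` and weak second derivatives
`H x i j k = ∂_k ∂_j u_i`. The field `u` is the representative that is continuous up to the
boundary. -/
structure IsW2Inf (D : Set Plane) (u : Plane → Plane)
    (G : Plane → Matrix (Fin 2) (Fin 2) ℝ) (H : Plane → Fin 2 → Fin 2 → Fin 2 → ℝ) : Prop where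
  continuousOn : ContinuousOn u (closure D)
  memLp : ∀ i, MemLp (fun x => u x i) ∞ (volume.restrict D)
  memLp_grad : ∀ i j, MemLp (fun x => G x i j) ∞ (volume.restrict D)
  memLp_hess : ∀ i j k, MemLp (fun x => H x i j k) ∞ (volume.restrict D)
  weak_grad : ∀ i j, HasWeakPartial D (fun x => u x i) (fun x => G x i j) j
  weak_hess : ∀ i j k, HasWeakPartial D (fun x => G x i j) (fun x => H x i j k) k

/-- The seminorm `|u|_{1,2,S}`, in terms of the weak Jacobian `G` of `u`. -/
def seminormOneTwo (G : Plane → Matrix (Fin 2) (Fin 2) ℝ) (S : Set Plane) : ℝ≥0∞ :=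
  eLpNorm (fun x => Real.sqrt (∑ i, ∑ j, G x i j ^ 2)) 2 (volume.restrict S)

/-- The seminorm `|u|_{2,∞,S}`, in terms of the weak second derivatives `H` of `u`. -/
def seminormTwoInf (H : Plane → Fin 2 → Fin 2 → Fin 2 → ℝ) (S : Set Plane) : ℝ≥0∞ :=
  eLpNorm (fun x => Real.sqrt (∑ i, ∑ j, ∑ k, H x i j k ^ 2)) ∞ (volume.restrict S)

/-! ### Square elements and meshes -/

/-- An axis-parallel square, given by its lower left corner and its edge length. -/
structure Square where
  corner : Plane
  side : ℝ
  side_pos : 0 < side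

namespace Square

/-- The closed square as a set. -/
def carrier (T : Square) : Set Plane :=
  {x | ∀ i, T.corner i ≤ x i ∧ x i ≤ T.corner i + T.side}

/-- The nine bi-quadratic Lagrange nodes: vertices, edge midpoints, centre. -/
def node (T : Square) (a b : Fin 3) : Plane :=
  !₂[T.corner 0 + T.side * ((a : ℕ) : ℝ) / 2, T.corner 1 + T.side * ((b : ℕ) : ℝ) / 2]

/-- The four (closed) edges. -/
def edges (T : Square) : Set (Set Plane) :=
  {segment ℝ (T.node 0 0) (T.node 2 0), segment ℝ (T.node 0 2) (T.node 2 2),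
   segment ℝ (T.node 0 0) (T.node 0 2), segment ℝ (T.node 2 0) (T.node 2 2)}

/-- The eight halves of the edges. -/
def halfEdges (T : Square) : Set (Set Plane) :=
  {segment ℝ (T.node 0 0) (T.node 1 0), segment ℝ (T.node 1 0) (T.node 2 0),
   segment ℝ (T.node 0 2) (T.node 1 2), segment ℝ (T.node 1 2) (T.node 2 2),
   segment ℝ (T.node 0 0) (T.node 0 1), segment ℝ (T.node 0 1) (T.node 0 2),
   segment ℝ (T.node 2 0) (T.node 2 1), segment ℝ (T.node 2 1) (T.node 2 2)}

/-- Two squares share a nondegenerate piece of boundary (if they do not overlap):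
they meet in more than one point. -/
def Adjacent (T T' : Square) : Prop := (T.carrier ∩ T'.carrier).Nontrivial

end Square

/-- A mesh of axis-parallel squares. Local refinement with one hanging node per edge is allowed:
the common boundary piece of two adjacent elements is an edge of the one that is not larger, and an
edge or half an edge of the other. The last field says that the meshed domain has no pinch points
(no two elements touch at a vertex only, without being linked around that vertex). -/
structure Mesh where
  elems : Set Square
  finite : elems.Finite
  interior_disjoint : ∀ T ∈ elems, ∀ T' ∈ elems, T ≠ T' →
    Disjoint (interior T.carrier) (interior T'.carrier)
  matching : ∀ T ∈ elems, ∀ T' ∈ elems, T ≠ T' → T.Adjacent T' → T.side ≤ T'.side →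
    T.carrier ∩ T'.carrier ∈ T.edges ∧ T.carrier ∩ T'.carrier ∈ T'.edges ∪ T'.halfEdges
  no_pinch : ∀ z : Plane, ∀ T ∈ elems, ∀ T' ∈ elems, z ∈ T.carrier → z ∈ T'.carrier →
    Relation.ReflTransGen
      (fun A B : Square => A ∈ elems ∧ B ∈ elems ∧ z ∈ A.carrier ∧ z ∈ B.carrier ∧ A.Adjacent B)
      T T'

namespace Mesh

/-- The open domain `D` covered by the mesh. -/
def domain (M : Mesh) : Set Plane := interior (⋃ T ∈ M.elems, T.carrier)

/-- The patch `ω_T = ω_{∂T}`: the union of all elements that meet `T` (equivalently `∂T`) or that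
meet a larger element adjacent to `T`. Without hanging nodes, these are the elements that
meet `T`. -/
def patch (M : Mesh) (T : Square) : Set Plane :=
  ⋃ K ∈ {K ∈ M.elems | (K.carrier ∩ T.carrier).Nonempty ∨
    ∃ T' ∈ M.elems, T.side < T'.side ∧ T.Adjacent T' ∧ (K.carrier ∩ T'.carrier).Nonempty},
    K.carrier

end Mesh

/-! ### Bi-quadratic finite elements -/

/-- `v` coincides on `S` with a vector valued polynomial of degree at most two in each variable. -/
def IsBiquadraticOn (v : Plane → Plane) (S : Set Plane) : Prop :=
  ∃ c : Fin 3 → Fin 3 → Plane, ∀ x ∈ S,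
    v x = ∑ a : Fin 3, ∑ b : Fin 3, (x 0 ^ (a : ℕ) * x 1 ^ (b : ℕ)) • c a b

/-- `v ∈ V_h^{(2)}`: continuous and piecewise bi-quadratic. -/
def IsFiniteElement (M : Mesh) (v : Plane → Plane) : Prop :=
  ContinuousOn v (⋃ T ∈ M.elems, T.carrier) ∧ ∀ T ∈ M.elems, IsBiquadraticOn v T.carrier

/-- The quadratic Lagrange basis on `[0,1]` for the nodes `0, 1/2, 1`. -/
def lagrangeBasis (a : Fin 3) (t : ℝ) : ℝ :=
  ![(1 - t) * (1 - 2 * t), 4 * t * (1 - t), t * (2 * t - 1)] a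

/-- The bi-quadratic Lagrange interpolant of `u` on the element `T`. -/
def interpolant (T : Square) (u : Plane → Plane) (x : Plane) : Plane :=
  ∑ a : Fin 3, ∑ b : Fin 3,
    (lagrangeBasis a ((x 0 - T.corner 0) / T.side) *
      lagrangeBasis b ((x 1 - T.corner 1) / T.side)) • u (T.node a b)

/-- The Jacobian matrix of a differentiable field. -/
def jacobian (v : Plane → Plane) (x : Plane) : Matrix (Fin 2) (Fin 2) ℝ :=
  Matrix.of fun i j => (fderiv ℝ v x (dir j)) i

/-! ### Sequential laminates -/

/-- The symmetrized gradient, from the Jacobian. -/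
def strain (J : Matrix (Fin 2) (Fin 2) ℝ) : Matrix (Fin 2) (Fin 2) ℝ :=
  (1 / 2 : ℝ) • (J + J.transpose)

/-- A fourth order tensor in two dimensions. -/
abbrev Tensor4 := Fin 2 → Fin 2 → Fin 2 → Fin 2 → ℝ

/-- `C ξ`. -/
def Tensor4.apply (C : Tensor4) (e : Matrix (Fin 2) (Fin 2) ℝ) : Matrix (Fin 2) (Fin 2) ℝ :=
  Matrix.of fun i j => ∑ k, ∑ l, C i j k l * e k l

/-- The rotation by the angle `α`. -/
def rotMatrix (α : ℝ) : Matrix (Fin 2) (Fin 2) ℝ :=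
  !![Real.cos α, -Real.sin α; Real.sin α, Real.cos α]

/-- The effective tensor of a rank two sequential laminate in reference configuration;
`lam`, `mu` are the Lamé parameters of the rigid phase and `lam + mu` is its bulk modulus. -/
def referenceTensor (lam mu m θ : ℝ) : Tensor4 := fun i j k l =>
  let κ := lam + mu
  let den := 4 * κ * mu * m * (1 - m) * θ ^ 2 + (κ + mu) ^ 2 * (1 - θ)
  if i = j ∧ k = l then
    if i = k then
      if i = 0 then 4 * κ * mu * (κ + mu) * θ * (1 - θ * (1 - m)) * (1 - m) / den
      else 4 * κ * mu * (κ + mu) * θ * (1 - θ * m) * m / den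
    else 4 * κ * mu * lam * θ ^ 2 * m * (1 - m) / den
  else 0

/-- The effective tensor `C^*[q]` for the parameters `q = (α, m, θ)`. -/
def effectiveTensor (lam mu α m θ : ℝ) : Tensor4 := fun i j k l =>
  ∑ a, ∑ b, ∑ c, ∑ d, rotMatrix α i a * rotMatrix α j b * rotMatrix α k c * rotMatrix α l d *
    referenceTensor lam mu m θ a b c d

/-- The larger eigenvalue of a symmetric matrix. -/
def eig₁ (σ : Matrix (Fin 2) (Fin 2) ℝ) : ℝ :=
  (σ 0 0 + σ 1 1) / 2 + Real.sqrt (((σ 0 0 - σ 1 1) / 2) ^ 2 + σ 0 1 ^ 2)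

/-- The smaller eigenvalue of a symmetric matrix. -/
def eig₂ (σ : Matrix (Fin 2) (Fin 2) ℝ) : ℝ :=
  (σ 0 0 + σ 1 1) / 2 - Real.sqrt (((σ 0 0 - σ 1 1) / 2) ^ 2 + σ 0 1 ^ 2)

theorem eig₂_le_eig₁ (σ : Matrix (Fin 2) (Fin 2) ℝ) : eig₂ σ ≤ eig₁ σ := by
  have := Real.sqrt_nonneg (((σ 0 0 - σ 1 1) / 2) ^ 2 + σ 0 1 ^ 2)
  unfold eig₁ eig₂
  linarith

theorem charpoly_eq_of_isSymm (σ : Matrix (Fin 2) (Fin 2) ℝ) (h : σ.IsSymm) :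
    σ.charpoly = (Polynomial.X - Polynomial.C (eig₁ σ)) *
      (Polynomial.X - Polynomial.C (eig₂ σ)) := by
  have hs : σ 1 0 = σ 0 1 := h.apply 0 1
  have hsq := Real.sq_sqrt (show 0 ≤ ((σ 0 0 - σ 1 1) / 2) ^ 2 + σ 0 1 ^ 2 by positivity)
  have h1 : eig₁ σ + eig₂ σ = σ.trace := by
    rw [Matrix.trace_fin_two]; unfold eig₁ eig₂; ring
  have h2 : eig₁ σ * eig₂ σ = σ.det := by
    rw [Matrix.det_fin_two, hs]; unfold eig₁ eig₂; linear_combination -hsq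
  rw [Matrix.charpoly_fin_two, ← h1, ← h2, Polynomial.C_add, Polynomial.C_mul]
  ring

/-- The ratio parameter `m[σ]`. -/
def ratioOf (σ : Matrix (Fin 2) (Fin 2) ℝ) : ℝ :=
  |eig₂ σ| / (|eig₁ σ| + |eig₂ σ|)

/-- The density parameter `θ[σ]`, for the Lagrange multiplier `l` of the volume constraint. -/
def densityOf (lam mu l : ℝ) (σ : Matrix (Fin 2) (Fin 2) ℝ) : ℝ :=
  min 1 (Real.sqrt ((2 * mu + lam) / (4 * mu * (mu + lam) * l)) * (|eig₁ σ| + |eig₂ σ|))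

/-- `α` is the inclination of the first principal stress direction: `(cos α, sin α)` is an
eigenvector for `eig₁ σ`, that is, `α = arctan (τ_y / τ_x)` up to multiples of `π`. -/
def IsInclination (σ : Matrix (Fin 2) (Fin 2) ℝ) (α : ℝ) : Prop :=
  σ.mulVec ![Real.cos α, Real.sin α] = eig₁ σ • ![Real.cos α, Real.sin α]

/-- The stress `C^*[q(x)] ε` for the strain of a displacement with Jacobian `J` at a point with
parameters `α, m, θ`. -/
def stress (lam mu α m θ : ℝ) (J : Matrix (Fin 2) (Fin 2) ℝ) : Matrix (Fin 2) (Fin 2) ℝ :=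
  (effectiveTensor lam mu α m θ).apply (strain J)

/-- The fields `q = (α, m, θ)` are the optimal lamination parameters of the displacement with
Jacobian `G`: almost everywhere `q = q[σ]` for the stress `σ = C^*[q] ε(u)`. -/
def IsOptimal (lam mu l : ℝ) (D : Set Plane) (G : Plane → Matrix (Fin 2) (Fin 2) ℝ)
    (α m θ : Plane → ℝ) : Prop :=
  ∀ᵐ x ∂(volume.restrict D),
    IsInclination (stress lam mu (α x) (m x) (θ x) (G x)) (α x) ∧
    m x = ratioOf (stress lam mu (α x) (m x) (θ x) (G x)) ∧
    θ x = densityOf lam mu l (stress lam mu (α x) (m x) (θ x) (G x))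

/-- The stress `σ_h = C^*[q] ε(I_T u)` of the interpolated displacement on the element `T`. -/
def interpolatedStress (lam mu : ℝ) (α m θ : Plane → ℝ) (T : Square) (u : Plane → Plane)
    (x : Plane) : Matrix (Fin 2) (Fin 2) ℝ :=
  stress lam mu (α x) (m x) (θ x) (jacobian (interpolant T u) x)

/-! ### The weights -/

/-- `ω_T^{(u)} = ‖u - ũ‖_{0,2,T}`. -/
def weightU (T : Square) (u v : Plane → Plane) : ℝ≥0∞ :=
  eLpNorm (fun x => u x - v x) 2 (volume.restrict T.carrier)

/-- `ω_{∂T}^{(u)} = ‖u - ũ‖_{0,2,∂T}`, with respect to arc length on `∂T`. -/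
def weightBoundary (T : Square) (u v : Plane → Plane) : ℝ≥0∞ :=
  eLpNorm (fun x => u x - v x) 2 ((μH[1] : Measure Plane).restrict (frontier T.carrier))

/-- `ω_T^{(m)} = ‖m - m̃‖_{0,∞,T}` and `ω_T^{(θ)} = ‖θ - θ̃‖_{0,∞,T}`. -/
def weightControl (T : Square) (p q : Plane → ℝ) : ℝ≥0∞ :=
  eLpNorm (fun x => p x - q x) ∞ (volume.restrict T.carrier)

end Laminate

end

open Laminate

/-! Both estimates start from inequalities for smooth functions on rectangles. They pass to `u` by
mollification on slightly smaller rectangles: the values converge up to the boundary because `u` is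
continuous there, the weak derivatives converge almost everywhere and stay bounded.

Primal weights. The approximation is a Clément-type quasi-interpolant. The basic inequality
`lintegral_line_box_le` bounds the mean square difference of a function between a line and a
rectangle by its gradient, so it serves both as a Poincaré and as a trace inequality. It provides on
each element `K` a value `a K` that approximates `u` as well as the mean (`exists_isLocalMean`), and
it shows that the values on adjacent elements differ by at most a constant times the square root of
the Dirichlet energy on their union (`enorm_localMean_sub_sq_le`); in two dimensions no power of the
mesh size appears here. At most four elements meet at a point and, without pinch points, they are
linked through adjacent ones, so all values around a node are comparable (`Mesh.edist_le_of_mem`).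
Each node receives the value of some element that contains it, except that hanging nodes receive the
trace of the larger neighbour; this makes the function continuous
(`interpolant_nodalField_consistent`). On `T` it differs from `a T` by a multiple of the root of the
energy of the patch, while `u` differs from `a T` by the order `h` in the mean square norm on `T`
and by the order `h^(1/2)` on its boundary.

Control weights. Almost everywhere `u` has a first order Taylor expansion on the whole element with
a remainder controlled by the second derivatives (`ae_taylor`). Bi-quadratic interpolation
reproduces affine functions, so the gradient of the interpolant is off by the order `h`. Both
stresses use the same tensor at the same point, and this tensor is bounded uniformly for `m` and `θ`
in `[0, 1]` (`abs_referenceTensor_le`), so no regularity of `q` is needed. Eigenvalues are Lipschitz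
in the matrix. The ratio `m` is Lipschitz up to the factor `1 / (|λ₁| + |λ₂|)`, which is under
control because `θ ≥ θ₀` keeps the exact stress away from zero. The outcome is a bound of order `h`;
the logarithm only enlarges it, since `|log h| ≥ |log h₀| > 0`. -/

open MeasureTheory Filter Topology
open scoped ENNReal ContDiff Convolution

noncomputable section

namespace Laminate

/-! ### Mollification of functions with weak derivatives -/

/-- A sequence of bump functions at the origin whose supports shrink to a point. -/
def bump (n : ℕ) : ContDiffBump (0 : Plane) where
  rIn := 1 / (2 * ((n : ℝ) + 1))
  rOut := 1 / ((n : ℝ) + 1)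
  rIn_pos := by positivity
  rIn_lt_rOut := by
    apply one_div_lt_one_div_of_lt <;> [positivity; linarith [(Nat.cast_nonneg n : (0 : ℝ) ≤ n)]]

theorem tendsto_bump_rOut : Tendsto (fun n => (bump n).rOut) atTop (𝓝 0) :=
  tendsto_one_div_add_atTop_nhds_zero_nat

/-- Mollification of the restriction of `f` to `U`. -/
def mollify (n : ℕ) (U : Set Plane) (f : Plane → ℝ) : Plane → ℝ :=
  (bump n).normed volume ⋆[ContinuousLinearMap.lsmul ℝ ℝ, volume] U.indicator f

theorem mollify_apply (n : ℕ) (U : Set Plane) (f : Plane → ℝ) (x : Plane) :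
    mollify n U f x = ∫ t, (bump n).normed volume (x - t) * U.indicator f t := by
  unfold mollify
  rw [convolution_eq_swap]
  simp

theorem locallyIntegrable_indicator {U : Set Plane} (hU : MeasurableSet U) {f : Plane → ℝ}
    (hf : MemLp f ∞ (volume.restrict U)) : LocallyIntegrable (U.indicator f) :=
  ((memLp_indicator_iff_restrict hU).2 hf).locallyIntegrable le_top

theorem contDiff_mollify (n : ℕ) {U : Set Plane} (hU : MeasurableSet U) {f : Plane → ℝ}
    (hf : MemLp f ∞ (volume.restrict U)) : ContDiff ℝ ∞ (mollify n U f) :=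
  (bump n).hasCompactSupport_normed.contDiff_convolution_left _ (bump n).contDiff_normed
    (locallyIntegrable_indicator hU hf)

/-- The derivative falls on the kernel, and the reflected kernel centred at `x` is a test function
supported in the ball around `x`. The sign from the reflection cancels the sign in the definition of
the weak derivative. -/
theorem fderiv_mollify (n : ℕ) {U : Set Plane} (hU : IsOpen U) {f g : Plane → ℝ} {k : Fin 2}
    (hf : MemLp f ∞ (volume.restrict U)) (hfg : HasWeakPartial U f g k) {x : Plane}
    (hx : Metric.closedBall x (bump n).rOut ⊆ U) :
    fderiv ℝ (mollify n U f) x (dir k) = mollify n U g x := by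
  have hli := locallyIntegrable_indicator hU.measurableSet hf
  have hsm : ContDiff ℝ ∞ ((bump n).normed (volume : Measure Plane)) := (bump n).contDiff_normed
  have hcs := (bump n).hasCompactSupport_normed (μ := (volume : Measure Plane))
  have hd := (hcs.hasFDerivAt_convolution_left
    (ContinuousLinearMap.lsmul ℝ ℝ) (hsm.of_le (by norm_cast)) hli x).fderiv
  have h0 : fderiv ℝ (mollify n U f) x (dir k) =
      ∫ t, fderiv ℝ ((bump n).normed volume) (x - t) (dir k) * U.indicator f t := by
    unfold mollify
    rw [hd, convolution_eq_swap, ContinuousLinearMap.integral_apply]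
    · simp [ContinuousLinearMap.precompL_apply]
    · have := (hcs.fderiv ℝ).convolutionExists_left
        ((ContinuousLinearMap.lsmul ℝ ℝ : ℝ →L[ℝ] ℝ →L[ℝ] ℝ).precompL Plane)
        (hsm.continuous_fderiv (by simp)) hli x
      exact (convolutionExistsAt_iff_integrable_swap).1 this
  set φ : Plane → ℝ := fun t => (bump n).normed volume (x - t) with hφ
  have hφs : ContDiff ℝ ∞ φ := hsm.comp (contDiff_const.sub contDiff_id)
  have hts : tsupport φ ⊆ Metric.closedBall x (bump n).rOut := by
    refine closure_minimal ?_ Metric.isClosed_closedBall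
    intro t ht
    have : x - t ∈ Function.support ((bump n).normed (volume : Measure Plane)) := ht
    rw [ContDiffBump.support_normed_eq] at this
    rw [Metric.mem_closedBall, dist_comm, dist_eq_norm]
    simpa using (mem_ball_zero_iff.1 this).le
  have hcφ : HasCompactSupport φ :=
    HasCompactSupport.of_support_subset_isCompact (isCompact_closedBall x (bump n).rOut)
      (subset_closure.trans hts)
  have hdφ : ∀ t, fderiv ℝ φ t (dir k) =
      -fderiv ℝ ((bump n).normed volume) (x - t) (dir k) := by
    intro t
    have h1 : HasFDerivAt (fun t : Plane => x - t) (-ContinuousLinearMap.id ℝ Plane) t := by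
      simpa using (hasFDerivAt_id t).const_sub x
    have h2 := ((hsm.differentiable (by simp)) (x - t)).hasFDerivAt
    have h3 : HasFDerivAt φ _ t := h2.comp t h1
    rw [h3.fderiv]
    simp
  have key := hfg.2.2 φ hφs hcφ (hts.trans hx)
  rw [h0, mollify_apply]
  rw [← integral_indicator hU.measurableSet, ← integral_indicator hU.measurableSet] at key
  have e1 : ∀ t, fderiv ℝ ((bump n).normed volume) (x - t) (dir k) * U.indicator f t =
      -(U.indicator (fun t => f t * fderiv ℝ φ t (dir k)) t) := by
    intro t
    by_cases ht : t ∈ U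
    · simp only [Set.indicator_of_mem ht, hdφ]; ring
    · simp only [Set.indicator_of_notMem ht]; ring
  have e2 : ∀ t, (bump n).normed volume (x - t) * U.indicator g t =
      U.indicator (fun t => g t * φ t) t := by
    intro t
    by_cases ht : t ∈ U
    · simp only [Set.indicator_of_mem ht, hφ]; ring
    · simp only [Set.indicator_of_notMem ht]; ring
  simp only [e1, e2]
  rw [integral_neg, key, neg_neg]

theorem abs_mollify_le (n : ℕ) {U : Set Plane} (hU : MeasurableSet U) {f : Plane → ℝ} {B : ℝ}
    (hB : 0 ≤ B) (hf : ∀ᵐ x ∂volume.restrict U, |f x| ≤ B) (x : Plane) :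
    |mollify n U f x| ≤ B := by
  have hint : Integrable (fun t => (bump n).normed (volume : Measure Plane) (x - t)) :=
    (bump n).integrable_normed.comp_sub_left x
  rw [mollify_apply, ← Real.norm_eq_abs]
  calc ‖∫ t, (bump n).normed volume (x - t) * U.indicator f t‖
      ≤ ∫ t, (bump n).normed volume (x - t) * B := by
        refine norm_integral_le_of_norm_le (hint.mul_const B) ?_
        have h := (ae_restrict_iff' hU).1 hf
        filter_upwards [h] with t ht
        rw [norm_mul, Real.norm_of_nonneg ((bump n).nonneg_normed _)]
        refine mul_le_mul_of_nonneg_left ?_ ((bump n).nonneg_normed _)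
        by_cases htU : t ∈ U
        · rw [Set.indicator_of_mem htU]; exact ht htU
        · rw [Set.indicator_of_notMem htU]; simpa using hB
    _ = B := by
        rw [integral_mul_const, integral_sub_left_eq_self, (bump n).integral_normed, one_mul]

/-- Lebesgue differentiation; the outer radius of each bump is exactly twice the inner one, so the
kernels do not degenerate. -/
theorem ae_tendsto_mollify {U : Set Plane} (hU : MeasurableSet U) {f : Plane → ℝ}
    (hf : MemLp f ∞ (volume.restrict U)) :
    ∀ᵐ x ∂volume.restrict U, Tendsto (fun n => mollify n U f x) atTop (𝓝 (f x)) := by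
  rw [ae_restrict_iff' hU]
  have h := ContDiffBump.ae_convolution_tendsto_right_of_locallyIntegrable (φ := bump) (K := 2)
    tendsto_bump_rOut
    (Eventually.of_forall fun n => by simp only [bump]; apply le_of_eq; field_simp)
    (locallyIntegrable_indicator hU hf)
  filter_upwards [h] with x hx hxU
  rw [Set.indicator_of_mem hxU] at hx
  exact hx

/-- The points move with `n` so that the limit point may lie on the boundary of `U`: it is
approached by points whose mollification balls stay inside `U`, where the extension by zero is not
felt. -/
theorem tendsto_mollify {U R : Set Plane} (hU : MeasurableSet U) (hUR : U ⊆ R) {f : Plane → ℝ}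
    (hf : MemLp f ∞ (volume.restrict U)) (hc : ContinuousOn f R) {y : ℕ → Plane} {x : Plane}
    (hx : x ∈ R) (hy : Tendsto y atTop (𝓝 x))
    (hyU : ∀ᶠ n in atTop, Metric.closedBall (y n) (bump n).rOut ⊆ U) :
    Tendsto (fun n => mollify n U f (y n)) atTop (𝓝 (f x)) := by
  have hm := (locallyIntegrable_indicator hU hf).aestronglyMeasurable
  rw [Metric.tendsto_nhds]
  intro ε hε
  obtain ⟨δ, hδ, hδf⟩ := Metric.continuousOn_iff.1 hc x hx (ε / 4) (by linarith)
  filter_upwards [hyU, Metric.tendsto_nhds.1 hy (δ / 2) (by linarith),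
    Metric.tendsto_nhds.1 tendsto_bump_rOut (δ / 2) (by linarith)] with n h1 h2 h3
  rw [Real.dist_eq, sub_zero, abs_of_pos (bump n).rOut_pos] at h3
  have hyn : y n ∈ U := h1 (Metric.mem_closedBall_self (bump n).rOut_pos.le)
  have hcl : ∀ z ∈ Metric.ball (y n) (bump n).rOut, z ∈ U ∧ dist (f z) (f x) < ε / 4 := by
    intro z hz
    have hzU := h1 (Metric.ball_subset_closedBall hz)
    refine ⟨hzU, hδf z (hUR hzU) ?_⟩
    have := dist_triangle z (y n) x
    have := Metric.mem_ball.1 hz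
    linarith
  have hyx := (hcl (y n) (Metric.mem_ball_self (bump n).rOut_pos)).2
  have hle := ContDiffBump.dist_normed_convolution_le (φ := bump n) (x₀ := y n) (ε := ε / 2) hm
    (fun z hz => by
      rw [Set.indicator_of_mem (hcl z hz).1, Set.indicator_of_mem hyn]
      have := dist_triangle_right (f z) (f (y n)) (f x)
      have := (hcl z hz).2
      linarith)
  rw [Set.indicator_of_mem hyn] at hle
  have := dist_triangle (mollify n U f (y n)) (f (y n)) (f x)
  have h4 : dist (mollify n U f (y n)) (f (y n)) ≤ ε / 2 := hle
  linarith

theorem HasWeakPartial.mono {D U : Set Plane} {f g : Plane → ℝ} {k : Fin 2}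
    (hD : MeasurableSet D) (hUD : U ⊆ D) (h : HasWeakPartial D f g k) :
    HasWeakPartial U f g k := by
  refine ⟨h.1.mono_set hUD, h.2.1.mono_set hUD, fun φ hφ hc hs => ?_⟩
  have hk := h.2.2 φ hφ hc (hs.trans hUD)
  rw [setIntegral_eq_of_subset_of_forall_sdiff_eq_zero hD hUD,
    setIntegral_eq_of_subset_of_forall_sdiff_eq_zero hD hUD] at hk
  · exact hk
  · intro x hx
    rw [image_eq_zero_of_notMem_tsupport fun h => hx.2 (hs h), mul_zero]
  · intro x hx
    have : x ∉ tsupport (fderiv ℝ φ) := fun h => hx.2 (hs (tsupport_fderiv_subset ℝ h))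
    rw [image_eq_zero_of_notMem_tsupport this]
    simp

/-! ### Rectangles -/

/-- The closed rectangle with lower left corner `p` and upper right corner `q`. -/
def box (p q : Fin 2 → ℝ) : Set Plane := {x | ∀ i, p i ≤ x i ∧ x i ≤ q i}

/-- The open rectangle with lower left corner `p` and upper right corner `q`. -/
def obox (p q : Fin 2 → ℝ) : Set Plane := {x | ∀ i, p i < x i ∧ x i < q i}

/-- The point with `i`-th coordinate `s` and other coordinate `t`. -/
def pt (i : Fin 2) (s t : ℝ) : Plane := s • dir i + t • dir (1 - i)

@[simp] theorem pt_self (i : Fin 2) (s t : ℝ) : pt i s t i = s := by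
  fin_cases i <;> simp [pt, dir]

@[simp] theorem pt_other (i : Fin 2) (s t : ℝ) : pt i s t (1 - i) = t := by
  fin_cases i <;> simp [pt, dir]

theorem forall_axis {P : Fin 2 → Prop} (i : Fin 2) : (∀ k, P k) ↔ P i ∧ P (1 - i) := by
  fin_cases i <;> simp [Fin.forall_fin_two, and_comm]

theorem plane_ext (i : Fin 2) {x y : Plane} (h1 : x i = y i) (h2 : x (1 - i) = y (1 - i)) :
    x = y := by
  ext k
  revert k
  exact (forall_axis i).2 ⟨h1, h2⟩

theorem pt_eta (i : Fin 2) (x : Plane) : pt i (x i) (x (1 - i)) = x :=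
  plane_ext i (by simp) (by simp)

theorem pt_swap (i : Fin 2) (s t : ℝ) : pt (1 - i) s t = pt i t s := by
  simp only [pt, sub_sub_cancel]
  rw [add_comm]

theorem continuous_pt (i : Fin 2) : Continuous fun z : ℝ × ℝ => pt i z.1 z.2 := by
  unfold pt; fun_prop

theorem continuous_coord (i : Fin 2) : Continuous fun x : Plane => x i := by fun_prop

theorem isClosed_box (p q : Fin 2 → ℝ) : IsClosed (box p q) := by
  have : box p q = ⋂ i, {x : Plane | p i ≤ x i} ∩ {x : Plane | x i ≤ q i} := by
    ext x; simp [box]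
  rw [this]
  exact isClosed_iInter fun i => (isClosed_le continuous_const (continuous_coord i)).inter
    (isClosed_le (continuous_coord i) continuous_const)

theorem isOpen_obox (p q : Fin 2 → ℝ) : IsOpen (obox p q) := by
  have : obox p q = ⋂ i, {x : Plane | p i < x i} ∩ {x : Plane | x i < q i} := by
    ext x; simp [obox]
  rw [this]
  exact isOpen_iInter_of_finite fun i => (isOpen_lt continuous_const (continuous_coord i)).inter
    (isOpen_lt (continuous_coord i) continuous_const)

theorem obox_subset_box (p q : Fin 2 → ℝ) : obox p q ⊆ box p q :=
  fun _ hx i => ⟨(hx i).1.le, (hx i).2.le⟩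

theorem convex_box (p q : Fin 2 → ℝ) : Convex ℝ (box p q) := by
  have : box p q = ⋂ i, {x : Plane | p i ≤ x i} ∩ {x : Plane | x i ≤ q i} := by
    ext x; simp [box]
  rw [this]
  refine convex_iInter fun i => ?_
  have hl : IsLinearMap ℝ fun x : Plane => x i := ⟨fun _ _ => rfl, fun _ _ => rfl⟩
  exact (convex_halfSpace_ge hl _).inter (convex_halfSpace_le hl _)

theorem pt_mem_box {p q : Fin 2 → ℝ} {i : Fin 2} {s t : ℝ} :
    pt i s t ∈ box p q ↔ s ∈ Set.Icc (p i) (q i) ∧ t ∈ Set.Icc (p (1 - i)) (q (1 - i)) := by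
  unfold box
  rw [Set.mem_ofPred_eq, forall_axis i]
  simp

theorem pt_mem_obox {p q : Fin 2 → ℝ} {i : Fin 2} {s t : ℝ} :
    pt i s t ∈ obox p q ↔ s ∈ Set.Ioo (p i) (q i) ∧ t ∈ Set.Ioo (p (1 - i)) (q (1 - i)) := by
  unfold obox
  rw [Set.mem_ofPred_eq, forall_axis i]
  simp

theorem box_preimage (p q : Fin 2 → ℝ) (i : Fin 2) :
    (fun z : ℝ × ℝ => pt i z.1 z.2) ⁻¹' box p q =
      Set.Icc (p i) (q i) ×ˢ Set.Icc (p (1 - i)) (q (1 - i)) := by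
  ext z
  exact pt_mem_box

theorem measurePreserving_pt (i : Fin 2) :
    MeasurePreserving (fun z : ℝ × ℝ => pt i z.1 z.2) := by
  have h0 : MeasurePreserving (fun z : ℝ × ℝ => pt 0 z.1 z.2) := by
    have h := (PiLp.volume_preserving_toLp (Fin 2)).comp
      ((volume_preserving_finTwoArrow ℝ).symm _)
    have h2 : (fun z : ℝ × ℝ => pt 0 z.1 z.2) =
        WithLp.toLp 2 ∘ (MeasurableEquiv.finTwoArrow (α := ℝ)).symm := by
      funext z
      ext k
      fin_cases k <;> simp [pt, dir]
    exact h2 ▸ h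
  fin_cases i
  · exact h0
  · have h1 := h0.comp (Measure.measurePreserving_swap (μ := (volume : Measure ℝ)) (ν := volume))
    have h2 : (fun z : ℝ × ℝ => pt 1 z.1 z.2) = (fun z : ℝ × ℝ => pt 0 z.1 z.2) ∘ Prod.swap :=
      funext fun z => pt_swap 0 z.1 z.2
    exact h2 ▸ h1

theorem lintegral_box (p q : Fin 2 → ℝ) (i : Fin 2) {F : Plane → ℝ≥0∞} (hF : Measurable F) :
    ∫⁻ x in box p q, F x =
      ∫⁻ s in Set.Icc (p i) (q i), ∫⁻ t in Set.Icc (p (1 - i)) (q (1 - i)), F (pt i s t) := by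
  rw [← (measurePreserving_pt i).setLIntegral_comp_preimage (isClosed_box p q).measurableSet hF,
    box_preimage, Measure.volume_eq_prod, ← Measure.prod_restrict, lintegral_prod]
  exact (hF.comp (continuous_pt i).measurable).aemeasurable

theorem interior_box (p q : Fin 2 → ℝ) : interior (box p q) = obox p q := by
  apply Set.Subset.antisymm
  · intro x hx k
    have hb := interior_subset hx
    obtain ⟨ε, hε, hball⟩ := Metric.isOpen_iff.1 isOpen_interior x hx
    have hd : ‖dir k‖ = 1 := by simp [dir]
    have h1 : x + (ε / 2) • dir k ∈ box p q := by
      refine interior_subset (hball ?_)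
      rw [mem_ball_iff_norm, add_sub_cancel_left, norm_smul, hd, Real.norm_of_nonneg] <;> linarith
    have h2 : x - (ε / 2) • dir k ∈ box p q := by
      refine interior_subset (hball ?_)
      rw [mem_ball_iff_norm, sub_sub_cancel_left, norm_neg, norm_smul, hd, Real.norm_of_nonneg]
        <;> linarith
    have h3 := (h1 k).2
    have h4 := (h2 k).1
    simp [dir] at h3 h4
    constructor <;> linarith
  · exact interior_maximal (obox_subset_box p q) (isOpen_obox p q)

theorem obox_ae_eq_box (p q : Fin 2 → ℝ) : obox p q =ᵐ[volume] box p q := by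
  rw [← interior_box]
  exact interior_ae_eq_of_null_frontier ((convex_box p q).addHaar_frontier volume)

theorem volume_box (p q : Fin 2 → ℝ) :
    volume (box p q) = ENNReal.ofReal (q 0 - p 0) * ENNReal.ofReal (q 1 - p 1) := by
  have := lintegral_box p q 0 (F := fun _ => 1) measurable_const
  simp only [lintegral_const, Measure.restrict_apply MeasurableSet.univ, Set.univ_inter, one_mul,
    Real.volume_Icc] at this
  rw [this, mul_comm]
  rfl

/-! ### Shrunken rectangles -/

/-- Truncation of `t` to `[a, b]`. -/
def clamp (a b t : ℝ) : ℝ := max a (min t b)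

theorem clamp_mem {a b : ℝ} (h : a ≤ b) (t : ℝ) : clamp a b t ∈ Set.Icc a b :=
  ⟨le_max_left _ _, max_le h (min_le_right _ _)⟩

theorem tendsto_clamp {a b t : ℝ} (ht : t ∈ Set.Icc a b) {δ : ℕ → ℝ}
    (hδ : Tendsto δ atTop (𝓝 0)) :
    Tendsto (fun n => clamp (a + δ n) (b - δ n) t) atTop (𝓝 t) := by
  have h1 : Tendsto (fun n => clamp (a + δ n) (b - δ n) t) atTop
      (𝓝 (max (a + 0) (min t (b - 0)))) :=
    (tendsto_const_nhds.add hδ).max (tendsto_const_nhds.min (tendsto_const_nhds.sub hδ))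
  simpa [ht.1, ht.2] using h1

/-- The margin that is left free for the mollification. -/
def margin (n : ℕ) : ℝ := 2 * (bump n).rOut

theorem margin_pos (n : ℕ) : 0 < margin n := mul_pos two_pos (bump n).rOut_pos

theorem tendsto_margin : Tendsto margin atTop (𝓝 0) := by
  have h := tendsto_bump_rOut.const_mul 2
  rw [mul_zero] at h
  exact h

/-- The rectangle without a strip along the boundary. -/
def innerBox (n : ℕ) (p q : Fin 2 → ℝ) : Set Plane :=
  box (fun k => p k + margin n) (fun k => q k - margin n)

theorem abs_coord_le_norm (x : Plane) (k : Fin 2) : |x k| ≤ ‖x‖ := by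
  simpa using PiLp.norm_apply_le x k

/-- The margin is twice the mollification radius, so even the closed ball stays in the open
rectangle. -/
theorem closedBall_subset_obox {n : ℕ} {p q : Fin 2 → ℝ} {x : Plane} (hx : x ∈ innerBox n p q) :
    Metric.closedBall x (bump n).rOut ⊆ obox p q := by
  intro y hy k
  have h1 := (abs_coord_le_norm (y - x) k).trans (mem_closedBall_iff_norm.1 hy)
  have h2 := hx k
  have h3 := (bump n).rOut_pos
  simp only [margin, PiLp.sub_apply] at h1 h2
  have := abs_le.1 h1
  constructor <;> linarith

theorem eventually_margin {p q : Fin 2 → ℝ} (hpq : ∀ k, p k < q k) :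
    ∀ᶠ n in atTop, ∀ k, p k + margin n ≤ q k - margin n := by
  rw [eventually_all]
  intro k
  have := (tendsto_order.1 tendsto_margin).2 ((q k - p k) / 2) (by linarith [hpq k])
  filter_upwards [this] with n hn
  linarith

theorem eventually_mem_innerBox {p q : Fin 2 → ℝ} {x : Plane} (hx : x ∈ obox p q) :
    ∀ᶠ n in atTop, x ∈ innerBox n p q := by
  have : ∀ᶠ n in atTop, ∀ k, p k + margin n ≤ x k ∧ x k ≤ q k - margin n := by
    rw [eventually_all]
    intro k
    filter_upwards [(tendsto_order.1 tendsto_margin).2 (x k - p k) (by linarith [(hx k).1]),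
      (tendsto_order.1 tendsto_margin).2 (q k - x k) (by linarith [(hx k).2])] with n h1 h2
    constructor <;> linarith
  exact this

/-- The nearest point of the inner rectangle. -/
def clampPt (n : ℕ) (p q : Fin 2 → ℝ) (z : Plane) : Plane :=
  pt 0 (clamp (p 0 + margin n) (q 0 - margin n) (z 0))
    (clamp (p 1 + margin n) (q 1 - margin n) (z 1))

theorem clampPt_mem {n : ℕ} {p q : Fin 2 → ℝ} (h : ∀ k, p k + margin n ≤ q k - margin n)
    (z : Plane) : clampPt n p q z ∈ innerBox n p q :=
  pt_mem_box.2 ⟨clamp_mem (h 0) _, clamp_mem (h 1) _⟩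

theorem tendsto_clampPt {p q : Fin 2 → ℝ} {z : Plane} (hz : z ∈ box p q) :
    Tendsto (fun n => clampPt n p q z) atTop (𝓝 z) := by
  have := ((continuous_pt 0).tendsto (z 0, z 1)).comp
    ((tendsto_clamp (hz 0) tendsto_margin).prodMk_nhds (tendsto_clamp (hz 1) tendsto_margin))
  rwa [show pt 0 (z 0) (z 1) = z from pt_eta 0 z] at this

/-! ### The Taylor inequality -/

theorem norm_le_of_dir {L : Plane →L[ℝ] ℝ} {B : ℝ} (h : ∀ k, |L (dir k)| ≤ B) :
    ‖L‖ ≤ 2 * B := by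
  have hB : 0 ≤ B := (abs_nonneg _).trans (h 0)
  refine L.opNorm_le_bound (by linarith) fun v => ?_
  have hv : L v = v 0 * L (dir 0) + v 1 * L (dir 1) := by
    conv_lhs => rw [← pt_eta 0 v]
    simp [pt]
  rw [hv, Real.norm_eq_abs]
  refine (abs_add_le _ _).trans ?_
  rw [abs_mul, abs_mul]
  have h0 := mul_le_mul (abs_coord_le_norm v 0) (h 0) (abs_nonneg _) (norm_nonneg _)
  have h1 := mul_le_mul (abs_coord_le_norm v 1) (h 1) (abs_nonneg _) (norm_nonneg _)
  linarith

/-- For the mollified function the mean value inequality is applied twice, to the gradient and then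
to the function minus its linear part. In the limit the gradient converges only for almost every
`x`, but the values converge at every point of the closed rectangle, so a single null set serves all
`z`. -/
theorem ae_taylor {p q : Fin 2 → ℝ} (hpq : ∀ k, p k < q k) {f : Plane → ℝ}
    {g : Fin 2 → Plane → ℝ} {h : Fin 2 → Fin 2 → Plane → ℝ} {M : ℝ}
    (hc : ContinuousOn f (box p q)) (hf : MemLp f ∞ (volume.restrict (obox p q)))
    (hg : ∀ k, MemLp (g k) ∞ (volume.restrict (obox p q)))
    (hfg : ∀ k, HasWeakPartial (obox p q) f (g k) k)
    (hgh : ∀ k l, HasWeakPartial (obox p q) (g k) (h k l) l) (hM : 0 ≤ M)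
    (hh : ∀ k l, ∀ᵐ x ∂volume.restrict (obox p q), |h k l x| ≤ M) :
    ∀ᵐ x ∂volume.restrict (obox p q), ∀ z ∈ box p q,
      |f z - f x - ∑ k, g k x * (z k - x k)| ≤ 4 * M * ‖z - x‖ ^ 2 := by
  have hU := (isOpen_obox p q).measurableSet
  filter_upwards [ae_all_iff.2 fun k => ae_tendsto_mollify hU (hg k), ae_restrict_mem hU]
    with x hx hxU z hz
  have hsub := obox_subset_box p q
  -- `z` may be a boundary point, so it is replaced by its nearest point in the inner rectangle,
  -- where the derivatives of the mollification are the mollified weak derivatives.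
  have key : ∀ᶠ n in atTop, |mollify n (obox p q) f (clampPt n p q z) - mollify n (obox p q) f x
      - ∑ k, mollify n (obox p q) (g k) x * (clampPt n p q z k - x k)| ≤
        4 * M * ‖clampPt n p q z - x‖ ^ 2 := by
    filter_upwards [eventually_mem_innerBox hxU, eventually_margin hpq] with n hn hmn
    set y := clampPt n p q z with hy
    have hyn : y ∈ innerBox n p q := clampPt_mem hmn z
    have hseg : segment ℝ x y ⊆ innerBox n p q := (convex_box _ _).segment_subset hn hyn
    have hdf : ∀ k, ∀ w ∈ innerBox n p q, fderiv ℝ (mollify n (obox p q) f) w (dir k) =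
        mollify n (obox p q) (g k) w := fun k w hw =>
      fderiv_mollify n (isOpen_obox p q) hf (hfg k) (closedBall_subset_obox hw)
    have hdiff : ∀ {φ : Plane → ℝ}, MemLp φ ∞ (volume.restrict (obox p q)) → ∀ w,
        DifferentiableAt ℝ (mollify n (obox p q) φ) w := fun hφ w =>
      (contDiff_mollify n hU hφ).differentiable (by simp) w
    have hgl : ∀ k, ∀ w ∈ segment ℝ x y, |mollify n (obox p q) (g k) w -
        mollify n (obox p q) (g k) x| ≤ 2 * M * ‖y - x‖ := by
      intro k w hw
      have := (convex_segment x y).norm_image_sub_le_of_norm_fderiv_le (𝕜 := ℝ)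
        (f := mollify n (obox p q) (g k)) (C := 2 * M)
        (fun v _ => hdiff (hg k) v)
        (fun v hv => norm_le_of_dir fun l => by
          rw [fderiv_mollify n (isOpen_obox p q) (hg k) (hgh k l) (closedBall_subset_obox (hseg hv))]
          exact abs_mollify_le n hU hM (hh k l) v) (left_mem_segment ℝ x y) hw
      refine this.trans (mul_le_mul_of_nonneg_left ?_ (by linarith))
      obtain ⟨a, b, ha, hb, hab, rfl⟩ := hw
      have : a • x + b • y - x = b • (y - x) := by
        rw [show a = 1 - b by linarith]; module
      rw [this, norm_smul, Real.norm_of_nonneg hb]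
      exact mul_le_of_le_one_left (norm_nonneg _) (by linarith)
    -- Second use of the mean value inequality. Each use costs a factor 2 for passing from partial
    -- derivatives to the operator norm, whence the 4 in the conclusion.
    have := (convex_segment x y).norm_image_sub_le_of_norm_fderiv_le (𝕜 := ℝ)
      (f := fun w => mollify n (obox p q) f w - fderiv ℝ (mollify n (obox p q) f) x w)
      (C := 2 * (2 * M * ‖y - x‖))
      (fun v _ => (hdiff hf v).sub (ContinuousLinearMap.differentiableAt _))
      (fun v hv => norm_le_of_dir fun k => by
        rw [fderiv_fun_sub (hdiff hf v) (ContinuousLinearMap.differentiableAt _),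
          ContinuousLinearMap.fderiv, _root_.sub_apply, hdf k v (hseg hv), hdf k x hn]
        exact hgl k v hv) (left_mem_segment ℝ x y) (right_mem_segment ℝ x y)
    rw [Real.norm_eq_abs] at this
    have e : fderiv ℝ (mollify n (obox p q) f) x y - fderiv ℝ (mollify n (obox p q) f) x x =
        ∑ k, mollify n (obox p q) (g k) x * (y k - x k) := by
      rw [← map_sub, ← pt_eta 0 (y - x), Fin.sum_univ_two, ← hdf 0 x hn, ← hdf 1 x hn]
      simp [pt]
      ring
    rw [← e]
    refine le_trans (le_of_eq ?_) (this.trans (le_of_eq ?_))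
    · congr 1; ring
    · ring
  have hlim := tendsto_clampPt hz
  have t1 : Tendsto (fun n => mollify n (obox p q) f (clampPt n p q z)) atTop (𝓝 (f z)) := by
    refine tendsto_mollify hU hsub hf hc hz hlim ?_
    filter_upwards [eventually_margin hpq] with n hn
    exact closedBall_subset_obox (clampPt_mem hn z)
  have t2 : Tendsto (fun n => mollify n (obox p q) f x) atTop (𝓝 (f x)) := by
    refine tendsto_mollify hU hsub hf hc (hsub hxU) tendsto_const_nhds ?_
    filter_upwards [eventually_mem_innerBox hxU] with n hn
    exact closedBall_subset_obox hn
  have t3 : Tendsto (fun n => ∑ k, mollify n (obox p q) (g k) x * (clampPt n p q z k - x k))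
      atTop (𝓝 (∑ k, g k x * (z k - x k))) :=
    tendsto_finsetSum _ fun k _ => (hx k).mul
      ((((continuous_coord k).tendsto z).comp hlim).sub_const _)
  exact le_of_tendsto_of_tendsto ((t1.sub t2).sub t3).abs
    (((hlim.sub_const x).norm.pow 2).const_mul _) key

/-! ### A Poincaré inequality between a line and a rectangle -/

/-- Cauchy–Schwarz against the constant 1. -/
theorem sq_lintegral_le {X : Type*} [MeasurableSpace X] (μ : Measure X) {w : X → ℝ≥0∞}
    (hw : AEMeasurable w μ) : (∫⁻ x, w x ∂μ) ^ 2 ≤ μ Set.univ * ∫⁻ x, w x ^ 2 ∂μ := by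
  have h := ENNReal.lintegral_mul_le_Lp_mul_Lq μ Real.HolderConjugate.two_two
    (f := fun _ => 1) (g := w) aemeasurable_const hw
  simp only [Pi.mul_apply, one_mul, ENNReal.one_rpow, lintegral_const] at h
  calc (∫⁻ x, w x ∂μ) ^ 2 ≤ (μ Set.univ ^ (1 / 2 : ℝ) *
        (∫⁻ x, w x ^ (2 : ℝ) ∂μ) ^ (1 / 2 : ℝ)) ^ 2 := by gcongr
    _ = _ := by
      rw [mul_pow, ← ENNReal.rpow_natCast, ← ENNReal.rpow_natCast, ← ENNReal.rpow_mul,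
        ← ENNReal.rpow_mul]
      simp

theorem enorm_sub_sq_le_of_hasDerivAt {φ φ' : ℝ → ℝ} (hd : ∀ t, HasDerivAt φ (φ' t) t)
    (hc : Continuous φ') {lo hi ℓ a b : ℝ} (hℓ : hi - lo ≤ ℓ) (ha : a ∈ Set.Icc lo hi)
    (hb : b ∈ Set.Icc lo hi) :
    ‖φ a - φ b‖ₑ ^ 2 ≤ ENNReal.ofReal ℓ * ∫⁻ t in Set.Icc lo hi, ‖φ' t‖ₑ ^ 2 := by
  wlog hab : b ≤ a generalizing a b
  · rw [← enorm_neg, neg_sub]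
    exact this hb ha (by linarith)
  have h1 : ‖φ a - φ b‖ₑ ≤ ∫⁻ t in Set.Icc lo hi, ‖φ' t‖ₑ := by
    rw [← intervalIntegral.integral_eq_sub_of_hasDerivAt (fun t _ => hd t)
      (hc.intervalIntegrable b a), intervalIntegral.integral_of_le hab]
    refine (enorm_integral_le_lintegral_enorm _).trans (lintegral_mono_set ?_)
    exact fun t ht => ⟨hb.1.trans ht.1.le, ht.2.trans ha.2⟩
  calc ‖φ a - φ b‖ₑ ^ 2 ≤ (∫⁻ t in Set.Icc lo hi, ‖φ' t‖ₑ) ^ 2 := by gcongr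
    _ ≤ _ := sq_lintegral_le _ hc.enorm.measurable.aemeasurable
    _ ≤ _ := by
      rw [Measure.restrict_apply_univ, Real.volume_Icc]
      gcongr

theorem enorm_add_sq_le {E : Type*} [SeminormedAddCommGroup E] (a b : E) :
    ‖a + b‖ₑ ^ 2 ≤ 2 * ‖a‖ₑ ^ 2 + 2 * ‖b‖ₑ ^ 2 := by
  have h : ‖a + b‖₊ ^ 2 ≤ 2 * ‖a‖₊ ^ 2 + 2 * ‖b‖₊ ^ 2 := by
    rw [← NNReal.coe_le_coe]
    push_cast
    have := norm_add_le a b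
    nlinarith [norm_nonneg (a + b), sq_nonneg (‖a‖ - ‖b‖)]
  simp only [enorm_eq_nnnorm]
  exact_mod_cast h

theorem enorm_sub_sq_le {E : Type*} [SeminormedAddCommGroup E] (a b c : E) :
    ‖a - c‖ₑ ^ 2 ≤ 2 * ‖a - b‖ₑ ^ 2 + 2 * ‖b - c‖ₑ ^ 2 := by
  rw [← sub_add_sub_cancel a b c]
  exact enorm_add_sq_le _ _

theorem measurable_section {i : Fin 2} {F : Plane → ℝ≥0∞} (hF : Measurable F) :
    Measurable fun z : ℝ × ℝ => F (pt i z.1 z.2) :=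
  hF.comp (continuous_pt i).measurable

/-- The point `(t, s)` of the line is joined to `(r, τ)` through the corner `(r, s)`. The energy `A
s` of the first leg depends only on `s`, and the energy `B r` of the second only on `r`, so the two
remaining integrations merely contribute powers of `ℓ`. -/
theorem lintegral_line_box_le_of_contDiff {f : Plane → ℝ} (hf : ContDiff ℝ ∞ f)
    {p q : Fin 2 → ℝ} {ℓ : ℝ} (hℓ : ∀ k, q k - p k ≤ ℓ) (i : Fin 2) {t : ℝ}
    (ht : t ∈ Set.Icc (p i) (q i)) :
    ∫⁻ s in Set.Icc (p (1 - i)) (q (1 - i)), ∫⁻ y in box p q, ‖f (pt i t s) - f y‖ₑ ^ 2 ≤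
      2 * ENNReal.ofReal ℓ ^ 3 * ∫⁻ y in box p q, ∑ k, ‖fderiv ℝ f y (dir k)‖ₑ ^ 2 := by
  set L := ENNReal.ofReal ℓ with hL
  set I := Set.Icc (p i) (q i) with hI
  set J := Set.Icc (p (1 - i)) (q (1 - i)) with hJ
  have hvI : volume I ≤ L := by
    rw [hI, Real.volume_Icc]; exact ENNReal.ofReal_le_ofReal (hℓ _)
  have hvJ : volume J ≤ L := by
    rw [hJ, Real.volume_Icc]; exact ENNReal.ofReal_le_ofReal (hℓ _)
  have hcd : ∀ k, Continuous fun y => fderiv ℝ f y (dir k) := fun k =>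
    (hf.continuous_fderiv (by simp)).clm_apply continuous_const
  have hme : ∀ k, Measurable fun y => ‖fderiv ℝ f y (dir k)‖ₑ ^ 2 := fun k =>
    ((hcd k).enorm.measurable).pow_const 2
  have hd : ∀ y, HasFDerivAt f (fderiv ℝ f y) y := fun y =>
    (hf.differentiable (by simp) y).hasFDerivAt
  have hdi : ∀ s τ, HasDerivAt (fun τ => f (pt i τ s)) (fderiv ℝ f (pt i τ s) (dir i)) τ := by
    intro s τ
    refine (hd _).comp_hasDerivAt τ ?_
    have h := ((hasDerivAt_id τ).smul_const (dir i)).add_const (s • dir (1 - i))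
    rw [one_smul] at h
    exact h
  have hdj : ∀ s τ, HasDerivAt (fun τ => f (pt i s τ))
      (fderiv ℝ f (pt i s τ) (dir (1 - i))) τ := by
    intro s τ
    refine (hd _).comp_hasDerivAt τ ?_
    have h := ((hasDerivAt_id τ).smul_const (dir (1 - i))).const_add (s • dir i)
    rw [one_smul] at h
    exact h
  set A : ℝ → ℝ≥0∞ := fun s => ∫⁻ τ in I, ‖fderiv ℝ f (pt i τ s) (dir i)‖ₑ ^ 2 with hA
  set B : ℝ → ℝ≥0∞ := fun r => ∫⁻ τ in J, ‖fderiv ℝ f (pt i r τ) (dir (1 - i))‖ₑ ^ 2 with hB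
  have hmA : Measurable A := (measurable_section (hme i)).lintegral_prod_left'
  have hmB : Measurable B := (measurable_section (hme (1 - i))).lintegral_prod_right'
  have hpt : ∀ s ∈ J, ∀ r ∈ I, ∀ τ ∈ J, ‖f (pt i t s) - f (pt i r τ)‖ₑ ^ 2 ≤
      2 * (L * A s) + 2 * (L * B r) := by
    intro s hs r hr τ hτ
    refine (enorm_sub_sq_le _ (f (pt i r s)) _).trans ?_
    gcongr
    · exact enorm_sub_sq_le_of_hasDerivAt (hdi s)
        ((hcd i).comp ((continuous_pt i).comp (by fun_prop : Continuous fun τ : ℝ => (τ, s))))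
        (hℓ i) ht hr
    · exact enorm_sub_sq_le_of_hasDerivAt (hdj r)
        ((hcd (1 - i)).comp ((continuous_pt i).comp (by fun_prop : Continuous fun τ : ℝ => (r, τ))))
        (hℓ (1 - i)) hs hτ
  have hmf : ∀ s, Measurable fun y => ‖f (pt i t s) - f y‖ₑ ^ 2 := fun s =>
    ((continuous_const.sub hf.continuous).enorm.measurable).pow_const 2
  calc ∫⁻ s in J, ∫⁻ y in box p q, ‖f (pt i t s) - f y‖ₑ ^ 2
      = ∫⁻ s in J, ∫⁻ r in I, ∫⁻ τ in J, ‖f (pt i t s) - f (pt i r τ)‖ₑ ^ 2 :=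
        lintegral_congr fun s => lintegral_box p q i (hmf s)
    _ ≤ ∫⁻ s in J, ∫⁻ r in I, ∫⁻ τ in J, (2 * (L * A s) + 2 * (L * B r)) :=
        setLIntegral_mono' measurableSet_Icc fun s hs =>
          setLIntegral_mono' measurableSet_Icc fun r hr =>
            setLIntegral_mono' measurableSet_Icc fun τ hτ => hpt s hs r hr τ hτ
    _ ≤ ∫⁻ s in J, ∫⁻ r in I, (2 * (L * A s) + 2 * (L * B r)) * L := by
        gcongr with s r
        rw [lintegral_const, Measure.restrict_apply_univ]
        gcongr
    _ ≤ ∫⁻ s in J, (2 * (L * A s) * L + 2 * (L * ∫⁻ r in I, B r)) * L := by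
        gcongr with s
        rw [lintegral_mul_const _ (by fun_prop), lintegral_add_left (by fun_prop),
          lintegral_const, Measure.restrict_apply_univ, lintegral_const_mul _ (by fun_prop),
          lintegral_const_mul _ (by fun_prop)]
        gcongr
    _ ≤ (2 * (L * ∫⁻ s in J, A s) * L + 2 * (L * ∫⁻ r in I, B r) * L) * L := by
        rw [lintegral_mul_const _ (by fun_prop), lintegral_add_left (by fun_prop),
          lintegral_const, Measure.restrict_apply_univ, lintegral_mul_const _ (by fun_prop),
          lintegral_const_mul _ (by fun_prop), lintegral_const_mul _ (by fun_prop)]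
        gcongr
    _ = 2 * L ^ 3 * ((∫⁻ s in J, A s) + ∫⁻ r in I, B r) := by ring
    _ = 2 * L ^ 3 * ∫⁻ y in box p q, ∑ k, ‖fderiv ℝ f y (dir k)‖ₑ ^ 2 := by
        have e1 : ∫⁻ s in J, A s = ∫⁻ y in box p q, ‖fderiv ℝ f y (dir i)‖ₑ ^ 2 := by
          rw [lintegral_box p q (1 - i) (hme i)]
          simp only [sub_sub_cancel, pt_swap]
          rfl
        have e2 : ∫⁻ r in I, B r = ∫⁻ y in box p q, ‖fderiv ℝ f y (dir (1 - i))‖ₑ ^ 2 := by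
          rw [lintegral_box p q i (hme (1 - i))]
        rw [e1, e2, ← lintegral_add_left (hme i)]
        congr 2
        funext y
        fin_cases i <;> simp [Fin.sum_univ_two, add_comm]

theorem exists_ae_abs_le {X : Type*} [MeasurableSpace X] {μ : Measure X} {g : X → ℝ}
    (hg : MemLp g ∞ μ) : ∃ B : ℝ, 0 ≤ B ∧ ∀ᵐ x ∂μ, |g x| ≤ B := by
  refine ⟨(eLpNorm g ∞ μ).toReal, ENNReal.toReal_nonneg, ?_⟩
  filter_upwards [ae_le_eLpNormEssSup (f := g) (μ := μ)] with x hx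
  have := ENNReal.toReal_mono hg.eLpNorm_ne_top (eLpNorm_exponent_top (f := g) ▸ hx)
  simpa using this

theorem tendsto_lintegral_mollify {p q : Fin 2 → ℝ} {g : Fin 2 → Plane → ℝ}
    (hg : ∀ k, MemLp (g k) ∞ (volume.restrict (obox p q))) :
    Tendsto (fun n => ∫⁻ y in obox p q, ∑ k, ‖mollify n (obox p q) (g k) y‖ₑ ^ 2) atTop
      (𝓝 (∫⁻ y in obox p q, ∑ k, ‖g k y‖ₑ ^ 2)) := by
  have hU := (isOpen_obox p q).measurableSet
  choose B hB0 hB using fun k => exists_ae_abs_le (hg k)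
  refine tendsto_lintegral_of_dominated_convergence
    (fun _ => ∑ k, ENNReal.ofReal (B k) ^ 2) (fun n => ?_) (fun n => ?_) ?_ ?_
  · exact Finset.measurable_fun_sum _ fun k _ =>
      ((contDiff_mollify n hU (hg k)).continuous.enorm.measurable).pow_const 2
  · refine Eventually.of_forall fun y => Finset.sum_le_sum fun k _ => ?_
    gcongr
    rw [Real.enorm_eq_ofReal_abs]
    exact ENNReal.ofReal_le_ofReal (abs_mollify_le n hU (hB0 k) (hB k) y)
  · rw [lintegral_const, Measure.restrict_apply_univ]
    refine ENNReal.mul_ne_top (by simp) ?_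
    exact ((measure_mono (obox_subset_box p q)).trans_lt (by
      rw [volume_box]; exact ENNReal.mul_lt_top ENNReal.ofReal_lt_top ENNReal.ofReal_lt_top)).ne
  · filter_upwards [ae_all_iff.2 fun k => ae_tendsto_mollify hU (hg k)] with y hy
    exact tendsto_finsetSum _ fun k _ =>
      ((ENNReal.continuous_pow 2).tendsto _).comp (hy k).enorm

/-- The smooth estimate is used for the mollifications on shrunken rectangles, with the line moved
inside. Fatou's lemma handles the left side, dominated convergence the right side. -/
theorem lintegral_line_box_le {p q : Fin 2 → ℝ} (hpq : ∀ k, p k < q k) {f : Plane → ℝ}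
    {g : Fin 2 → Plane → ℝ} (hc : ContinuousOn f (box p q))
    (hf : MemLp f ∞ (volume.restrict (obox p q)))
    (hg : ∀ k, MemLp (g k) ∞ (volume.restrict (obox p q)))
    (hfg : ∀ k, HasWeakPartial (obox p q) f (g k) k) {ℓ : ℝ} (hℓ : ∀ k, q k - p k ≤ ℓ)
    (i : Fin 2) {t : ℝ} (ht : t ∈ Set.Icc (p i) (q i)) :
    ∫⁻ s in Set.Icc (p (1 - i)) (q (1 - i)), ∫⁻ y in box p q, ‖f (pt i t s) - f y‖ₑ ^ 2 ≤
      2 * ENNReal.ofReal ℓ ^ 3 * ∫⁻ y in obox p q, ∑ k, ‖g k y‖ₑ ^ 2 := by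
  have hU := (isOpen_obox p q).measurableSet
  set U := obox p q with hUdef
  set t' : ℕ → ℝ := fun n => clamp (p i + margin n) (q i - margin n) t with ht'
  set F : ℕ → Plane → ℝ := fun n => mollify n U f with hF
  have hFc : ∀ n, Continuous (F n) := fun n => (contDiff_mollify n hU hf).continuous
  set J' : ℕ → Set ℝ := fun n =>
    Set.Icc (p (1 - i) + margin n) (q (1 - i) - margin n) with hJ'
  set R' : ℕ → Set Plane := fun n => innerBox n p q with hR'
  have hR'm : ∀ n, MeasurableSet (R' n) := fun n => (isClosed_box _ _).measurableSet
  -- The indicator puts all the integrands on one fixed domain, as Fatou's lemma requires.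
  set Φ : ℕ → ℝ → Plane → ℝ≥0∞ := fun n s y =>
    (J' n ×ˢ R' n).indicator (fun z => ‖F n (pt i (t' n) z.1) - F n z.2‖ₑ ^ 2) (s, y) with hΦ
  have hΦm : ∀ n, Measurable fun z : ℝ × Plane => Φ n z.1 z.2 := by
    intro n
    refine Measurable.indicator ?_ (measurableSet_Icc.prod (hR'm n))
    have : Continuous fun z : ℝ × Plane => F n (pt i (t' n) z.1) - F n z.2 :=
      ((hFc n).comp ((continuous_pt i).comp
        (by fun_prop : Continuous fun z : ℝ × Plane => (t' n, z.1)))).sub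
        ((hFc n).comp continuous_snd)
    exact this.enorm.measurable.pow_const 2
  have hlim : ∀ s ∈ Set.Ioo (p (1 - i)) (q (1 - i)), ∀ y ∈ U,
      Tendsto (fun n => Φ n s y) atTop (𝓝 (‖f (pt i t s) - f y‖ₑ ^ 2)) := by
    intro s hs y hy
    have hbox : pt i t s ∈ box p q := pt_mem_box.2 ⟨ht, hs.1.le, hs.2.le⟩
    have hJev : ∀ᶠ n in atTop, s ∈ J' n := by
      filter_upwards [(tendsto_order.1 tendsto_margin).2 (s - p (1 - i)) (by linarith [hs.1]),
        (tendsto_order.1 tendsto_margin).2 (q (1 - i) - s) (by linarith [hs.2])] with n h1 h2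
      constructor <;> linarith
    have h1 : Tendsto (fun n => F n (pt i (t' n) s)) atTop (𝓝 (f (pt i t s))) := by
      refine tendsto_mollify hU (obox_subset_box p q) hf hc hbox ?_ ?_
      · exact ((tendsto_clamp ht tendsto_margin).smul_const _).add_const _
      · filter_upwards [hJev, eventually_margin hpq] with n h1 h2
        exact closedBall_subset_obox (pt_mem_box.2 ⟨clamp_mem (h2 i) _, h1⟩)
    have h2 : Tendsto (fun n => F n y) atTop (𝓝 (f y)) := by
      refine tendsto_mollify hU (obox_subset_box p q) hf hc (obox_subset_box p q hy)
        tendsto_const_nhds ?_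
      filter_upwards [eventually_mem_innerBox hy] with n h1
      exact closedBall_subset_obox h1
    refine (((ENNReal.continuous_pow 2).tendsto _).comp (h1.sub h2).enorm).congr' ?_
    filter_upwards [hJev, eventually_mem_innerBox hy] with n h1 h2
    simp only [hΦ]
    rw [Set.indicator_of_mem (Set.mk_mem_prod h1 h2)]
    rfl
  have hstep : ∀ᶠ n in atTop, ∫⁻ s in Set.Ioo (p (1 - i)) (q (1 - i)), ∫⁻ y in U, Φ n s y ≤
      2 * ENNReal.ofReal ℓ ^ 3 * ∫⁻ y in U, ∑ k, ‖mollify n U (g k) y‖ₑ ^ 2 := by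
    filter_upwards [eventually_margin hpq] with n hn
    have hsm := lintegral_line_box_le_of_contDiff (contDiff_mollify n hU hf)
      (p := fun k => p k + margin n) (q := fun k => q k - margin n) (ℓ := ℓ)
      (fun k => by linarith [hℓ k, margin_pos n]) i (t := t' n) (clamp_mem (hn i) t)
    have hRU : R' n ⊆ U := fun y hy =>
      closedBall_subset_obox hy (Metric.mem_closedBall_self (bump n).rOut_pos.le)
    calc ∫⁻ s in Set.Ioo (p (1 - i)) (q (1 - i)), ∫⁻ y in U, Φ n s y
        ≤ ∫⁻ s, ∫⁻ y, Φ n s y :=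
          lintegral_mono' Measure.restrict_le_self fun s =>
            lintegral_mono' Measure.restrict_le_self fun y => le_rfl
      _ = ∫⁻ s in J' n, ∫⁻ y in R' n, ‖F n (pt i (t' n) s) - F n y‖ₑ ^ 2 := by
          rw [← lintegral_indicator measurableSet_Icc]
          refine lintegral_congr fun s => ?_
          by_cases hs : s ∈ J' n
          · rw [Set.indicator_of_mem hs, ← lintegral_indicator (hR'm n)]
            refine lintegral_congr fun y => ?_
            by_cases hy : y ∈ R' n
            · rw [Set.indicator_of_mem hy]
              exact Set.indicator_of_mem (Set.mk_mem_prod hs hy) _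
            · rw [Set.indicator_of_notMem hy]
              exact Set.indicator_of_notMem (fun h => hy h.2) _
          · rw [Set.indicator_of_notMem hs]
            refine (lintegral_congr fun y => ?_).trans lintegral_zero
            exact Set.indicator_of_notMem (fun h => hs h.1) _
      _ ≤ _ := hsm
      _ ≤ _ := by
          refine mul_le_mul_right ((le_of_eq ?_).trans (lintegral_mono_set hRU)) _
          refine setLIntegral_congr_fun (hR'm n) fun y hy => Finset.sum_congr rfl fun k _ => ?_
          rw [fderiv_mollify n (isOpen_obox p q) hf (hfg k) (closedBall_subset_obox hy)]
  have hdom := tendsto_lintegral_mollify hg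
  calc ∫⁻ s in Set.Icc (p (1 - i)) (q (1 - i)), ∫⁻ y in box p q, ‖f (pt i t s) - f y‖ₑ ^ 2
      = ∫⁻ s in Set.Ioo (p (1 - i)) (q (1 - i)), ∫⁻ y in U, ‖f (pt i t s) - f y‖ₑ ^ 2 := by
        rw [setLIntegral_congr Ioo_ae_eq_Icc.symm]
        exact lintegral_congr fun s => setLIntegral_congr (obox_ae_eq_box p q).symm
    _ ≤ ∫⁻ s in Set.Ioo (p (1 - i)) (q (1 - i)), liminf (fun n => ∫⁻ y in U, Φ n s y) atTop := by
        refine setLIntegral_mono' measurableSet_Ioo fun s hs => ?_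
        refine le_trans (le_of_eq ?_) (lintegral_liminf_le fun n =>
          (hΦm n).comp measurable_prodMk_left)
        exact setLIntegral_congr_fun hU fun y hy => (hlim s hs y hy).liminf_eq.symm
    _ ≤ liminf (fun n => ∫⁻ s in Set.Ioo (p (1 - i)) (q (1 - i)), ∫⁻ y in U, Φ n s y) atTop :=
        lintegral_liminf_le fun n => (hΦm n).lintegral_prod_right'
    _ ≤ liminf (fun n => 2 * ENNReal.ofReal ℓ ^ 3 *
          ∫⁻ y in U, ∑ k, ‖mollify n U (g k) y‖ₑ ^ 2) atTop := liminf_le_liminf hstep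
    _ = _ := by
        refine (ENNReal.Tendsto.const_mul hdom (Or.inr ?_)).liminf_eq
        exact ENNReal.mul_ne_top (by simp) (by simp)

/-! ### Geometry of the mesh -/

namespace Square

/-- Lower bounds of the coordinates. -/
def lo (T : Square) (i : Fin 2) : ℝ := T.corner i

/-- Upper bounds of the coordinates. -/
def hi (T : Square) (i : Fin 2) : ℝ := T.corner i + T.side

theorem hi_eq (T : Square) (i : Fin 2) : T.hi i = T.lo i + T.side := rfl

theorem lo_lt_hi (T : Square) (i : Fin 2) : T.lo i < T.hi i := by
  rw [hi_eq]; linarith [T.side_pos]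

theorem carrier_eq_box (T : Square) : T.carrier = box T.lo T.hi := rfl

theorem isClosed_carrier (T : Square) : IsClosed T.carrier := isClosed_box _ _

theorem volume_carrier (T : Square) : volume T.carrier = ENNReal.ofReal (T.side ^ 2) := by
  rw [carrier_eq_box, volume_box, hi_eq, hi_eq, add_sub_cancel_left, add_sub_cancel_left,
    ← ENNReal.ofReal_mul T.side_pos.le, sq]

theorem pt_mem_carrier {T : Square} {i : Fin 2} {s t : ℝ} : pt i s t ∈ T.carrier ↔
    s ∈ Set.Icc (T.lo i) (T.hi i) ∧ t ∈ Set.Icc (T.lo (1 - i)) (T.hi (1 - i)) := pt_mem_box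

/-- If no axis separated the squares, their open coordinate intervals would overlap in both
directions and produce a common interior point. -/
theorem exists_separated {T T' : Square}
    (h : Disjoint (interior T.carrier) (interior T'.carrier)) :
    ∃ i, T.hi i ≤ T'.lo i ∨ T'.hi i ≤ T.lo i := by
  by_contra! hn
  have hm : ∀ i, max (T.lo i) (T'.lo i) < min (T.hi i) (T'.hi i) := fun i =>
    max_lt (lt_min (T.lo_lt_hi i) (hn i).2) (lt_min (hn i).1 (T'.lo_lt_hi i))
  have key : ∀ i, ∃ t, (T.lo i < t ∧ t < T.hi i) ∧ T'.lo i < t ∧ t < T'.hi i := fun i => by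
    obtain ⟨t, h1, h2⟩ := exists_between (hm i)
    rw [max_lt_iff] at h1
    rw [lt_min_iff] at h2
    exact ⟨t, ⟨h1.1, h2.1⟩, h1.2, h2.2⟩
  choose t h1 h2 using key
  rw [carrier_eq_box, carrier_eq_box, interior_box, interior_box] at h
  exact Set.disjoint_left.1 h (pt_mem_obox.2 ⟨h1 0, h1 1⟩) (pt_mem_obox.2 ⟨h2 0, h2 1⟩)

/-- The coordinates of the lines through the Lagrange nodes. -/
def gridLine (T : Square) (i : Fin 2) (a : Fin 3) : ℝ := T.corner i + T.side * ((a : ℕ) : ℝ) / 2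

@[simp] theorem gridLine_zero (T : Square) (i : Fin 2) : T.gridLine i 0 = T.lo i := by
  simp [gridLine, lo]

@[simp] theorem gridLine_two (T : Square) (i : Fin 2) : T.gridLine i 2 = T.hi i := by
  simp [gridLine, hi]

theorem gridLine_one (T : Square) (i : Fin 2) : T.gridLine i 1 = T.lo i + T.side / 2 := by
  simp [gridLine, lo]

theorem gridLine_mem (T : Square) (i : Fin 2) (a : Fin 3) :
    T.gridLine i a ∈ Set.Icc (T.lo i) (T.hi i) := by
  have := T.side_pos
  fin_cases a <;> simp [gridLine, lo, hi] <;> first | linarith | (constructor <;> linarith)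

theorem node_eq_pt (T : Square) (a b : Fin 3) :
    T.node a b = pt 0 (T.gridLine 0 a) (T.gridLine 1 b) := by
  refine plane_ext 0 ?_ ?_
  · rw [pt_self]; rfl
  · rw [pt_other]; rfl

theorem node_mem (T : Square) (a b : Fin 3) : T.node a b ∈ T.carrier := by
  rw [node_eq_pt]
  exact pt_mem_carrier.2 ⟨T.gridLine_mem 0 a, T.gridLine_mem 1 b⟩

end Square

/-- The axis-parallel segment on the line where the `i`-th coordinate is `c`. -/
def axisSegment (i : Fin 2) (c a b : ℝ) : Set Plane :=
  {x | x i = c ∧ a ≤ x (1 - i) ∧ x (1 - i) ≤ b}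

theorem pt_mem_axisSegment {i : Fin 2} {c a b t : ℝ} (h : t ∈ Set.Icc a b) :
    pt i c t ∈ axisSegment i c a b := by
  simpa [axisSegment] using h

theorem segment_pt (i : Fin 2) (c : ℝ) {a b : ℝ} (hab : a ≤ b) :
    segment ℝ (pt i c a) (pt i c b) = axisSegment i c a b := by
  have himg : segment ℝ (pt i c a) (pt i c b) = (fun t => pt i c t) '' segment ℝ a b := by
    have := image_segment ℝ (AffineMap.lineMap (pt i c 0) (pt i c 1) : ℝ →ᵃ[ℝ] Plane) a b
    have e : ∀ t : ℝ, (AffineMap.lineMap (pt i c 0) (pt i c 1) : ℝ →ᵃ[ℝ] Plane) t = pt i c t := by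
      intro t
      simp [AffineMap.lineMap_apply, pt]
      abel
    simp only [e] at this
    exact this.symm
  rw [himg, segment_eq_Icc hab]
  ext x
  constructor
  · rintro ⟨t, ht, rfl⟩
    exact pt_mem_axisSegment ht
  · rintro ⟨h1, h2, h3⟩
    exact ⟨x (1 - i), ⟨h2, h3⟩, by rw [← h1]; exact pt_eta i x⟩

/-- Turns the equalities of point sets in `Mesh.matching` into equations between coordinates. -/
theorem axisSegment_injective {i i' : Fin 2} {c c' a a' b b' : ℝ} (hab : a < b) (hab' : a' < b')
    (h : axisSegment i c a b = axisSegment i' c' a' b') : i = i' ∧ c = c' ∧ a = a' ∧ b = b' := by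
  have hi : i = i' := by
    by_contra hne
    have hi' : i' = 1 - i := by fin_cases i <;> fin_cases i' <;> simp_all
    subst hi'
    have h1 : pt i c a ∈ axisSegment (1 - i) c' a' b' := h ▸ pt_mem_axisSegment ⟨le_rfl, hab.le⟩
    have h2 : pt i c b ∈ axisSegment (1 - i) c' a' b' := h ▸ pt_mem_axisSegment ⟨hab.le, le_rfl⟩
    have h3 := h1.1
    have h4 := h2.1
    simp only [pt_other] at h3 h4
    linarith
  subst hi
  have h1 : pt i c a ∈ axisSegment i c' a' b' := h ▸ pt_mem_axisSegment ⟨le_rfl, hab.le⟩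
  have h2 : pt i c b ∈ axisSegment i c' a' b' := h ▸ pt_mem_axisSegment ⟨hab.le, le_rfl⟩
  have h3 : pt i c' a' ∈ axisSegment i c a b := h ▸ pt_mem_axisSegment ⟨le_rfl, hab'.le⟩
  have h4 : pt i c' b' ∈ axisSegment i c a b := h ▸ pt_mem_axisSegment ⟨hab'.le, le_rfl⟩
  simp only [axisSegment, Set.mem_ofPred_eq, pt_self, pt_other] at h1 h2 h3 h4
  exact ⟨rfl, h1.1, by linarith, by linarith⟩

namespace Square

theorem exists_of_mem_edges {T : Square} {S : Set Plane} (h : S ∈ T.edges) :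
    ∃ i c, (c = T.lo i ∨ c = T.hi i) ∧ S = axisSegment i c (T.lo (1 - i)) (T.hi (1 - i)) := by
  have h0 := (T.lo_lt_hi 0).le
  have h1 := (T.lo_lt_hi 1).le
  simp only [edges, Set.mem_insert_iff, Set.mem_singleton_iff, node_eq_pt, gridLine_zero,
    gridLine_two] at h
  have hs : ∀ s t, pt 0 s t = pt 1 t s := fun s t => (pt_swap 0 t s).symm
  rcases h with rfl | rfl | rfl | rfl
  · exact ⟨1, T.lo 1, Or.inl rfl, by rw [hs, hs]; exact segment_pt 1 _ h0⟩
  · exact ⟨1, T.hi 1, Or.inr rfl, by rw [hs, hs]; exact segment_pt 1 _ h0⟩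
  · exact ⟨0, T.lo 0, Or.inl rfl, segment_pt 0 _ h1⟩
  · exact ⟨0, T.hi 0, Or.inr rfl, segment_pt 0 _ h1⟩

theorem exists_of_mem_halfEdges {T : Square} {S : Set Plane} (h : S ∈ T.halfEdges) :
    ∃ i c, S = axisSegment i c (T.lo (1 - i)) (T.lo (1 - i) + T.side / 2) ∨
      S = axisSegment i c (T.lo (1 - i) + T.side / 2) (T.hi (1 - i)) := by
  have hp := T.side_pos
  have h0 : ∀ i, T.lo i ≤ T.lo i + T.side / 2 := fun i => by linarith
  have h1 : ∀ i, T.lo i + T.side / 2 ≤ T.hi i := fun i => by rw [hi_eq]; linarith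
  simp only [halfEdges, Set.mem_insert_iff, Set.mem_singleton_iff, node_eq_pt, gridLine_zero,
    gridLine_two, gridLine_one] at h
  have hs : ∀ s t, pt 0 s t = pt 1 t s := fun s t => (pt_swap 0 t s).symm
  rcases h with rfl | rfl | rfl | rfl | rfl | rfl | rfl | rfl
  · exact ⟨1, T.lo 1, Or.inl (by rw [hs, hs]; exact segment_pt 1 _ (h0 0))⟩
  · exact ⟨1, T.lo 1, Or.inr (by rw [hs, hs]; exact segment_pt 1 _ (h1 0))⟩
  · exact ⟨1, T.hi 1, Or.inl (by rw [hs, hs]; exact segment_pt 1 _ (h0 0))⟩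
  · exact ⟨1, T.hi 1, Or.inr (by rw [hs, hs]; exact segment_pt 1 _ (h1 0))⟩
  · exact ⟨0, T.lo 0, Or.inl (segment_pt 0 _ (h0 1))⟩
  · exact ⟨0, T.lo 0, Or.inr (segment_pt 0 _ (h1 1))⟩
  · exact ⟨0, T.hi 0, Or.inl (segment_pt 0 _ (h0 1))⟩
  · exact ⟨0, T.hi 0, Or.inr (segment_pt 0 _ (h1 1))⟩

/-- `T` is attached to an edge of the square `T'`, which is as large as `T` or twice as large;
the edge is orthogonal to the `i`-th axis. -/
def Attached (T T' : Square) (i : Fin 2) : Prop :=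
  (T'.lo i = T.hi i ∨ T'.hi i = T.lo i) ∧
    ((T.side = T'.side ∧ T.lo (1 - i) = T'.lo (1 - i)) ∨
      (T'.side = 2 * T.side ∧
        (T.lo (1 - i) = T'.lo (1 - i) ∨ T.lo (1 - i) = T'.lo (1 - i) + T.side)))

theorem Adjacent.symm {T T' : Square} (h : T.Adjacent T') : T'.Adjacent T := by
  rwa [Adjacent, Set.inter_comm]

theorem Attached.lo_le {T T' : Square} {i : Fin 2} (h : T.Attached T' i) :
    T'.lo (1 - i) ≤ T.lo (1 - i) := by
  have := T.side_pos
  rcases h.2 with h | ⟨_, h | h⟩ <;> linarith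

theorem Attached.le_hi {T T' : Square} {i : Fin 2} (h : T.Attached T' i) :
    T.hi (1 - i) ≤ T'.hi (1 - i) := by
  have := T.side_pos
  rw [hi_eq, hi_eq]
  rcases h.2 with h | ⟨_, h | h⟩ <;> linarith

theorem Attached.side_le {T T' : Square} {i : Fin 2} (h : T.Attached T' i) :
    T'.side ≤ 2 * T.side := by
  have := T.side_pos
  rcases h.2 with h | ⟨_, h | h⟩ <;> linarith

/-- The intersection is a product of intervals. If it is a single point, each interval is
degenerate, and its two equal ends cannot both come from `T'`, which has positive side. -/
theorem eq_lo_or_hi_of_not_adjacent {T T' : Square} (h : ¬T.Adjacent T') {x : Plane}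
    (hx : x ∈ T.carrier) (hx' : x ∈ T'.carrier) (i : Fin 2) : x i = T.lo i ∨ x i = T.hi i := by
  have hsub : ∀ y ∈ T.carrier ∩ T'.carrier, y = x := by
    rw [Adjacent, Set.not_nontrivial_iff] at h
    exact fun y hy => h hy ⟨hx, hx'⟩
  rw [← pt_eta i x] at hx hx'
  rw [pt_mem_carrier] at hx hx'
  have hm : ∀ t, max (T.lo i) (T'.lo i) ≤ t → t ≤ min (T.hi i) (T'.hi i) → t = x i := by
    intro t h1 h2
    rw [max_le_iff] at h1
    rw [le_min_iff] at h2
    have := hsub (pt i t (x (1 - i))) ⟨pt_mem_carrier.2 ⟨⟨h1.1, h2.1⟩, hx.2⟩,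
      pt_mem_carrier.2 ⟨⟨h1.2, h2.2⟩, hx'.2⟩⟩
    rw [← this, pt_self]
  have h3 := max_le hx.1.1 hx'.1.1
  have h4 := le_min hx.1.2 hx'.1.2
  have h1 := hm _ le_rfl (h3.trans h4)
  have h2 := hm _ (h3.trans h4) le_rfl
  rcases max_choice (T.lo i) (T'.lo i) with h5 | h5
  · left; linarith
  rcases min_choice (T.hi i) (T'.hi i) with h6 | h6
  · right; linarith
  · linarith [T'.lo_lt_hi i]

end Square

/-! ### Neighbouring elements and elements around a point. -/

namespace Mesh

variable {M : Mesh}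

theorem exists_separated {T T' : Square} (hT : T ∈ M.elems) (hT' : T' ∈ M.elems) (hne : T ≠ T') :
    ∃ i, T.hi i ≤ T'.lo i ∨ T'.hi i ≤ T.lo i :=
  Square.exists_separated (M.interior_disjoint T hT T' hT' hne)

theorem exists_attached {T T' : Square} (hT : T ∈ M.elems) (hT' : T' ∈ M.elems) (hne : T ≠ T')
    (hadj : T.Adjacent T') (hle : T.side ≤ T'.side) : ∃ i, T.Attached T' i := by
  obtain ⟨h1, h2⟩ := M.matching T hT T' hT' hne hadj hle
  obtain ⟨i, c, hc, hS⟩ := Square.exists_of_mem_edges h1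
  have hlt := T.lo_lt_hi (1 - i)
  have hp := T.side_pos
  have hp' := T'.side_pos
  have hmem : pt i c (T.lo (1 - i)) ∈ T.carrier ∩ T'.carrier := by
    rw [hS]; exact pt_mem_axisSegment ⟨le_rfl, hlt.le⟩
  have hm := Square.pt_mem_carrier.1 hmem.1
  have hm' := Square.pt_mem_carrier.1 hmem.2
  -- The intervals of the two squares on the `i`-th axis have only `c` in common, so one begins
  -- where the other ends.
  have huniq : ∀ s, s ∈ Set.Icc (T.lo i) (T.hi i) → s ∈ Set.Icc (T'.lo i) (T'.hi i) → s = c := by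
    intro s hs hs'
    have : pt i s (T.lo (1 - i)) ∈ T.carrier ∩ T'.carrier :=
      ⟨Square.pt_mem_carrier.2 ⟨hs, hm.2⟩, Square.pt_mem_carrier.2 ⟨hs', hm'.2⟩⟩
    rw [hS] at this
    simpa using this.1
  refine ⟨i, ?_, ?_⟩
  · rcases hc with hc | hc
    · right
      have := huniq (min (T.hi i) (T'.hi i))
        ⟨le_min (T.lo_lt_hi i).le (by linarith [hm'.1.2]), min_le_left _ _⟩
        ⟨le_min (hm'.1.1.trans hm.1.2) (T'.lo_lt_hi i).le, min_le_right _ _⟩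
      rcases min_choice (T.hi i) (T'.hi i) with h | h
      · linarith [T.lo_lt_hi i]
      · linarith
    · left
      have := huniq (max (T.lo i) (T'.lo i))
        ⟨le_max_left _ _, max_le (T.lo_lt_hi i).le (hm'.1.1.trans hm.1.2)⟩
        ⟨le_max_right _ _, max_le (hm.1.1.trans hm'.1.2) (T'.lo_lt_hi i).le⟩
      rcases max_choice (T.lo i) (T'.lo i) with h | h
      · linarith [T.lo_lt_hi i]
      · linarith
  · rcases h2 with h2 | h2
    · left
      obtain ⟨i', c', -, hS'⟩ := Square.exists_of_mem_edges h2
      obtain ⟨rfl, -, ha, hb⟩ := axisSegment_injective hlt (T'.lo_lt_hi _) (hS.symm.trans hS')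
      rw [Square.hi_eq, Square.hi_eq] at hb
      exact ⟨by linarith, ha⟩
    · right
      obtain ⟨i', c', hS' | hS'⟩ := Square.exists_of_mem_halfEdges h2
      · obtain ⟨rfl, -, ha, hb⟩ := axisSegment_injective hlt (by linarith) (hS.symm.trans hS')
        rw [Square.hi_eq] at hb
        exact ⟨by linarith, Or.inl ha⟩
      · obtain ⟨rfl, -, ha, hb⟩ := axisSegment_injective hlt (by rw [Square.hi_eq]; linarith)
          (hS.symm.trans hS')
        rw [Square.hi_eq, Square.hi_eq] at hb
        exact ⟨by linarith, Or.inr (by linarith)⟩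

/-- At a point in the relative interior of the common boundary of two elements there is no third
element. -/
theorem eq_of_mem_three {T T' K : Square} (hT : T ∈ M.elems) (hT' : T' ∈ M.elems)
    (hK : K ∈ M.elems) {i : Fin 2} (hi : T'.lo i = T.hi i ∨ T'.hi i = T.lo i)
    (hKT : K ≠ T) (hKT' : K ≠ T') {x : Plane} (hx : x ∈ T.carrier) (hx' : x ∈ T'.carrier)
    (hxK : x ∈ K.carrier) (hlo : T.lo (1 - i) < x (1 - i)) (hhi : x (1 - i) < T.hi (1 - i))
    (hlo' : T'.lo (1 - i) < x (1 - i)) (hhi' : x (1 - i) < T'.hi (1 - i)) : False := by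
  have k1 := hxK i
  have k2 := hxK (1 - i)
  have t1 := hx i
  have t1' := hx' i
  change K.lo i ≤ x i ∧ x i ≤ K.hi i at k1
  change K.lo (1 - i) ≤ x (1 - i) ∧ x (1 - i) ≤ K.hi (1 - i) at k2
  change T.lo i ≤ x i ∧ x i ≤ T.hi i at t1
  change T'.lo i ≤ x i ∧ x i ≤ T'.hi i at t1'
  have hl := T.lo_lt_hi i
  have hl' := T'.lo_lt_hi i
  have hlK := K.lo_lt_hi i
  -- Since `x` lies strictly inside the extent of `T` along the other axis, only the `i`-th axis can
  -- separate `K` from `T`; the same holds for `T'`. As `T` and `T'` occupy both sides of the line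
  -- through `x`, no thickness is left for `K`.
  have e1 : K.hi i ≤ T.lo i ∨ T.hi i ≤ K.lo i := by
    obtain ⟨j, hj⟩ := exists_separated hK hT hKT
    rcases (show j = i ∨ j = 1 - i by fin_cases i <;> fin_cases j <;> simp) with rfl | rfl
    · exact hj
    · rcases hj with hj | hj <;> linarith
  have e2 : K.hi i ≤ T'.lo i ∨ T'.hi i ≤ K.lo i := by
    obtain ⟨j, hj⟩ := exists_separated hK hT' hKT'
    rcases (show j = i ∨ j = 1 - i by fin_cases i <;> fin_cases j <;> simp) with rfl | rfl
    · exact hj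
    · rcases hj with hj | hj <;> linarith
  rcases hi with hi | hi <;> rcases e1 with e1 | e1 <;> rcases e2 with e2 | e2 <;> linarith

/-- An element at `z` is determined by the axes along which it extends beyond `z` in the positive
direction: two elements that are separated along an axis and contain `z` lie on opposite sides of
it. There are four such patterns. -/
theorem card_elems_at_le (M : Mesh) (z : Plane) :
    Nat.card {K : Square // K ∈ M.elems ∧ z ∈ K.carrier} ≤ 4 := by
  classical
  let φ : {K : Square // K ∈ M.elems ∧ z ∈ K.carrier} → (Fin 2 → Bool) := fun K i =>
    decide (z i < K.1.hi i)
  have hφ : Function.Injective φ := by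
    intro K K' h
    by_contra hne
    obtain ⟨i, hi⟩ := exists_separated K.2.1 K'.2.1 (fun h => hne (Subtype.ext h))
    have h1 := congrFun h i
    simp only [φ, decide_eq_decide] at h1
    have h2 : K.1.lo i ≤ z i ∧ z i ≤ K.1.hi i := K.2.2 i
    have h3 : K'.1.lo i ≤ z i ∧ z i ≤ K'.1.hi i := K'.2.2 i
    have h4 := K.1.lo_lt_hi i
    have h5 := K'.1.lo_lt_hi i
    rcases hi with hi | hi
    · linarith [h1.2 (by linarith)]
    · linarith [h1.1 (by linarith)]
  have := Nat.card_le_card_of_injective φ hφ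
  simpa using this

/-- By `no_pinch`, adjacency connects the elements at `z`. They are at most four, so a path without
repetitions has fewer than four steps, and the triangle inequality along it gives the bound. -/
theorem edist_le_of_mem {E : Type*} [PseudoEMetricSpace E] (a : Square → E) (c : ℝ≥0∞) {z : Plane}
    (h : ∀ A ∈ M.elems, ∀ B ∈ M.elems, z ∈ A.carrier → z ∈ B.carrier → A ≠ B → A.Adjacent B →
      edist (a A) (a B) ≤ c) {K K' : Square} (hK : K ∈ M.elems) (hK' : K' ∈ M.elems)
    (hz : z ∈ K.carrier) (hz' : z ∈ K'.carrier) : edist (a K) (a K') ≤ 4 * c := by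
  classical
  have : Finite {K : Square // K ∈ M.elems ∧ z ∈ K.carrier} :=
    M.finite.subset (fun _ h => h.1)
  have := Fintype.ofFinite {K : Square // K ∈ M.elems ∧ z ∈ K.carrier}
  let Γ : SimpleGraph {K : Square // K ∈ M.elems ∧ z ∈ K.carrier} :=
    { Adj := fun A B => A ≠ B ∧ A.1.Adjacent B.1
      symm := ⟨fun A B h => ⟨h.1.symm, h.2.symm⟩⟩
      loopless := ⟨fun A h => h.1 rfl⟩ }
  have hreach : ∀ B : Square, Relation.ReflTransGen (fun A B : Square => A ∈ M.elems ∧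
      B ∈ M.elems ∧ z ∈ A.carrier ∧ z ∈ B.carrier ∧ A.Adjacent B) K B →
      ∃ hB : B ∈ M.elems ∧ z ∈ B.carrier, Γ.Reachable ⟨K, hK, hz⟩ ⟨B, hB⟩ := by
    intro B hB
    induction hB with
    | refl => exact ⟨⟨hK, hz⟩, SimpleGraph.Reachable.refl _⟩
    | @tail B C _ hBC ih =>
      obtain ⟨hB, hr⟩ := ih
      refine ⟨⟨hBC.2.1, hBC.2.2.2.1⟩, ?_⟩
      by_cases hne : B = C
      · subst hne; exact hr
      · exact hr.trans (SimpleGraph.Adj.reachable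
          ⟨fun h => hne (congrArg Subtype.val h), hBC.2.2.2.2⟩)
  obtain ⟨_, hr⟩ := hreach K' (M.no_pinch z K hK K' hK' hz hz')
  obtain ⟨w, hw⟩ := hr.exists_isPath
  have hlen : w.length < 4 :=
    hw.length_lt.trans_le (by rw [← Nat.card_eq_fintype_card]; exact M.card_elems_at_le z)
  have hwalk : ∀ {A B} (w : Γ.Walk A B), edist (a A.1) (a B.1) ≤ w.length * c := by
    intro A B w
    induction w with
    | nil => simp
    | @cons A B C hAB w ih =>
      refine (edist_triangle _ (a B.1) _).trans ?_
      rw [SimpleGraph.Walk.length_cons, Nat.cast_add, Nat.cast_one, add_mul, one_mul, add_comm]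
      exact add_le_add ih (h _ A.2.1 _ B.2.1 A.2.2 B.2.2
        (fun h => hAB.1 (Subtype.ext h)) hAB.2)
  refine (hwalk w).trans ?_
  gcongr
  exact_mod_cast hlen.le

end Mesh

/-! ### Bi-quadratic interpolation -/

theorem lagrangeBasis_node (a b : Fin 3) :
    lagrangeBasis a (((b : ℕ) : ℝ) / 2) = if a = b then 1 else 0 := by
  fin_cases a <;> fin_cases b <;> norm_num [lagrangeBasis]

theorem sum_lagrangeBasis (t : ℝ) : ∑ a, lagrangeBasis a t = 1 := by
  simp only [lagrangeBasis, Fin.sum_univ_three, Matrix.cons_val]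
  ring

/-- Quadratic interpolation is exact on quadratics, and these stay quadratic under an affine change
of variable. With the change of variable from a small edge to a large one, this gives continuity
across half edges. -/
theorem sum_lagrangeBasis_mul_affine (c : Fin 3) (α β t : ℝ) :
    ∑ b, lagrangeBasis b t * lagrangeBasis c (α + β * (((b : ℕ) : ℝ) / 2)) =
      lagrangeBasis c (α + β * t) := by
  fin_cases c <;> simp [lagrangeBasis, Fin.sum_univ_three] <;> ring

theorem abs_lagrangeBasis_le {a : Fin 3} {t : ℝ} (ht : t ∈ Set.Icc (0 : ℝ) 1) :
    |lagrangeBasis a t| ≤ 1 := by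
  obtain ⟨h0, h1⟩ := ht
  rw [abs_le]
  fin_cases a <;> simp [lagrangeBasis] <;> constructor <;> nlinarith [sq_nonneg (2 * t - 1)]

namespace Square

/-- The coordinates with respect to the element. -/
def localCoord (T : Square) (i : Fin 2) (x : Plane) : ℝ := (x i - T.corner i) / T.side

theorem localCoord_of_eq_gridLine {T : Square} {i : Fin 2} {x : Plane} {a : Fin 3}
    (h : x i = T.gridLine i a) : T.localCoord i x = ((a : ℕ) : ℝ) / 2 := by
  have := T.side_pos.ne'
  rw [localCoord, h, gridLine]
  field_simp
  ring

theorem localCoord_mem {T : Square} {x : Plane} (hx : x ∈ T.carrier) (i : Fin 2) :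
    T.localCoord i x ∈ Set.Icc (0 : ℝ) 1 := by
  have h := hx i
  have hp := T.side_pos
  constructor
  · exact div_nonneg (by linarith) hp.le
  · rw [localCoord, div_le_one hp]; linarith

end Square

theorem interpolant_eq (i : Fin 2) (T : Square) (U : Plane → Plane) (x : Plane) :
    interpolant T U x = ∑ a, ∑ b, (lagrangeBasis a (T.localCoord i x) *
      lagrangeBasis b (T.localCoord (1 - i) x)) • U (pt i (T.gridLine i a) (T.gridLine (1 - i) b)) := by
  have h0 : interpolant T U x = ∑ a, ∑ b, (lagrangeBasis a (T.localCoord 0 x) *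
      lagrangeBasis b (T.localCoord 1 x)) • U (pt 0 (T.gridLine 0 a) (T.gridLine 1 b)) := by
    simp only [interpolant, Square.node_eq_pt]
    rfl
  rcases (show i = 0 ∨ i = 1 by fin_cases i <;> simp) with rfl | rfl
  · exact h0
  · rw [h0, Finset.sum_comm]
    refine Finset.sum_congr rfl fun b _ => Finset.sum_congr rfl fun a _ => ?_
    rw [mul_comm]
    congr 2
    exact pt_swap 1 _ _

/-- On a line through nodes the basis functions of all other parallel lines vanish; hence the trace
on an edge depends only on the three nodal values there. -/
theorem interpolant_of_eq_gridLine {i : Fin 2} {T : Square} {U : Plane → Plane} {x : Plane}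
    {a : Fin 3} (h : x i = T.gridLine i a) :
    interpolant T U x = ∑ b, lagrangeBasis b (T.localCoord (1 - i) x) •
      U (pt i (x i) (T.gridLine (1 - i) b)) := by
  rw [interpolant_eq i, Finset.sum_eq_single a]
  · rw [Square.localCoord_of_eq_gridLine h, lagrangeBasis_node, h]
    simp
  · intro a' _ ha'
    rw [Square.localCoord_of_eq_gridLine h, lagrangeBasis_node, if_neg ha']
    simp
  · simp

theorem interpolant_node {i : Fin 2} {T : Square} {U : Plane → Plane} {x : Plane}
    {a b : Fin 3} (h : x i = T.gridLine i a) (h' : x (1 - i) = T.gridLine (1 - i) b) :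
    interpolant T U x = U x := by
  rw [interpolant_of_eq_gridLine h, Finset.sum_eq_single b]
  · rw [Square.localCoord_of_eq_gridLine h', lagrangeBasis_node, ← h', pt_eta]
    simp
  · intro b' _ hb'
    rw [Square.localCoord_of_eq_gridLine h', lagrangeBasis_node, if_neg hb']
    simp
  · simp

theorem continuous_lagrangeBasis (a : Fin 3) : Continuous (lagrangeBasis a) := by
  change Continuous fun t => lagrangeBasis a t
  fin_cases a <;> simp only [lagrangeBasis] <;> simp <;> fun_prop

theorem Square.continuous_localCoord (T : Square) (i : Fin 2) : Continuous (T.localCoord i) := by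
  unfold Square.localCoord; fun_prop

theorem continuous_interpolant (T : Square) (U : Plane → Plane) : Continuous (interpolant T U) := by
  have : interpolant T U = fun x => _ := funext fun x => interpolant_eq 0 T U x
  rw [this]
  exact continuous_finsetSum _ fun a _ => continuous_finsetSum _ fun b _ =>
    (((continuous_lagrangeBasis a).comp (T.continuous_localCoord 0)).mul
      ((continuous_lagrangeBasis b).comp (T.continuous_localCoord _))).smul continuous_const

/-- The nine basis functions sum to 1 and are bounded by 1 on the element. -/
theorem enorm_interpolant_sub_le {T : Square} {U : Plane → Plane} {x c : Plane} {e : ℝ≥0∞}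
    (hx : x ∈ T.carrier) (hU : ∀ a b, ‖U (T.node a b) - c‖ₑ ≤ e) :
    ‖interpolant T U x - c‖ₑ ≤ 9 * e := by
  have hc : c = ∑ a, ∑ b, (lagrangeBasis a (T.localCoord 0 x) *
      lagrangeBasis b (T.localCoord 1 x)) • c := by
    simp_rw [← Finset.sum_smul, ← Finset.mul_sum, sum_lagrangeBasis, mul_one, sum_lagrangeBasis,
      one_smul]
  have he : interpolant T U x - c = ∑ a, ∑ b, (lagrangeBasis a (T.localCoord 0 x) *
      lagrangeBasis b (T.localCoord 1 x)) • (U (T.node a b) - c) := by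
    conv_lhs => rw [hc]
    simp_rw [smul_sub, Finset.sum_sub_distrib]
    rfl
  have hl : ∀ a b, ‖(lagrangeBasis a (T.localCoord 0 x) *
      lagrangeBasis b (T.localCoord 1 x)) • (U (T.node a b) - c)‖ₑ ≤ e := by
    intro a b
    rw [enorm_smul]
    refine (mul_le_mul_left (?_ : _ ≤ (1 : ℝ≥0∞)) _).trans ((one_mul _).trans_le (hU a b))
    rw [Real.enorm_eq_ofReal_abs, ENNReal.ofReal_le_one, abs_mul]
    exact mul_le_one₀ (abs_lagrangeBasis_le (Square.localCoord_mem hx 0)) (abs_nonneg _)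
      (abs_lagrangeBasis_le (Square.localCoord_mem hx 1))
  rw [he]
  calc _ ≤ ∑ a : Fin 3, ‖∑ b, (lagrangeBasis a (T.localCoord 0 x) *
      lagrangeBasis b (T.localCoord 1 x)) • (U (T.node a b) - c)‖ₑ := enorm_sum_le _ _
    _ ≤ ∑ a : Fin 3, ∑ b : Fin 3, e :=
        Finset.sum_le_sum fun a _ => (enorm_sum_le _ _).trans (Finset.sum_le_sum fun b _ => hl a b)
    _ = 9 * e := by
        simp only [Finset.sum_const, Finset.card_univ, Fintype.card_fin, nsmul_eq_mul]
        rw [← mul_assoc]; norm_num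

theorem exists_lagrangeBasis_coeff (a : Fin 3) (c h : ℝ) :
    ∃ p : Fin 3 → ℝ, ∀ x : ℝ, lagrangeBasis a ((x - c) / h) = ∑ k : Fin 3, x ^ (k : ℕ) * p k := by
  have key : ∀ q : Fin 3 → ℝ, ∃ p : Fin 3 → ℝ, ∀ x : ℝ,
      q 0 + q 1 * ((x - c) / h) + q 2 * ((x - c) / h) ^ 2 = ∑ k : Fin 3, x ^ (k : ℕ) * p k := by
    intro q
    refine ⟨![q 0 - q 1 * (c * h⁻¹) + q 2 * (c * h⁻¹) ^ 2, q 1 * h⁻¹ - 2 * q 2 * h⁻¹ * (c * h⁻¹),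
      q 2 * h⁻¹ ^ 2], fun x => ?_⟩
    simp [Fin.sum_univ_three, div_eq_mul_inv]
    ring
  obtain ⟨p, hp⟩ := key (![![1, -3, 2], ![0, 4, -4], ![0, -1, 2]] a)
  refine ⟨p, fun x => ?_⟩
  rw [← hp]
  fin_cases a <;> simp [lagrangeBasis] <;> ring

theorem isBiquadraticOn_interpolant (T : Square) (U : Plane → Plane) (S : Set Plane) :
    IsBiquadraticOn (interpolant T U) S := by
  choose p hp using fun a => exists_lagrangeBasis_coeff a (T.corner 0) T.side
  choose p' hp' using fun a => exists_lagrangeBasis_coeff a (T.corner 1) T.side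
  refine ⟨fun k l => ∑ a, ∑ b, (p a k * p' b l) • U (T.node a b), fun x _ => ?_⟩
  simp only [interpolant, hp, hp', Finset.sum_mul_sum, Finset.sum_smul, Finset.smul_sum, smul_smul]
  refine (Finset.sum_congr rfl fun a _ => Finset.sum_comm).trans ?_
  rw [Finset.sum_comm]
  refine Finset.sum_congr rfl fun k _ => ?_
  refine (Finset.sum_congr rfl fun a _ => Finset.sum_comm).trans ?_
  rw [Finset.sum_comm]
  refine Finset.sum_congr rfl fun l _ => Finset.sum_congr rfl fun a _ =>
    Finset.sum_congr rfl fun b _ => ?_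
  congr 1
  ring

/-! ### Conforming finite element functions from nodal values -/

open Classical in
/-- The value at a node of `T` of the finite element function with the free nodal values `A`:
at the nodes on the edge of a larger neighbour it is determined by the values on that edge. -/
def nodalField (M : Mesh) (A : Plane → Plane) (T : Square) (z : Plane) : Plane :=
  if h : ∃ K ∈ M.elems, T.side < K.side ∧ T.Adjacent K ∧ z ∈ K.carrier then
    interpolant h.choose A z else A z

open Classical in
/-- The finite element function with the free nodal values `A`. -/
def feFunction (M : Mesh) (A : Plane → Plane) (x : Plane) : Plane :=
  if h : ∃ T ∈ M.elems, x ∈ T.carrier then interpolant h.choose (nodalField M A h.choose) x else 0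

section Conforming

variable {M : Mesh} {A : Plane → Plane}

theorem nodalField_cases (M : Mesh) (A : Plane → Plane) (T : Square) (z : Plane) :
    (nodalField M A T z = A z ∧
      ¬∃ K ∈ M.elems, T.side < K.side ∧ T.Adjacent K ∧ z ∈ K.carrier) ∨
    ∃ K ∈ M.elems, T.side < K.side ∧ T.Adjacent K ∧ z ∈ K.carrier ∧
      nodalField M A T z = interpolant K A z := by
  unfold nodalField
  split_ifs with h
  · exact Or.inr ⟨h.choose, h.choose_spec.1, h.choose_spec.2.1, h.choose_spec.2.2.1,
      h.choose_spec.2.2.2, rfl⟩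
  · exact Or.inl ⟨rfl, h⟩

theorem Square.Attached.exists_gridLine {T T' : Square} {i : Fin 2} (h : T.Attached T' i)
    {x : Plane} (hx : x ∈ T.carrier) (hx' : x ∈ T'.carrier) :
    (x i = T.lo i ∨ x i = T.hi i) ∧ (x i = T'.lo i ∨ x i = T'.hi i) := by
  have h1 : T.lo i ≤ x i ∧ x i ≤ T.hi i := hx i
  have h2 : T'.lo i ≤ x i ∧ x i ≤ T'.hi i := hx' i
  rcases h.1 with h | h
  · exact ⟨Or.inr (by linarith), Or.inl (by linarith)⟩
  · exact ⟨Or.inl (by linarith), Or.inr (by linarith)⟩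

theorem Square.exists_gridLine_of_lo_or_hi {T : Square} {i : Fin 2} {t : ℝ}
    (h : t = T.lo i ∨ t = T.hi i) : ∃ a, t = T.gridLine i a := by
  rcases h with h | h
  · exact ⟨0, by simpa using h⟩
  · exact ⟨2, by simpa using h⟩

/-- The larger square is exactly twice as large, so the end points of the small edge are an end
point and the midpoint of the large edge, hence nodes of `T'`. -/
theorem interpolant_of_corner_of_attached {T T' : Square} {i : Fin 2} (h : T.Attached T' i)
    (hs : T.side < T'.side) (U : Plane → Plane) {x : Plane} (hx : x ∈ T.carrier)
    (hx' : x ∈ T'.carrier) (hc : x (1 - i) = T.lo (1 - i) ∨ x (1 - i) = T.hi (1 - i)) :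
    interpolant T' U x = U x := by
  obtain ⟨a, ha⟩ := Square.exists_gridLine_of_lo_or_hi (h.exists_gridLine hx hx').2
  have hb : ∃ b, x (1 - i) = T'.gridLine (1 - i) b := by
    rcases h.2 with h2 | ⟨h2, h3⟩
    · exact absurd h2.1 hs.ne
    · rcases hc with hc | hc <;> rcases h3 with h3 | h3 <;> rw [hc]
      · exact ⟨0, by simp [h3]⟩
      · exact ⟨1, by rw [h3, Square.gridLine_one]; linarith⟩
      · exact ⟨1, by rw [Square.hi_eq, h3, Square.gridLine_one]; linarith⟩
      · exact ⟨2, by rw [Square.hi_eq, h3, Square.gridLine_two, Square.hi_eq]; linarith⟩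
  obtain ⟨b, hb⟩ := hb
  exact interpolant_node ha hb

/-- A vertex of `T` on an edge of a larger neighbour is a node of that neighbour, so the constraint
imposes nothing new. Only edge midpoints are really constrained. -/
theorem nodalField_corner {T : Square} (hT : T ∈ M.elems) {x : Plane} (hx : x ∈ T.carrier)
    (hc : ∀ i, x i = T.lo i ∨ x i = T.hi i) : nodalField M A T x = A x := by
  rcases nodalField_cases M A T x with h | ⟨K, hK, hs, hadj, hxK, h⟩
  · exact h.1
  · obtain ⟨i, hi⟩ := M.exists_attached hT hK (fun h => by rw [h] at hs; exact lt_irrefl _ hs)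
      hadj hs.le
    rw [h]
    exact interpolant_of_corner_of_attached hi hs A hx hxK (hc _)

theorem interpolant_corner {T : Square} (hT : T ∈ M.elems) {x : Plane} (hx : x ∈ T.carrier)
    (hc : ∀ i, x i = T.lo i ∨ x i = T.hi i) : interpolant T (nodalField M A T) x = A x := by
  obtain ⟨a, ha⟩ := Square.exists_gridLine_of_lo_or_hi (hc 0)
  obtain ⟨b, hb⟩ := Square.exists_gridLine_of_lo_or_hi (hc 1)
  rw [interpolant_node (i := 0) ha hb, nodalField_corner hT hx hc]

theorem nodalField_edge_corner {T : Square} (hT : T ∈ M.elems) {i : Fin 2} {s : ℝ}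
    (hs : s = T.lo i ∨ s = T.hi i) {b : Fin 3} (hb : b ≠ 1) :
    nodalField M A T (pt i s (T.gridLine (1 - i) b)) = A (pt i s (T.gridLine (1 - i) b)) := by
  have hsm : s ∈ Set.Icc (T.lo i) (T.hi i) := by
    have := (T.lo_lt_hi i).le
    rcases hs with rfl | rfl
    · exact ⟨le_rfl, this⟩
    · exact ⟨this, le_rfl⟩
  refine nodalField_corner hT (Square.pt_mem_carrier.2 ⟨hsm, T.gridLine_mem _ _⟩) ?_
  refine (forall_axis i).2 ⟨by simpa using hs, ?_⟩
  fin_cases b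
  · simp
  · simp at hb
  · simp

/-- The elements have the same nodes on the common edge. No third element contains its midpoint, so
there, as at the end points, both use the free value. -/
theorem interpolant_eq_of_equal_side {T T' : Square} (hT : T ∈ M.elems) (hT' : T' ∈ M.elems)
    {i : Fin 2} (h : T.Attached T' i) (hs : T.side = T'.side)
    (hlo : T.lo (1 - i) = T'.lo (1 - i)) {x : Plane} (hx : x ∈ T.carrier) (hx' : x ∈ T'.carrier) :
    interpolant T (nodalField M A T) x = interpolant T' (nodalField M A T') x := by
  obtain ⟨h1, h2⟩ := h.exists_gridLine hx hx'
  obtain ⟨a, ha⟩ := Square.exists_gridLine_of_lo_or_hi h1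
  obtain ⟨a', ha'⟩ := Square.exists_gridLine_of_lo_or_hi h2
  have hg : ∀ b, T.gridLine (1 - i) b = T'.gridLine (1 - i) b := by
    intro b
    unfold Square.lo at hlo
    rw [Square.gridLine, Square.gridLine, hlo, hs]
  have hl : T.localCoord (1 - i) x = T'.localCoord (1 - i) x := by
    unfold Square.lo at hlo
    rw [Square.localCoord, Square.localCoord, hlo, hs]
  rw [interpolant_of_eq_gridLine ha, interpolant_of_eq_gridLine ha', hl]
  refine Finset.sum_congr rfl fun b _ => ?_
  congr 1
  by_cases hb : b = 1
  · subst hb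
    have hp := T.side_pos
    have hm : T.gridLine (1 - i) 1 = T.lo (1 - i) + T.side / 2 := T.gridLine_one _
    have hm' : T'.gridLine (1 - i) 1 = T'.lo (1 - i) + T'.side / 2 := T'.gridLine_one _
    have hzT : pt i (x i) (T.gridLine (1 - i) 1) ∈ T.carrier :=
      Square.pt_mem_carrier.2 ⟨hx i, T.gridLine_mem _ _⟩
    have hzT' : pt i (x i) (T.gridLine (1 - i) 1) ∈ T'.carrier := by
      rw [hg]; exact Square.pt_mem_carrier.2 ⟨hx' i, T'.gridLine_mem _ _⟩
    have hno : ∀ K ∈ M.elems, T.side < K.side →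
        pt i (x i) (T.gridLine (1 - i) 1) ∈ K.carrier → False := by
      intro K hK hKs hz
      refine Mesh.eq_of_mem_three hT hT' hK h.1 (fun h => by rw [h] at hKs; exact lt_irrefl _ hKs)
        (fun h => by rw [h, hs] at hKs; exact lt_irrefl _ hKs) hzT hzT' hz ?_ ?_ ?_ ?_ <;>
      simp only [pt_other, Square.hi_eq] <;> linarith
    have e1 : nodalField M A T (pt i (x i) (T.gridLine (1 - i) 1)) =
        A (pt i (x i) (T.gridLine (1 - i) 1)) := by
      rcases nodalField_cases M A T (pt i (x i) (T.gridLine (1 - i) 1)) with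
        h | ⟨K, hK, hKs, -, hz, -⟩
      · exact h.1
      · exact (hno K hK hKs hz).elim
    have e2 : nodalField M A T' (pt i (x i) (T.gridLine (1 - i) 1)) =
        A (pt i (x i) (T.gridLine (1 - i) 1)) := by
      rcases nodalField_cases M A T' (pt i (x i) (T.gridLine (1 - i) 1)) with
        h | ⟨K, hK, hKs, -, hz, -⟩
      · exact h.1
      · exact (hno K hK (hs.trans_lt hKs) hz).elim
    rw [← hg, e1, e2]
  · rw [nodalField_edge_corner hT h1 hb, nodalField_edge_corner hT' h2 hb, hg]

/-- On an edge that faces a smaller element, the larger one uses free values only. Otherwise the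
midpoint would lie on a still larger `K`, attached along the same edge and covering it; then `T`,
`T'` and `K` would meet in the relative interior of an edge of `T`. -/
theorem interpolant_large_eq {T T' : Square} (hT : T ∈ M.elems) (hT' : T' ∈ M.elems)
    {i : Fin 2} (h : T.Attached T' i) (hs : T.side < T'.side) {x : Plane} (hx : x ∈ T.carrier)
    (hx' : x ∈ T'.carrier) :
    interpolant T' (nodalField M A T') x = interpolant T' A x := by
  obtain ⟨h1, h2⟩ := h.exists_gridLine hx hx'
  obtain ⟨a', ha'⟩ := Square.exists_gridLine_of_lo_or_hi h2
  rw [interpolant_of_eq_gridLine ha', interpolant_of_eq_gridLine ha']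
  refine Finset.sum_congr rfl fun b _ => ?_
  congr 1
  by_cases hb : b = 1
  · subst hb
    have hp := T.side_pos
    have hm := T.gridLine_one (1 - i)
    have hm' := T'.gridLine_one (1 - i)
    rcases nodalField_cases M A T' (pt i (x i) (T'.gridLine (1 - i) 1)) with
      hc | ⟨K, hK, hKs, hadj, hz, -⟩
    · exact hc.1
    exfalso
    have hne : T' ≠ K := fun h => by rw [h] at hKs; exact lt_irrefl _ hKs
    obtain ⟨j, hj⟩ := M.exists_attached hT' hK hne hadj hKs.le
    have hzi := hz i
    have hzj := hz (1 - i)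
    change K.lo i ≤ _ ∧ _ ≤ K.hi i at hzi
    change K.lo (1 - i) ≤ _ ∧ _ ≤ K.hi (1 - i) at hzj
    simp only [pt_self, pt_other] at hzi hzj
    have hji : j = i := by
      rcases (show j = i ∨ j = 1 - i by fin_cases i <;> fin_cases j <;> simp) with hji | hji
      · exact hji
      · exfalso
        subst hji
        rcases hj.1 with h3 | h3
        · rw [Square.hi_eq] at h3; linarith
        · linarith
    subst hji
    have h5 := hj.lo_le
    have h6 := hj.le_hi
    have h7 := h.lo_le
    have h8 := h.le_hi
    have h9 := T.hi_eq (1 - j)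
    have hmem : ∀ S : Square, x j ∈ Set.Icc (S.lo j) (S.hi j) → S.lo (1 - j) ≤ T.lo (1 - j) →
        T.hi (1 - j) ≤ S.hi (1 - j) → pt j (x j) (T.gridLine (1 - j) 1) ∈ S.carrier := by
      intro S hS1 hS2 hS3
      exact Square.pt_mem_carrier.2 ⟨hS1, by linarith, by linarith⟩
    -- The point to test is the midpoint of the edge of `T`: the midpoint of the edge of `T'` may be
    -- a vertex of `T`.
    refine Mesh.eq_of_mem_three hT hT' hK h.1
      (fun h => by rw [h] at hKs; exact lt_asymm hs hKs) hne.symm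
      (hmem T (hx j) le_rfl le_rfl) (hmem T' (hx' j) h7 h8)
      (hmem K hzi (h5.trans h7) (h8.trans h6)) ?_ ?_ ?_ ?_ <;>
    simp only [pt_other] <;> linarith
  · exact nodalField_edge_corner hT' h2 hb

/-- All three nodal values of `T` on the edge are values of the interpolant on `T'`: at the end
points because they are nodes of `T'`, at the midpoint by the constraint, whose larger neighbour can
only be `T'`. Both traces are quadratic along the edge, so they agree. -/
theorem interpolant_small_eq {T T' : Square} (hT : T ∈ M.elems) (hT' : T' ∈ M.elems)
    {i : Fin 2} (h : T.Attached T' i) (hadj : T.Adjacent T') (hs : T.side < T'.side) {x : Plane}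
    (hx : x ∈ T.carrier) (hx' : x ∈ T'.carrier) :
    interpolant T (nodalField M A T) x = interpolant T' A x := by
  obtain ⟨h1, h2⟩ := h.exists_gridLine hx hx'
  obtain ⟨a, ha⟩ := Square.exists_gridLine_of_lo_or_hi h1
  obtain ⟨a', ha'⟩ := Square.exists_gridLine_of_lo_or_hi h2
  have hp := T.side_pos
  have hp' := T'.side_pos
  have hm := T.gridLine_one (1 - i)
  have h7 := h.lo_le
  have h8 := h.le_hi
  have h9 := T.hi_eq (1 - i)
  have hzT : ∀ b, pt i (x i) (T.gridLine (1 - i) b) ∈ T.carrier := fun b =>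
    Square.pt_mem_carrier.2 ⟨hx i, T.gridLine_mem _ _⟩
  have hzT' : ∀ b, pt i (x i) (T.gridLine (1 - i) b) ∈ T'.carrier := fun b =>
    Square.pt_mem_carrier.2 ⟨hx' i, h7.trans (T.gridLine_mem _ _).1, (T.gridLine_mem _ _).2.trans h8⟩
  have hn : ∀ b, nodalField M A T (pt i (x i) (T.gridLine (1 - i) b)) =
      interpolant T' A (pt i (x i) (T.gridLine (1 - i) b)) := by
    intro b
    by_cases hb : b = 1
    · subst hb
      rcases nodalField_cases M A T (pt i (x i) (T.gridLine (1 - i) 1)) with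
        hc | ⟨K, hK, hKs, -, hz, hc⟩
      · exact absurd ⟨T', hT', hs, hadj, hzT' 1⟩ hc.2
      · rw [hc]
        by_cases hKT : K = T'
        · rw [hKT]
        · exfalso
          refine Mesh.eq_of_mem_three hT hT' hK h.1
            (fun h => by rw [h] at hKs; exact lt_irrefl _ hKs) hKT (hzT 1) (hzT' 1) hz ?_ ?_ ?_ ?_ <;>
          simp only [pt_other] <;> linarith
    · rw [nodalField_edge_corner hT h1 hb]
      refine (interpolant_of_corner_of_attached h hs A (hzT b) (hzT' b) ?_).symm
      fin_cases b
      · simp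
      · simp at hb
      · simp
  rw [interpolant_of_eq_gridLine ha, interpolant_of_eq_gridLine ha']
  have hb : ∀ b, interpolant T' A (pt i (x i) (T.gridLine (1 - i) b)) =
      ∑ c, lagrangeBasis c (T'.localCoord (1 - i) (pt i (x i) (T.gridLine (1 - i) b))) •
        A (pt i (x i) (T'.gridLine (1 - i) c)) := by
    intro b
    rw [interpolant_of_eq_gridLine (i := i) (a := a') (by rw [pt_self, ha']), pt_self]
  simp only [hn, hb, Finset.smul_sum, smul_smul]
  rw [Finset.sum_comm]
  refine Finset.sum_congr rfl fun c _ => ?_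
  rw [← Finset.sum_smul]
  congr 1
  have e1 : ∀ b : Fin 3, T'.localCoord (1 - i) (pt i (x i) (T.gridLine (1 - i) b)) =
      (T.corner (1 - i) - T'.corner (1 - i)) / T'.side + T.side / T'.side * (((b : ℕ) : ℝ) / 2) := by
    intro b
    rw [Square.localCoord, pt_other, Square.gridLine]
    field_simp
    ring
  have e2 : T'.localCoord (1 - i) x = (T.corner (1 - i) - T'.corner (1 - i)) / T'.side +
      T.side / T'.side * T.localCoord (1 - i) x := by
    rw [Square.localCoord, Square.localCoord]
    field_simp
    ring
  simp only [e1, e2]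
  exact sum_lagrangeBasis_mul_affine c _ _ _

/-- Across a common edge this is one of the cases above. Elements that are not adjacent meet only in
a common vertex, where both take the free value. -/
theorem interpolant_nodalField_consistent {T T' : Square} (hT : T ∈ M.elems) (hT' : T' ∈ M.elems)
    {x : Plane} (hx : x ∈ T.carrier) (hx' : x ∈ T'.carrier) :
    interpolant T (nodalField M A T) x = interpolant T' (nodalField M A T') x := by
  wlog hle : T.side ≤ T'.side generalizing T T'
  · exact (this hT' hT hx' hx (le_of_not_ge hle)).symm
  by_cases hne : T = T'
  · rw [hne]
  by_cases hadj : T.Adjacent T'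
  · obtain ⟨i, h⟩ := M.exists_attached hT hT' hne hadj hle
    rcases hle.eq_or_lt with hs | hs
    · rcases h.2 with h2 | h2
      · exact interpolant_eq_of_equal_side hT hT' h hs h2.2 hx hx'
      · exfalso
        linarith [T.side_pos, h2.1]
    · rw [interpolant_small_eq hT hT' h hadj hs hx hx', interpolant_large_eq hT hT' h hs hx hx']
  · rw [interpolant_corner hT hx (Square.eq_lo_or_hi_of_not_adjacent hadj hx hx'),
      interpolant_corner hT' hx'
        (Square.eq_lo_or_hi_of_not_adjacent (fun h => hadj h.symm) hx' hx)]

theorem feFunction_eq {T : Square} (hT : T ∈ M.elems) {x : Plane} (hx : x ∈ T.carrier) :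
    feFunction M A x = interpolant T (nodalField M A T) x := by
  have h : ∃ T ∈ M.elems, x ∈ T.carrier := ⟨T, hT, hx⟩
  rw [feFunction, dif_pos h]
  exact interpolant_nodalField_consistent h.choose_spec.1 hT h.choose_spec.2 hx

theorem isFiniteElement_feFunction (M : Mesh) (A : Plane → Plane) :
    IsFiniteElement M (feFunction M A) := by
  constructor
  · have := M.finite.to_subtype
    rw [Set.biUnion_eq_iUnion]
    refine (locallyFinite_of_finite _).continuousOn_iUnion (fun T => T.1.isClosed_carrier)
      fun T => ?_
    exact (continuous_interpolant T.1 _).continuousOn.congr fun x hx => feFunction_eq T.2 hx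
  · intro T hT
    obtain ⟨c, hc⟩ := isBiquadraticOn_interpolant T (nodalField M A T) T.carrier
    exact ⟨c, fun x hx => (feFunction_eq hT hx).trans (hc x hx)⟩

end Conforming

/-! ### Local averages -/

/-- The square of the Frobenius norm of the gradient. -/
def gradSq (G : Plane → Matrix (Fin 2) (Fin 2) ℝ) (x : Plane) : ℝ≥0∞ :=
  ∑ i, ∑ k, ‖G x i k‖ₑ ^ 2

/-- The square of the seminorm `|u|_{1,2,S}`. -/
def energy (G : Plane → Matrix (Fin 2) (Fin 2) ℝ) (S : Set Plane) : ℝ≥0∞ :=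
  ∫⁻ x in S, gradSq G x

theorem energy_mono {G : Plane → Matrix (Fin 2) (Fin 2) ℝ} {S S' : Set Plane} (h : S ⊆ S') :
    energy G S ≤ energy G S' := lintegral_mono_set h

theorem energy_eq_sum {G : Plane → Matrix (Fin 2) (Fin 2) ℝ} {S : Set Plane}
    (h : ∀ a k, AEMeasurable (fun x => G x a k) (volume.restrict S)) :
    energy G S = ∑ a, ∫⁻ y in S, ∑ k, ‖G y a k‖ₑ ^ 2 := by
  have hm : ∀ a, AEMeasurable (fun y => ∑ k, ‖G y a k‖ₑ ^ 2) (volume.restrict S) := fun a =>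
    Finset.aemeasurable_fun_sum _ fun k _ => (h a k).enorm.pow_const 2
  exact lintegral_finsetSum' _ fun a _ => hm a

theorem enorm_sq_eq_sum (v : Plane) : ‖v‖ₑ ^ 2 = ∑ i, ‖v i‖ₑ ^ 2 := by
  have h : ‖v‖₊ ^ 2 = ∑ i, ‖v i‖₊ ^ 2 := by
    rw [← NNReal.coe_inj]
    push_cast
    exact EuclideanSpace.norm_sq_eq v
  simp only [enorm_eq_nnnorm]
  exact_mod_cast h

theorem box_eq_closure_obox {p q : Fin 2 → ℝ} (hpq : ∀ k, p k < q k) :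
    box p q = closure (obox p q) := by
  have hne : (interior (box p q)).Nonempty := by
    rw [interior_box]
    refine ⟨pt 0 ((p 0 + q 0) / 2) ((p 1 + q 1) / 2), pt_mem_obox.2 ?_⟩
    have h0 := hpq 0
    have h1 := hpq 1
    exact ⟨⟨by linarith, by linarith⟩, by change p 1 < _; linarith, by change _ < q 1; linarith⟩
  rw [← interior_box, (convex_box p q).closure_interior_eq_closure_of_nonempty_interior hne,
    (isClosed_box p q).closure_eq]

section Estimates

variable {M : Mesh} {u : Plane → Plane} {G : Plane → Matrix (Fin 2) (Fin 2) ℝ}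
  {H : Plane → Fin 2 → Fin 2 → Fin 2 → ℝ}

theorem Mesh.obox_subset_domain {p q : Fin 2 → ℝ} (h : box p q ⊆ ⋃ T ∈ M.elems, T.carrier) :
    obox p q ⊆ M.domain :=
  interior_maximal ((obox_subset_box p q).trans h) (isOpen_obox p q)

theorem Mesh.box_subset_closure_domain {p q : Fin 2 → ℝ} (hpq : ∀ k, p k < q k)
    (h : box p q ⊆ ⋃ T ∈ M.elems, T.carrier) : box p q ⊆ closure M.domain := by
  rw [box_eq_closure_obox hpq]
  exact closure_mono (M.obox_subset_domain h)

theorem Mesh.carrier_subset {T : Square} (hT : T ∈ M.elems) :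
    T.carrier ⊆ ⋃ T ∈ M.elems, T.carrier :=
  Set.subset_biUnion_of_mem (u := fun T : Square => T.carrier) hT

theorem measurableSet_domain (M : Mesh) : MeasurableSet M.domain := isOpen_interior.measurableSet

/-- Outside the closure of `D` the field is arbitrary; setting it to zero there makes it Borel
measurable, as the iterated integrals below require. -/
theorem IsW2Inf.indicator {D : Set Plane} (hD : MeasurableSet D) (h : IsW2Inf D u G H) :
    IsW2Inf D ((closure D).indicator u) G H := by
  have he : ∀ i, ∀ x ∈ D, (closure D).indicator u x i = u x i := fun i x hx => by
    rw [Set.indicator_of_mem (subset_closure hx)]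
  have hmem : ∀ i, MemLp (fun x => (closure D).indicator u x i) ∞ (volume.restrict D) := by
    intro i
    refine (memLp_congr_ae ?_).2 (h.memLp i)
    filter_upwards [ae_restrict_mem hD] with x hx using he i x hx
  refine ⟨h.continuousOn.congr fun x hx => Set.indicator_of_mem hx u, fun i => ?_, h.memLp_grad,
    h.memLp_hess, fun i j => ?_, h.weak_hess⟩
  · exact hmem i
  · obtain ⟨-, h2, h3⟩ := h.weak_grad i j
    refine ⟨locallyIntegrableOn_of_locallyIntegrable_restrict ((hmem i).locallyIntegrable le_top),
      h2, fun φ hφ hc hs => ?_⟩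
    · rw [← h3 φ hφ hc hs]
      exact setIntegral_congr_fun hD fun x hx => by simp only [he i x hx]

theorem lintegral_line_box_le_energy (hu : Measurable u) (hW : IsW2Inf M.domain u G H)
    {p q : Fin 2 → ℝ} (hpq : ∀ k, p k < q k) (hbox : box p q ⊆ ⋃ T ∈ M.elems, T.carrier)
    {ℓ : ℝ} (hℓ : ∀ k, q k - p k ≤ ℓ) (i : Fin 2) {t : ℝ} (ht : t ∈ Set.Icc (p i) (q i)) :
    ∫⁻ s in Set.Icc (p (1 - i)) (q (1 - i)), ∫⁻ y in box p q, ‖u (pt i t s) - u y‖ₑ ^ 2 ≤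
      2 * ENNReal.ofReal ℓ ^ 3 * energy G (box p q) := by
  have hUD := M.obox_subset_domain hbox
  have hmono := Measure.restrict_mono hUD (le_refl (volume : Measure Plane))
  have hpart : ∀ a, ∫⁻ s in Set.Icc (p (1 - i)) (q (1 - i)), ∫⁻ y in box p q,
      ‖u (pt i t s) a - u y a‖ₑ ^ 2 ≤
      2 * ENNReal.ofReal ℓ ^ 3 * ∫⁻ y in obox p q, ∑ k, ‖G y a k‖ₑ ^ 2 := by
    intro a
    refine lintegral_line_box_le hpq (f := fun x => u x a) (g := fun k x => G x a k) ?_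
      ((hW.memLp a).mono_measure hmono) (fun k => (hW.memLp_grad a k).mono_measure hmono)
      (fun k => (hW.weak_grad a k).mono (measurableSet_domain M) hUD) hℓ i ht
    exact (continuous_coord a).comp_continuousOn
      (hW.continuousOn.mono (M.box_subset_closure_domain hpq hbox))
  have hua : ∀ a, Measurable fun x => u x a := fun a => (continuous_coord a).measurable.comp hu
  have hms : ∀ s a, Measurable fun y => ‖u (pt i t s) a - u y a‖ₑ ^ 2 := fun s a =>
    (measurable_const.sub (hua a)).enorm.pow_const 2
  have hm : ∀ a, Measurable fun z : ℝ × Plane => ‖u (pt i t z.1) a - u z.2 a‖ₑ ^ 2 := by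
    intro a
    have hpm : Measurable fun z : ℝ × Plane => pt i t z.1 :=
      ((continuous_pt i).comp (by fun_prop : Continuous fun z : ℝ × Plane => (t, z.1))).measurable
    exact (((hua a).comp hpm).sub ((hua a).comp measurable_snd)).enorm.pow_const 2
  calc _ = ∫⁻ s in Set.Icc (p (1 - i)) (q (1 - i)), ∫⁻ y in box p q,
        ∑ a, ‖u (pt i t s) a - u y a‖ₑ ^ 2 := by simp only [enorm_sq_eq_sum, PiLp.sub_apply]
    _ = ∑ a, ∫⁻ s in Set.Icc (p (1 - i)) (q (1 - i)), ∫⁻ y in box p q,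
        ‖u (pt i t s) a - u y a‖ₑ ^ 2 := by
        have h1 : ∀ s, ∫⁻ y in box p q, ∑ a, ‖u (pt i t s) a - u y a‖ₑ ^ 2 =
            ∑ a, ∫⁻ y in box p q, ‖u (pt i t s) a - u y a‖ₑ ^ 2 := fun s =>
          lintegral_finsetSum _ fun a _ => hms s a
        have h2 : ∀ a, Measurable fun s => ∫⁻ y in box p q, ‖u (pt i t s) a - u y a‖ₑ ^ 2 :=
          fun a => (hm a).lintegral_prod_right' (ν := volume.restrict (box p q))
        simp only [h1]
        exact lintegral_finsetSum _ fun a _ => h2 a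
    _ ≤ ∑ a, 2 * ENNReal.ofReal ℓ ^ 3 * ∫⁻ y in obox p q, ∑ k, ‖G y a k‖ₑ ^ 2 :=
        Finset.sum_le_sum fun a _ => hpart a
    _ = 2 * ENNReal.ofReal ℓ ^ 3 * energy G (obox p q) := by
        rw [← Finset.mul_sum, energy_eq_sum fun a k =>
          ((hW.memLp_grad a k).mono_measure hmono).aestronglyMeasurable.aemeasurable]
    _ ≤ _ := mul_le_mul_right (energy_mono (obox_subset_box p q)) _

theorem lintegral_box_box_le_energy (hu : Measurable u) (hW : IsW2Inf M.domain u G H)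
    {p q : Fin 2 → ℝ} (hpq : ∀ k, p k < q k) (hbox : box p q ⊆ ⋃ T ∈ M.elems, T.carrier)
    {ℓ : ℝ} (hℓ : ∀ k, q k - p k ≤ ℓ) :
    ∫⁻ x in box p q, ∫⁻ y in box p q, ‖u x - u y‖ₑ ^ 2 ≤
      2 * ENNReal.ofReal ℓ ^ 4 * energy G (box p q) := by
  have hm : Measurable fun z : Plane × Plane => ‖u z.1 - u z.2‖ₑ ^ 2 :=
    ((hu.comp measurable_fst).sub (hu.comp measurable_snd)).enorm.pow_const 2
  rw [lintegral_box p q 0 hm.lintegral_prod_right']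
  calc _ ≤ ∫⁻ t in Set.Icc (p 0) (q 0), 2 * ENNReal.ofReal ℓ ^ 3 * energy G (box p q) :=
        setLIntegral_mono' measurableSet_Icc fun t ht =>
          lintegral_line_box_le_energy hu hW hpq hbox hℓ 0 ht
    _ ≤ 2 * ENNReal.ofReal ℓ ^ 3 * energy G (box p q) * ENNReal.ofReal ℓ := by
        rw [lintegral_const, Measure.restrict_apply_univ, Real.volume_Icc]
        gcongr
        exact hℓ 0
    _ = _ := by ring

/-- The value `c` approximates `u` on `K` as well as the mean value. -/
def IsLocalMean (u : Plane → Plane) (G : Plane → Matrix (Fin 2) (Fin 2) ℝ) (K : Square)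
    (c : Plane) : Prop :=
  ∫⁻ y in K.carrier, ‖u y - c‖ₑ ^ 2 ≤ 2 * ENNReal.ofReal K.side ^ 2 * energy G K.carrier

/-- The double integral of `|u x - u y|²` is bounded by the energy, so for some `x` the inner
integral is at most its average over `K`; then `c = u x` works. -/
theorem exists_isLocalMean (hu : Measurable u) (hW : IsW2Inf M.domain u G H) {K : Square}
    (hK : K ∈ M.elems) : ∃ c, IsLocalMean u G K c := by
  have hm : Measurable fun z : Plane × Plane => ‖u z.1 - u z.2‖ₑ ^ 2 :=
    ((hu.comp measurable_fst).sub (hu.comp measurable_snd)).enorm.pow_const 2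
  have hp := K.side_pos
  have hL0 : ENNReal.ofReal K.side ≠ 0 := by simpa using hp
  have hv : volume K.carrier = ENNReal.ofReal K.side ^ 2 := by
    rw [K.volume_carrier, ENNReal.ofReal_pow hp.le]
  have hv0 : volume K.carrier ≠ 0 := by rw [hv]; exact pow_ne_zero 2 hL0
  have hvt : volume K.carrier ≠ ⊤ := by rw [hv]; exact ENNReal.pow_ne_top ENNReal.ofReal_ne_top
  obtain ⟨x, -, hx⟩ := exists_le_setLAverage hv0 hvt
    (hm.lintegral_prod_right' (ν := volume.restrict K.carrier)).aemeasurable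
  refine ⟨u x, ?_⟩
  have h2 := lintegral_box_box_le_energy hu hW K.lo_lt_hi (M.carrier_subset hK) (ℓ := K.side)
    (fun k => by rw [K.hi_eq]; linarith)
  rw [setLAverage_eq, ENNReal.le_div_iff_mul_le (Or.inl hv0) (Or.inl hvt)] at hx
  have h3 := hx.trans h2
  rw [hv, show 2 * ENNReal.ofReal K.side ^ 4 * energy G (box K.lo K.hi) =
    2 * ENNReal.ofReal K.side ^ 2 * energy G (box K.lo K.hi) * ENNReal.ofReal K.side ^ 2 by ring,
    ENNReal.mul_le_mul_iff_left (pow_ne_zero 2 hL0) (ENNReal.pow_ne_top ENNReal.ofReal_ne_top)] at h3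
  refine le_trans (le_of_eq (lintegral_congr fun y => ?_)) h3
  rw [← enorm_neg, neg_sub]

end Estimates

/-! ### Comparison of the local averages -/

theorem volume_box_axis (p q : Fin 2 → ℝ) (i : Fin 2) : volume (box p q) =
    ENNReal.ofReal (q i - p i) * ENNReal.ofReal (q (1 - i) - p (1 - i)) := by
  rw [volume_box]
  fin_cases i
  · rfl
  · exact mul_comm _ _

theorem Square.volume_carrier_eq (T : Square) :
    volume T.carrier = ENNReal.ofReal T.side ^ 2 := by
  rw [T.volume_carrier, ENNReal.ofReal_pow T.side_pos.le]

theorem Square.ofReal_side_ne_zero (T : Square) : ENNReal.ofReal T.side ≠ 0 := by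
  simpa using T.side_pos

theorem measurable_enorm_sub_sq {X : Type*} [MeasurableSpace X] {u : X → Plane}
    (hu : Measurable u) (c : Plane) : Measurable fun x => ‖u x - c‖ₑ ^ 2 :=
  (hu.sub measurable_const).enorm.pow_const 2

theorem one_sub_ne (i : Fin 2) : 1 - i ≠ i := by fin_cases i <;> simp

theorem ennreal_le_sqrt {d X : ℝ≥0∞} (h : d ^ 2 ≤ X) : d ≤ X ^ (1 / 2 : ℝ) := by
  have := ENNReal.rpow_le_rpow h (by norm_num : (0 : ℝ) ≤ 1 / 2)
  rwa [← ENNReal.rpow_natCast, ← ENNReal.rpow_mul, show ((2 : ℕ) : ℝ) * (1 / 2) = 1 by norm_num,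
    ENNReal.rpow_one] at this

theorem ennreal_sqrt_sq (X : ℝ≥0∞) : (X ^ (1 / 2 : ℝ)) ^ 2 = X := by
  rw [← ENNReal.rpow_natCast, ← ENNReal.rpow_mul, show (1 / 2 : ℝ) * ((2 : ℕ) : ℝ) = 1 by norm_num,
    ENNReal.rpow_one]

section Estimates

variable {M : Mesh} {u : Plane → Plane} {G : Plane → Matrix (Fin 2) (Fin 2) ℝ}
  {H : Plane → Fin 2 → Fin 2 → Fin 2 → ℝ} {a : Square → Plane}

/-- The difference is compared through `u x` and `u y` with `x` in `T` and `y` in the strip `P` of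
`T'` in line with `T`. Together `T` and `P` form a rectangle inside `T ∪ T'` with edges at most `3 *
T.side`, on which the Poincaré inequality applies. -/
theorem enorm_localMean_sub_sq_le (hu : Measurable u) (hW : IsW2Inf M.domain u G H)
    {T T' : Square} (hT : T ∈ M.elems) (hT' : T' ∈ M.elems) {i : Fin 2} (h : T.Attached T' i)
    (hle : T.side ≤ T'.side) {c c' : Plane} (hc : IsLocalMean u G T c)
    (hc' : IsLocalMean u G T' c') :
    ‖c - c'‖ₑ ^ 2 ≤ 688 * energy G (T.carrier ∪ T'.carrier) := by
  set L := ENNReal.ofReal T.side with hL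
  set E := energy G (T.carrier ∪ T'.carrier) with hE
  have hne := one_sub_ne i
  have hp := T.side_pos
  have h2 := h.side_le
  have hj1 := h.lo_le
  have hj2 := h.le_hi
  have e1 := T.hi_eq i
  have e2 := T'.hi_eq i
  have e3 := T.hi_eq (1 - i)
  have hlt := T.lo_lt_hi i
  have hlt' := T'.lo_lt_hi i
  have hltj := T.lo_lt_hi (1 - i)
  set p := Function.update T.lo i (min (T.lo i) (T'.lo i)) with hpdef
  set q := Function.update T.hi i (max (T.hi i) (T'.hi i)) with hqdef
  set P := box (Function.update T.lo i (T'.lo i)) (Function.update T.hi i (T'.hi i)) with hP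
  have hpi : p i = min (T.lo i) (T'.lo i) := Function.update_self ..
  have hqi : q i = max (T.hi i) (T'.hi i) := Function.update_self ..
  have hpj : p (1 - i) = T.lo (1 - i) := Function.update_of_ne hne ..
  have hqj : q (1 - i) = T.hi (1 - i) := Function.update_of_ne hne ..
  have hRi : q i - p i ≤ 3 * T.side := by
    rw [hpi, hqi]
    rcases h.1 with h | h
    · rw [min_eq_left (by linarith), max_eq_right (by linarith)]; linarith
    · rw [min_eq_right (by linarith), max_eq_left (by linarith)]; linarith
  have hpq : ∀ k, p k < q k := (forall_axis i).2 ⟨by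
    rw [hpi, hqi]; exact (min_le_left _ _).trans_lt (hlt.trans_le (le_max_left _ _)), by
    rw [hpj, hqj]; exact hltj⟩
  have hℓ : ∀ k, q k - p k ≤ 3 * T.side := (forall_axis i).2 ⟨hRi, by rw [hpj, hqj]; linarith⟩
  have hbox_iff : ∀ (p q : Fin 2 → ℝ) (x : Plane), x ∈ box p q ↔
      (p i ≤ x i ∧ x i ≤ q i) ∧ p (1 - i) ≤ x (1 - i) ∧ x (1 - i) ≤ q (1 - i) := fun p q x =>
    forall_axis (P := fun k => p k ≤ x k ∧ x k ≤ q k) i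
  have hPmem : ∀ x, x ∈ P ↔ (T'.lo i ≤ x i ∧ x i ≤ T'.hi i) ∧
      T.lo (1 - i) ≤ x (1 - i) ∧ x (1 - i) ≤ T.hi (1 - i) := by
    intro x
    rw [hP, hbox_iff, Function.update_self, Function.update_self, Function.update_of_ne hne,
      Function.update_of_ne hne]
  have hRmem : ∀ x, x ∈ box p q ↔ (min (T.lo i) (T'.lo i) ≤ x i ∧ x i ≤ max (T.hi i) (T'.hi i)) ∧
      T.lo (1 - i) ≤ x (1 - i) ∧ x (1 - i) ≤ T.hi (1 - i) := by
    intro x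
    rw [hbox_iff, hpi, hqi, hpj, hqj]
  have hRsub : box p q ⊆ T.carrier ∪ T'.carrier := by
    intro x hx
    obtain ⟨⟨h3, h4⟩, h5, h6⟩ := (hRmem x).1 hx
    rw [Square.carrier_eq_box, Square.carrier_eq_box, Set.mem_union, hbox_iff, hbox_iff]
    rcases h.1 with h | h
    · rw [min_eq_left (by linarith)] at h3
      rw [max_eq_right (by linarith)] at h4
      rcases le_total (x i) (T.hi i) with h7 | h7
      · exact Or.inl ⟨⟨h3, h7⟩, h5, h6⟩
      · exact Or.inr ⟨⟨by linarith, h4⟩, by linarith, by linarith⟩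
    · rw [min_eq_right (by linarith)] at h3
      rw [max_eq_left (by linarith)] at h4
      rcases le_total (T.lo i) (x i) with h7 | h7
      · exact Or.inl ⟨⟨h7, h4⟩, h5, h6⟩
      · exact Or.inr ⟨⟨h3, by linarith⟩, by linarith, by linarith⟩
  have hTR : T.carrier ⊆ box p q := by
    intro x hx
    rw [Square.carrier_eq_box, hbox_iff] at hx
    exact (hRmem x).2 ⟨⟨(min_le_left _ _).trans hx.1.1, hx.1.2.trans (le_max_left _ _)⟩, hx.2⟩
  have hPR : P ⊆ box p q := by
    intro x hx
    rw [hPmem] at hx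
    exact (hRmem x).2 ⟨⟨(min_le_right _ _).trans hx.1.1, hx.1.2.trans (le_max_right _ _)⟩, hx.2⟩
  have hPT' : P ⊆ T'.carrier := by
    intro x hx
    rw [hPmem] at hx
    rw [Square.carrier_eq_box, hbox_iff]
    exact ⟨hx.1, by linarith [hx.2.1], by linarith [hx.2.2]⟩
  have hvP : volume P = ENNReal.ofReal T'.side * L := by
    rw [hP, volume_box_axis _ _ i, Function.update_self, Function.update_self,
      Function.update_of_ne hne, Function.update_of_ne hne, e2, e3, add_sub_cancel_left,
      add_sub_cancel_left]
  have hLk : L ≤ ENNReal.ofReal T'.side := ENNReal.ofReal_le_ofReal hle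
  have hkL : ENNReal.ofReal T'.side ≤ 2 * L := by
    rw [hL, show (2 : ℝ≥0∞) = ENNReal.ofReal 2 by simp, ← ENNReal.ofReal_mul zero_le_two]
    exact ENNReal.ofReal_le_ofReal h2
  have hvT : volume T.carrier = L ^ 2 := T.volume_carrier_eq
  have hRΩ : box p q ⊆ ⋃ T ∈ M.elems, T.carrier :=
    hRsub.trans (Set.union_subset (M.carrier_subset hT) (M.carrier_subset hT'))
  have hmid : ∫⁻ x in T.carrier, ∫⁻ y in P, ‖u x - u y‖ₑ ^ 2 ≤ 2 * (3 * L) ^ 4 * E := by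
    calc _ ≤ ∫⁻ x in box p q, ∫⁻ y in box p q, ‖u x - u y‖ₑ ^ 2 :=
          lintegral_mono' (Measure.restrict_mono hTR le_rfl) fun x => lintegral_mono_set hPR
      _ ≤ 2 * ENNReal.ofReal (3 * T.side) ^ 4 * energy G (box p q) :=
          lintegral_box_box_le_energy hu hW hpq hRΩ hℓ
      _ ≤ _ := by
          rw [ENNReal.ofReal_mul (by norm_num), show ENNReal.ofReal 3 = 3 by simp]
          gcongr
          exact energy_mono hRsub
  have hT1 : ∫⁻ x in T.carrier, ‖u x - c‖ₑ ^ 2 ≤ 2 * L ^ 2 * E :=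
    hc.trans (mul_le_mul_right (energy_mono Set.subset_union_left) _)
  have hT2 : ∫⁻ x in P, ‖u x - c'‖ₑ ^ 2 ≤ 2 * (2 * L) ^ 2 * E :=
    (lintegral_mono_set hPT').trans (hc'.trans (by
      gcongr
      exact energy_mono Set.subset_union_right))
  have hm1 : Measurable fun x => 2 * ‖u x - c‖ₑ ^ 2 :=
    ((hu.sub measurable_const).enorm.pow_const 2).const_mul 2
  have hm2 : ∀ x, Measurable fun y => ‖u x - u y‖ₑ ^ 2 := fun x =>
    (measurable_const.sub hu).enorm.pow_const 2
  have hm3 : Measurable fun x => ‖u x - c'‖ₑ ^ 2 := (hu.sub measurable_const).enorm.pow_const 2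
  have hpt : ∀ x y, ‖c - c'‖ₑ ^ 2 ≤ 2 * ‖u x - c‖ₑ ^ 2 + (4 * ‖u x - u y‖ₑ ^ 2 +
      4 * ‖u y - c'‖ₑ ^ 2) := by
    intro x y
    have h1 := enorm_sub_sq_le c (u x) c'
    have h2 := enorm_sub_sq_le (u x) (u y) c'
    rw [← enorm_neg (c - u x), neg_sub] at h1
    calc _ ≤ _ := h1
      _ ≤ 2 * ‖u x - c‖ₑ ^ 2 + 2 * (2 * ‖u x - u y‖ₑ ^ 2 + 2 * ‖u y - c'‖ₑ ^ 2) := by gcongr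
      _ = _ := by ring
  -- Integration over `T × P`, whose measure is at least `L ^ 4`. The three parts contribute `2·2·2
  -- = 8`, `4·2·3⁴ = 648` and `4·2·2² = 32`.
  have hmain : ‖c - c'‖ₑ ^ 2 * L ^ 4 ≤ 688 * E * L ^ 4 := by
    calc ‖c - c'‖ₑ ^ 2 * L ^ 4 = ‖c - c'‖ₑ ^ 2 * (L * L) * L ^ 2 := by ring
      _ ≤ ‖c - c'‖ₑ ^ 2 * (ENNReal.ofReal T'.side * L) * L ^ 2 := by gcongr
      _ = ∫⁻ x in T.carrier, ∫⁻ y in P, ‖c - c'‖ₑ ^ 2 := by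
          simp only [lintegral_const, Measure.restrict_apply_univ, hvT, hvP]
      _ ≤ ∫⁻ x in T.carrier, ∫⁻ y in P, (2 * ‖u x - c‖ₑ ^ 2 + (4 * ‖u x - u y‖ₑ ^ 2 +
            4 * ‖u y - c'‖ₑ ^ 2)) :=
          lintegral_mono fun x => lintegral_mono fun y => hpt x y
      _ = ∫⁻ x in T.carrier, (2 * ‖u x - c‖ₑ ^ 2 * (ENNReal.ofReal T'.side * L) +
            (4 * ∫⁻ y in P, ‖u x - u y‖ₑ ^ 2) + 4 * ∫⁻ y in P, ‖u y - c'‖ₑ ^ 2) := by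
          refine lintegral_congr fun x => ?_
          rw [lintegral_add_left measurable_const, lintegral_const, Measure.restrict_apply_univ,
            hvP, lintegral_add_left ((hm2 x).const_mul 4), lintegral_const_mul _ (hm2 x),
            lintegral_const_mul _ hm3, add_assoc]
      _ = 2 * (∫⁻ x in T.carrier, ‖u x - c‖ₑ ^ 2) * (ENNReal.ofReal T'.side * L) +
            4 * (∫⁻ x in T.carrier, ∫⁻ y in P, ‖u x - u y‖ₑ ^ 2) +
            4 * (∫⁻ y in P, ‖u y - c'‖ₑ ^ 2) * L ^ 2 := by
          have hm4 : Measurable fun x => ∫⁻ y in P, ‖u x - u y‖ₑ ^ 2 := by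
            have : Measurable fun z : Plane × Plane => ‖u z.1 - u z.2‖ₑ ^ 2 :=
              ((hu.comp measurable_fst).sub (hu.comp measurable_snd)).enorm.pow_const 2
            exact this.lintegral_prod_right' (ν := volume.restrict P)
          rw [lintegral_add_right _ measurable_const, lintegral_add_left (hm1.mul_const _),
            lintegral_mul_const _ hm1, lintegral_const_mul _ hm4, lintegral_const,
            Measure.restrict_apply_univ, hvT,
            lintegral_const_mul _ (measurable_enorm_sub_sq hu _)]
      _ ≤ 2 * (2 * L ^ 2 * E) * (2 * L * L) + 4 * (2 * (3 * L) ^ 4 * E) +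
            4 * (2 * (2 * L) ^ 2 * E) * L ^ 2 := by gcongr
      _ = 688 * E * L ^ 4 := by ring
  rwa [ENNReal.mul_le_mul_iff_left (pow_ne_zero 4 T.ofReal_side_ne_zero)
    (ENNReal.pow_ne_top ENNReal.ofReal_ne_top)] at hmain

theorem enorm_localMean_sub_le_of_adjacent (hu : Measurable u) (hW : IsW2Inf M.domain u G H)
    (ha : ∀ K ∈ M.elems, IsLocalMean u G K (a K)) {S : Set Plane} {T T' : Square}
    (hT : T ∈ M.elems) (hT' : T' ∈ M.elems) (hne : T ≠ T') (hadj : T.Adjacent T')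
    (hTS : T.carrier ⊆ S) (hTS' : T'.carrier ⊆ S) :
    ‖a T - a T'‖ₑ ≤ (688 * energy G S) ^ (1 / 2 : ℝ) := by
  wlog hle : T.side ≤ T'.side generalizing T T'
  · rw [← enorm_neg, neg_sub]
    exact this hT' hT hne.symm hadj.symm hTS' hTS (le_of_not_ge hle)
  obtain ⟨i, h⟩ := M.exists_attached hT hT' hne hadj hle
  refine ennreal_le_sqrt ((enorm_localMean_sub_sq_le hu hW hT hT' h hle (ha T hT)
    (ha T' hT')).trans ?_)
  gcongr
  exact energy_mono (Set.union_subset hTS hTS')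

open Classical in
/-- The nodal values of the quasi-interpolant: at each point the approximate mean value over some
element that contains the point. -/
def nodeValue (M : Mesh) (a : Square → Plane) (z : Plane) : Plane :=
  if h : ∃ K ∈ M.elems, z ∈ K.carrier then a h.choose else 0

theorem enorm_nodeValue_sub_le (hu : Measurable u) (hW : IsW2Inf M.domain u G H)
    (ha : ∀ K ∈ M.elems, IsLocalMean u G K (a K)) {S : Set Plane} {K : Square} (hK : K ∈ M.elems)
    {z : Plane} (hz : z ∈ K.carrier) (hS : ∀ B ∈ M.elems, z ∈ B.carrier → B.carrier ⊆ S) :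
    ‖nodeValue M a z - a K‖ₑ ≤ 4 * (688 * energy G S) ^ (1 / 2 : ℝ) := by
  have h : ∃ K ∈ M.elems, z ∈ K.carrier := ⟨K, hK, hz⟩
  rw [nodeValue, dif_pos h, ← edist_eq_enorm_sub]
  refine M.edist_le_of_mem a _ (z := z) ?_ h.choose_spec.1 hK h.choose_spec.2 hz
  intro A hA B hB hzA hzB hne hadj
  rw [edist_eq_enorm_sub]
  exact enorm_localMean_sub_le_of_adjacent hu hW ha hA hB hne hadj (hS A hA hzA) (hS B hB hzB)

/-- At a hanging node the value interpolates nodal values of the larger neighbour `K`, each within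
`4 * e` of `a K`, and `a K` is within `e` of `a T`: `37 = 9·4 + 1`. This is where the patch must
contain the elements that meet a larger neighbour. -/
theorem enorm_nodalField_sub_le (hu : Measurable u) (hW : IsW2Inf M.domain u G H)
    (ha : ∀ K ∈ M.elems, IsLocalMean u G K (a K)) {T : Square} (hT : T ∈ M.elems)
    {z : Plane} (hz : z ∈ T.carrier) :
    ‖nodalField M (nodeValue M a) T z - a T‖ₑ ≤
      37 * (688 * energy G (M.patch T)) ^ (1 / 2 : ℝ) := by
  set e := (688 * energy G (M.patch T)) ^ (1 / 2 : ℝ) with he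
  have hsub : ∀ B ∈ M.elems, ((B.carrier ∩ T.carrier).Nonempty ∨ ∃ T' ∈ M.elems,
      T.side < T'.side ∧ T.Adjacent T' ∧ (B.carrier ∩ T'.carrier).Nonempty) →
      B.carrier ⊆ M.patch T := fun B hB h =>
    Set.subset_biUnion_of_mem (u := fun K : Square => K.carrier) (show B ∈ {K ∈ M.elems | _} from
      ⟨hB, h⟩)
  rcases nodalField_cases M (nodeValue M a) T z with h | ⟨K, hK, hs, hadj, hzK, h⟩
  · rw [h.1]
    refine (enorm_nodeValue_sub_le hu hW ha hT hz fun B hB hzB =>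
      hsub B hB (Or.inl ⟨z, hzB, hz⟩)).trans ?_
    gcongr
    norm_num
  · have hKS : K.carrier ⊆ M.patch T := hsub K hK (Or.inl ⟨z, hzK, hz⟩)
    have hTS : T.carrier ⊆ M.patch T := hsub T hT (Or.inl ⟨z, hz, hz⟩)
    have h1 : ‖interpolant K (nodeValue M a) z - a K‖ₑ ≤ 9 * (4 * e) := by
      refine enorm_interpolant_sub_le hzK fun b c => ?_
      exact enorm_nodeValue_sub_le hu hW ha hK (K.node_mem b c) fun B hB hzB =>
        hsub B hB (Or.inr ⟨K, hK, hs, hadj, _, hzB, K.node_mem b c⟩)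
    have h2 : ‖a K - a T‖ₑ ≤ e :=
      enorm_localMean_sub_le_of_adjacent hu hW ha hK hT
        (fun h => by rw [h] at hs; exact lt_irrefl _ hs) hadj.symm hKS hTS
    rw [h, ← sub_add_sub_cancel _ (a K)]
    calc _ ≤ _ := enorm_add_le _ _
      _ ≤ 9 * (4 * e) + e := add_le_add h1 h2
      _ = 37 * e := by ring

theorem enorm_quasiInterpolant_sub_sq_le (hu : Measurable u) (hW : IsW2Inf M.domain u G H)
    (ha : ∀ K ∈ M.elems, IsLocalMean u G K (a K)) {T : Square} (hT : T ∈ M.elems)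
    {x : Plane} (hx : x ∈ T.carrier) :
    ‖interpolant T (nodalField M (nodeValue M a) T) x - a T‖ₑ ^ 2 ≤
      76291632 * energy G (M.patch T) := by
  have h := enorm_interpolant_sub_le hx fun b c =>
    enorm_nodalField_sub_le hu hW ha hT (T.node_mem b c)
  calc _ ≤ (9 * (37 * (688 * energy G (M.patch T)) ^ (1 / 2 : ℝ))) ^ 2 := by gcongr
    _ = 9 ^ 2 * 37 ^ 2 * 688 * energy G (M.patch T) := by
      rw [mul_pow, mul_pow, ennreal_sqrt_sq]; ring
    _ = _ := by norm_num

/-! ### Estimates on an element and on its boundary -/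

/-- A trace inequality: `u y` is inserted and averaged over the element, so that the
line-to-rectangle estimate and the defining bound of `c` contribute 4 each. -/
theorem lintegral_line_localMean_le (hu : Measurable u) (hW : IsW2Inf M.domain u G H)
    {T : Square} (hT : T ∈ M.elems) {c : Plane} (hc : IsLocalMean u G T c) (i : Fin 2) {t : ℝ}
    (ht : t ∈ Set.Icc (T.lo i) (T.hi i)) :
    ∫⁻ s in Set.Icc (T.lo (1 - i)) (T.hi (1 - i)), ‖u (pt i t s) - c‖ₑ ^ 2 ≤
      8 * ENNReal.ofReal T.side * energy G T.carrier := by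
  set L := ENNReal.ofReal T.side with hL
  set E := energy G T.carrier with hE
  set J := Set.Icc (T.lo (1 - i)) (T.hi (1 - i)) with hJ
  have hvJ : volume J = L := by rw [hJ, Real.volume_Icc, T.hi_eq, add_sub_cancel_left]
  have hus : Measurable fun s => u (pt i t s) := hu.comp
    ((continuous_pt i).comp (by fun_prop : Continuous fun s : ℝ => (t, s))).measurable
  have hm1 : Measurable fun s => ‖u (pt i t s) - c‖ₑ ^ 2 :=
    (hus.sub measurable_const).enorm.pow_const 2
  have hm4 : ∀ s, Measurable fun y => ‖u (pt i t s) - u y‖ₑ ^ 2 := fun s =>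
    (measurable_const.sub hu).enorm.pow_const 2
  have hm2 : ∀ s, Measurable fun y => 2 * ‖u (pt i t s) - u y‖ₑ ^ 2 := fun s =>
    (hm4 s).const_mul 2
  have hm3 : Measurable fun y => ‖u y - c‖ₑ ^ 2 := (hu.sub measurable_const).enorm.pow_const 2
  have hline : ∫⁻ s in J, ∫⁻ y in T.carrier, ‖u (pt i t s) - u y‖ₑ ^ 2 ≤ 2 * L ^ 3 * E :=
    lintegral_line_box_le_energy hu hW T.lo_lt_hi (M.carrier_subset hT)
      (fun k => by rw [T.hi_eq, add_sub_cancel_left]) i ht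
  have hmain : (∫⁻ s in J, ‖u (pt i t s) - c‖ₑ ^ 2) * L ^ 2 ≤ 8 * L * E * L ^ 2 := by
    calc _ = ∫⁻ s in J, ∫⁻ y in T.carrier, ‖u (pt i t s) - c‖ₑ ^ 2 := by
          simp only [lintegral_const, Measure.restrict_apply_univ, T.volume_carrier_eq]
          rw [lintegral_mul_const _ hm1]
      _ ≤ ∫⁻ s in J, ∫⁻ y in T.carrier, (2 * ‖u (pt i t s) - u y‖ₑ ^ 2 + 2 * ‖u y - c‖ₑ ^ 2) :=
          lintegral_mono fun s => lintegral_mono fun y => enorm_sub_sq_le _ _ _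
      _ = ∫⁻ s in J, (2 * (∫⁻ y in T.carrier, ‖u (pt i t s) - u y‖ₑ ^ 2) +
            2 * ∫⁻ y in T.carrier, ‖u y - c‖ₑ ^ 2) := by
          refine lintegral_congr fun s => ?_
          rw [lintegral_add_left (hm2 s), lintegral_const_mul _ hm3,
            lintegral_const_mul _ (hm4 s)]
      _ = 2 * (∫⁻ s in J, ∫⁻ y in T.carrier, ‖u (pt i t s) - u y‖ₑ ^ 2) +
            2 * (∫⁻ y in T.carrier, ‖u y - c‖ₑ ^ 2) * L := by
          rw [lintegral_add_right _ measurable_const, lintegral_const,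
            Measure.restrict_apply_univ, hvJ, lintegral_const_mul]
          have : Measurable fun z : ℝ × Plane => ‖u (pt i t z.1) - u z.2‖ₑ ^ 2 :=
            ((hus.comp measurable_fst).sub (hu.comp measurable_snd)).enorm.pow_const 2
          exact this.lintegral_prod_right' (ν := volume.restrict T.carrier)
      _ ≤ 2 * (2 * L ^ 3 * E) + 2 * (2 * L ^ 2 * E) * L := by
          gcongr
          exact hc
      _ = 8 * L * E * L ^ 2 := by ring
  rwa [ENNReal.mul_le_mul_iff_left (pow_ne_zero 2 T.ofReal_side_ne_zero)
    (ENNReal.pow_ne_top ENNReal.ofReal_ne_top)] at hmain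

theorem isometry_pt (i : Fin 2) (c : ℝ) : Isometry fun s => pt i c s := by
  refine Isometry.of_dist_eq fun s t => ?_
  have hd : ‖dir (1 - i)‖ = 1 := by simp [dir]
  rw [dist_eq_norm, dist_eq_norm, pt, pt, add_sub_add_left_eq_sub, ← sub_smul, norm_smul, hd,
    mul_one]

/-- An isometric embedding of the real line carries Lebesgue measure to one-dimensional Hausdorff
measure on its range. The embedding is measurable, so `F` may be arbitrary. -/
theorem lintegral_axisSegment (i : Fin 2) (c a b : ℝ) (F : Plane → ℝ≥0∞) :
    ∫⁻ x in axisSegment i c a b, F x ∂(μH[1] : Measure Plane) =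
      ∫⁻ s in Set.Icc a b, F (pt i c s) := by
  have hiso := isometry_pt i c
  have hemb := hiso.isClosedEmbedding.measurableEmbedding
  have himg : axisSegment i c a b = (fun s => pt i c s) '' Set.Icc a b := by
    ext x
    constructor
    · rintro ⟨h1, h2, h3⟩
      exact ⟨x (1 - i), ⟨h2, h3⟩, by rw [← h1]; exact pt_eta i x⟩
    · rintro ⟨t, ht, rfl⟩
      exact pt_mem_axisSegment ht
  have hmap := hiso.map_hausdorffMeasure (d := 1) (Or.inl zero_le_one)
  rw [hausdorffMeasure_real] at hmap
  have hsub : axisSegment i c a b ⊆ Set.range fun s => pt i c s := by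
    rw [himg]; exact Set.image_subset_range _ _
  rw [← Measure.restrict_restrict_of_subset hsub, ← hmap, hemb.restrict_map, hemb.lintegral_map,
    himg, Set.preimage_image_eq _ hiso.injective]

theorem frontier_carrier_subset (T : Square) : frontier T.carrier ⊆
    ⋃ i, (axisSegment i (T.lo i) (T.lo (1 - i)) (T.hi (1 - i)) ∪
      axisSegment i (T.hi i) (T.lo (1 - i)) (T.hi (1 - i))) := by
  intro x hx
  rw [T.isClosed_carrier.frontier_eq, T.carrier_eq_box, interior_box] at hx
  obtain ⟨hx1, hx2⟩ := hx
  simp only [obox, Set.mem_ofPred_eq, not_forall] at hx2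
  obtain ⟨i, hi⟩ := hx2
  refine Set.mem_iUnion.2 ⟨i, ?_⟩
  rcases (hx1 i).1.eq_or_lt with h | h
  · exact Or.inl ⟨h.symm, hx1 (1 - i)⟩
  · exact Or.inr ⟨le_antisymm (hx1 i).2 (not_lt.1 fun h' => hi ⟨h, h'⟩), hx1 (1 - i)⟩

theorem lintegral_frontier_le {T : Square} {F : Plane → ℝ≥0∞} {B : ℝ≥0∞}
    (h : ∀ i, ∀ t ∈ Set.Icc (T.lo i) (T.hi i),
      ∫⁻ s in Set.Icc (T.lo (1 - i)) (T.hi (1 - i)), F (pt i t s) ≤ B) :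
    ∫⁻ x in frontier T.carrier, F x ∂(μH[1] : Measure Plane) ≤ 4 * B := by
  have hl : ∀ i, T.lo i ∈ Set.Icc (T.lo i) (T.hi i) := fun i => ⟨le_rfl, (T.lo_lt_hi i).le⟩
  have hr : ∀ i, T.hi i ∈ Set.Icc (T.lo i) (T.hi i) := fun i => ⟨(T.lo_lt_hi i).le, le_rfl⟩
  calc _ ≤ _ := lintegral_mono_set (frontier_carrier_subset T)
    _ ≤ ∑' i, _ := lintegral_iUnion_le _ _
    _ = ∑ i, _ := tsum_fintype _
    _ ≤ ∑ i : Fin 2, (B + B) := by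
        refine Finset.sum_le_sum fun i _ => (lintegral_union_le _ _ _).trans (add_le_add ?_ ?_)
        · rw [lintegral_axisSegment]; exact h i _ (hl i)
        · rw [lintegral_axisSegment]; exact h i _ (hr i)
    _ = 4 * B := by rw [Fin.sum_univ_two]; ring

theorem eLpNorm_two_eq {X E : Type*} [MeasurableSpace X] [NormedAddCommGroup E] (μ : Measure X)
    (f : X → E) : eLpNorm f 2 μ = (∫⁻ x, ‖f x‖ₑ ^ 2 ∂μ) ^ (1 / 2 : ℝ) := by
  rw [eLpNorm_eq_lintegral_rpow_enorm_toReal two_ne_zero ENNReal.ofNat_ne_top]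
  simp

theorem seminormOneTwo_eq (G : Plane → Matrix (Fin 2) (Fin 2) ℝ) (S : Set Plane) :
    seminormOneTwo G S = energy G S ^ (1 / 2 : ℝ) := by
  rw [seminormOneTwo, eLpNorm_two_eq, energy]
  congr 2
  funext x
  rw [Real.enorm_of_nonneg (Real.sqrt_nonneg _), ← ENNReal.ofReal_pow (Real.sqrt_nonneg _),
    Real.sq_sqrt (by positivity), gradSq, ENNReal.ofReal_sum_of_nonneg fun _ _ => by positivity]
  refine Finset.sum_congr rfl fun i _ => ?_
  rw [ENNReal.ofReal_sum_of_nonneg fun _ _ => by positivity]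
  refine Finset.sum_congr rfl fun k _ => ?_
  rw [Real.enorm_eq_ofReal_abs, ← ENNReal.ofReal_pow (abs_nonneg _), sq_abs]

theorem lintegral_carrier_error_le (hu : Measurable u) (hW : IsW2Inf M.domain u G H)
    (ha : ∀ K ∈ M.elems, IsLocalMean u G K (a K)) {T : Square} (hT : T ∈ M.elems) :
    ∫⁻ x in T.carrier, ‖u x - interpolant T (nodalField M (nodeValue M a) T) x‖ₑ ^ 2 ≤
      40000 ^ 2 * ENNReal.ofReal T.side ^ 2 * energy G (M.patch T) := by
  set w := interpolant T (nodalField M (nodeValue M a) T) with hw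
  set E := energy G (M.patch T) with hE
  set L := ENNReal.ofReal T.side
  have hTS : energy G T.carrier ≤ E := energy_mono <|
    Set.subset_biUnion_of_mem (u := fun K : Square => K.carrier) (show T ∈ {K ∈ M.elems | _} from
      ⟨hT, Or.inl ⟨_, T.node_mem 0 0, T.node_mem 0 0⟩⟩)
  have hm : Measurable fun x => 2 * ‖u x - a T‖ₑ ^ 2 :=
    ((hu.sub measurable_const).enorm.pow_const 2).const_mul 2
  calc _ ≤ ∫⁻ x in T.carrier, (2 * ‖u x - a T‖ₑ ^ 2 + 2 * (76291632 * E)) := by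
        refine setLIntegral_mono' T.isClosed_carrier.measurableSet fun x hx => ?_
        refine (enorm_sub_sq_le _ (a T) _).trans ?_
        rw [← enorm_neg (a T - w x), neg_sub]
        gcongr
        exact enorm_quasiInterpolant_sub_sq_le hu hW ha hT hx
    _ = 2 * (∫⁻ x in T.carrier, ‖u x - a T‖ₑ ^ 2) + 2 * (76291632 * E) * L ^ 2 := by
        rw [lintegral_add_left hm, lintegral_const, Measure.restrict_apply_univ,
          T.volume_carrier_eq, lintegral_const_mul _ (measurable_enorm_sub_sq hu _)]
    _ ≤ 2 * (2 * L ^ 2 * E) + 2 * (76291632 * E) * L ^ 2 := by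
        gcongr
        exact (ha T hT).trans (mul_le_mul_right hTS _)
    _ = 152583268 * (L ^ 2 * E) := by ring
    _ ≤ 40000 ^ 2 * (L ^ 2 * E) := by gcongr; norm_num
    _ = _ := by ring

theorem lintegral_frontier_error_le (hu : Measurable u) (hW : IsW2Inf M.domain u G H)
    (ha : ∀ K ∈ M.elems, IsLocalMean u G K (a K)) {T : Square} (hT : T ∈ M.elems) :
    ∫⁻ x in frontier T.carrier, ‖u x - interpolant T (nodalField M (nodeValue M a) T) x‖ₑ ^ 2
        ∂(μH[1] : Measure Plane) ≤
      40000 ^ 2 * ENNReal.ofReal T.side * energy G (M.patch T) := by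
  set w := interpolant T (nodalField M (nodeValue M a) T) with hw
  set E := energy G (M.patch T) with hE
  set L := ENNReal.ofReal T.side
  have hTS : energy G T.carrier ≤ E := energy_mono <|
    Set.subset_biUnion_of_mem (u := fun K : Square => K.carrier) (show T ∈ {K ∈ M.elems | _} from
      ⟨hT, Or.inl ⟨_, T.node_mem 0 0, T.node_mem 0 0⟩⟩)
  have hside : ∀ i, ∀ t ∈ Set.Icc (T.lo i) (T.hi i),
      ∫⁻ s in Set.Icc (T.lo (1 - i)) (T.hi (1 - i)), ‖u (pt i t s) - w (pt i t s)‖ₑ ^ 2 ≤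
        152583280 * (L * E) := by
    intro i t ht
    have hus : Measurable fun s => u (pt i t s) := hu.comp
      ((continuous_pt i).comp (by fun_prop : Continuous fun s : ℝ => (t, s))).measurable
    have hm : Measurable fun s => 2 * ‖u (pt i t s) - a T‖ₑ ^ 2 :=
      ((hus.sub measurable_const).enorm.pow_const 2).const_mul 2
    calc _ ≤ ∫⁻ s in Set.Icc (T.lo (1 - i)) (T.hi (1 - i)),
          (2 * ‖u (pt i t s) - a T‖ₑ ^ 2 + 2 * (76291632 * E)) := by
          refine setLIntegral_mono' measurableSet_Icc fun s hs => ?_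
          refine (enorm_sub_sq_le _ (a T) _).trans ?_
          rw [← enorm_neg (a T - w _), neg_sub]
          gcongr
          exact enorm_quasiInterpolant_sub_sq_le hu hW ha hT (Square.pt_mem_carrier.2 ⟨ht, hs⟩)
      _ = 2 * (∫⁻ s in Set.Icc (T.lo (1 - i)) (T.hi (1 - i)), ‖u (pt i t s) - a T‖ₑ ^ 2) +
            2 * (76291632 * E) * L := by
          rw [lintegral_add_left hm, lintegral_const, Measure.restrict_apply_univ,
            Real.volume_Icc, T.hi_eq, add_sub_cancel_left,
            lintegral_const_mul _ (measurable_enorm_sub_sq hus _)]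
      _ ≤ 2 * (8 * L * E) + 2 * (76291632 * E) * L := by
          gcongr
          exact (lintegral_line_localMean_le hu hW hT (ha T hT) i ht).trans
            (mul_le_mul_right hTS _)
      _ = 152583280 * (L * E) := by ring
  calc _ ≤ 4 * (152583280 * (L * E)) := lintegral_frontier_le hside
    _ = 610333120 * (L * E) := by ring
    -- The constant is rounded up generously, so that the same one serves on the element and on its
    -- boundary.
    _ ≤ 40000 ^ 2 * (L * E) := by gcongr; norm_num
    _ = _ := by ring

theorem exists_quasiInterpolant (hW : IsW2Inf M.domain u G H) :
    ∃ v : Plane → Plane, IsFiniteElement M v ∧ ∀ T ∈ M.elems,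
      weightU T u v ≤ ENNReal.ofReal (40000 * T.side) * seminormOneTwo G (M.patch T) ∧
      weightBoundary T u v ≤
        ENNReal.ofReal (40000 * Real.sqrt T.side) * seminormOneTwo G (M.patch T) := by
  have hD := measurableSet_domain M
  have hW' := hW.indicator hD
  have hu' : Measurable ((closure M.domain).indicator u) := by
    -- The modified field is continuous on a closed set and zero elsewhere, hence measurable.
    classical
    have hcl := (isClosed_closure (s := M.domain)).measurableSet
    rw [← Set.piecewise_eq_indicator]
    exact hW.continuousOn.measurable_piecewise continuousOn_const hcl
  choose! a ha using fun K (hK : K ∈ M.elems) => exists_isLocalMean hu' hW' hK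
  refine ⟨feFunction M (nodeValue M a), isFiniteElement_feFunction M _, fun T hT => ?_⟩
  have heq : ∀ x ∈ T.carrier, u x - feFunction M (nodeValue M a) x =
      (closure M.domain).indicator u x - interpolant T (nodalField M (nodeValue M a) T) x := by
    intro x hx
    rw [feFunction_eq hT hx, Set.indicator_of_mem
      (M.box_subset_closure_domain T.lo_lt_hi (M.carrier_subset hT) hx)]
  have hside := T.side_pos
  have h4 : ENNReal.ofReal 40000 = 40000 := by simp
  constructor
  · rw [weightU, eLpNorm_two_eq, seminormOneTwo_eq]
    have hcongr := setLIntegral_congr_fun (μ := (volume : Measure Plane))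
      T.isClosed_carrier.measurableSet fun x hx => congrArg (fun v : Plane => ‖v‖ₑ ^ 2) (heq x hx)
    rw [hcongr]
    refine (ENNReal.rpow_le_rpow (lintegral_carrier_error_le hu' hW' ha hT)
      (by norm_num)).trans (le_of_eq ?_)
    rw [ENNReal.mul_rpow_of_nonneg _ _ (by norm_num), ← mul_pow, ENNReal.ofReal_mul (by norm_num),
      h4, ← ENNReal.rpow_natCast, ← ENNReal.rpow_mul]
    norm_num
  · rw [weightBoundary, eLpNorm_two_eq, seminormOneTwo_eq]
    have hcongr := setLIntegral_congr_fun (μ := (μH[1] : Measure Plane))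
      (isClosed_frontier (s := T.carrier)).measurableSet fun x hx =>
        congrArg (fun v : Plane => ‖v‖ₑ ^ 2) (heq x (T.isClosed_carrier.frontier_subset hx))
    rw [hcongr]
    refine (ENNReal.rpow_le_rpow (lintegral_frontier_error_le hu' hW' ha hT)
      (by norm_num)).trans (le_of_eq ?_)
    have hs : ENNReal.ofReal T.side = ENNReal.ofReal (Real.sqrt T.side) ^ 2 := by
      rw [← ENNReal.ofReal_pow (Real.sqrt_nonneg _), Real.sq_sqrt hside.le]
    rw [ENNReal.mul_rpow_of_nonneg _ _ (by norm_num), hs, ← mul_pow,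
      ENNReal.ofReal_mul (by norm_num), h4, ← ENNReal.rpow_natCast, ← ENNReal.rpow_mul]
    norm_num

end Estimates

/-! ### Interpolation error of the gradient -/

/-- The derivatives of the Lagrange basis. -/
def lagrangeBasisDeriv (a : Fin 3) (t : ℝ) : ℝ := ![4 * t - 3, 4 - 8 * t, 4 * t - 1] a

theorem hasDerivAt_lagrangeBasis (a : Fin 3) (t : ℝ) :
    HasDerivAt (lagrangeBasis a) (lagrangeBasisDeriv a t) t := by
  have key : ∀ c₀ c₁ c₂ : ℝ, HasDerivAt (fun s : ℝ => c₀ + c₁ * s + c₂ * s ^ 2)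
      (c₁ + 2 * c₂ * t) t := by
    intro c₀ c₁ c₂
    have h1 := ((hasDerivAt_id t).const_mul c₁).const_add c₀
    have h2 := (hasDerivAt_pow 2 t).const_mul c₂
    refine (h1.add h2).congr_deriv ?_
    norm_num
    ring
  have h := key (![1, 0, 0] a) (![-3, 4, -1] a) (![2, -4, 2] a)
  have e : lagrangeBasis a = fun s : ℝ => ![1, 0, 0] a + ![-3, 4, -1] a * s +
      ![2, -4, 2] a * s ^ 2 := by
    funext s
    fin_cases a <;> simp [lagrangeBasis] <;> ring
  rw [e]
  refine h.congr_deriv ?_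
  fin_cases a <;> simp [lagrangeBasisDeriv] <;> ring

theorem abs_lagrangeBasisDeriv_le {a : Fin 3} {t : ℝ} (ht : t ∈ Set.Icc (0 : ℝ) 1) :
    |lagrangeBasisDeriv a t| ≤ 4 := by
  obtain ⟨h0, h1⟩ := ht
  rw [abs_le]
  fin_cases a <;> simp [lagrangeBasisDeriv] <;> constructor <;> linarith

theorem differentiable_interpolant (T : Square) (U : Plane → Plane) :
    Differentiable ℝ (interpolant T U) := by
  have : interpolant T U = fun x => _ := funext fun x => interpolant_eq 0 T U x
  rw [this]
  have hl : ∀ i, Differentiable ℝ (T.localCoord i) := fun i => by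
    unfold Square.localCoord; fun_prop
  have hL : ∀ a, Differentiable ℝ (lagrangeBasis a) := fun a t =>
    (hasDerivAt_lagrangeBasis a t).differentiableAt
  exact Differentiable.fun_sum fun a _ => Differentiable.fun_sum fun b _ =>
    (((hL a).comp (hl 0)).mul ((hL b).comp (hl _))).smul_const _

theorem jacobian_interpolant (T : Square) (U : Plane → Plane) (x : Plane) (i j : Fin 2) :
    jacobian (interpolant T U) x i j = ∑ a, ∑ b, lagrangeBasisDeriv a (T.localCoord j x) *
      lagrangeBasis b (T.localCoord (1 - j) x) / T.side *
        U (pt j (T.gridLine j a) (T.gridLine (1 - j) b)) i := by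
  have h1 : HasDerivAt (fun s : ℝ => interpolant T U (x + s • dir j))
      (fderiv ℝ (interpolant T U) x (dir j)) 0 := by
    have hl : HasDerivAt (fun s : ℝ => x + s • dir j) (dir j) 0 := by
      simpa using ((hasDerivAt_id (0 : ℝ)).smul_const (dir j)).const_add x
    have hd : HasFDerivAt (interpolant T U) (fderiv ℝ (interpolant T U) x)
        (x + (0 : ℝ) • dir j) := by
      rw [zero_smul, add_zero]
      exact (differentiable_interpolant T U x).hasFDerivAt
    exact hd.comp_hasDerivAt 0 hl
  have hj : ∀ s : ℝ, T.localCoord j (x + s • dir j) = T.localCoord j x + s / T.side := by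
    intro s
    simp [Square.localCoord, dir]
    ring
  have hj' : ∀ s : ℝ, T.localCoord (1 - j) (x + s • dir j) = T.localCoord (1 - j) x := by
    intro s
    simp [Square.localCoord, dir, one_sub_ne]
  have h2 : HasDerivAt (fun s : ℝ => interpolant T U (x + s • dir j))
      (∑ a, ∑ b, (lagrangeBasisDeriv a (T.localCoord j x) * (1 / T.side) *
        lagrangeBasis b (T.localCoord (1 - j) x)) •
          U (pt j (T.gridLine j a) (T.gridLine (1 - j) b))) 0 := by
    simp only [interpolant_eq j, hj, hj']
    refine HasDerivAt.fun_sum fun a _ => HasDerivAt.fun_sum fun b _ => ?_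
    refine HasDerivAt.smul_const (HasDerivAt.mul_const ?_ _) _
    have hin : HasDerivAt (fun s : ℝ => T.localCoord j x + s / T.side) (1 / T.side) 0 :=
      ((hasDerivAt_id (0 : ℝ)).div_const T.side).const_add _
    have hL := hasDerivAt_lagrangeBasis a (T.localCoord j x + (0 : ℝ) / T.side)
    have := hL.comp (0 : ℝ) hin
    rw [zero_div, add_zero] at this
    exact this
  rw [jacobian, Matrix.of_apply, h1.unique h2]
  simp only [WithLp.ofLp_sum, Finset.sum_apply, PiLp.smul_apply, smul_eq_mul]
  refine Finset.sum_congr rfl fun a _ => Finset.sum_congr rfl fun b _ => ?_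
  ring

theorem sum_lagrangeBasisDeriv (t : ℝ) : ∑ a, lagrangeBasisDeriv a t = 0 := by
  simp only [lagrangeBasisDeriv, Fin.sum_univ_three, Matrix.cons_val]
  ring

theorem sum_lagrangeBasisDeriv_mul (t : ℝ) :
    ∑ a : Fin 3, lagrangeBasisDeriv a t * (((a : ℕ) : ℝ) / 2) = 1 := by
  simp [lagrangeBasisDeriv, Fin.sum_univ_three]
  ring

/-- Bi-quadratic interpolation reproduces affine functions, here at the level of the `j`-th partial
derivative. -/
theorem sum_lagrangeBasisDeriv_affine (T : Square) (j : Fin 2) (s t c₀ c₁ c₂ : ℝ) :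
    ∑ a, ∑ b, lagrangeBasisDeriv a s * lagrangeBasis b t / T.side *
      (c₀ + c₁ * T.gridLine j a + c₂ * T.gridLine (1 - j) b) = c₁ := by
  have hp := T.side_pos.ne'
  have h1 := sum_lagrangeBasisDeriv s
  have h2 := sum_lagrangeBasisDeriv_mul s
  have h3 := sum_lagrangeBasis t
  simp only [Fin.sum_univ_three] at h1 h2 h3 ⊢
  simp only [Square.gridLine]
  field_simp
  norm_num at h2 ⊢
  set d0 := lagrangeBasisDeriv 0 s
  set d1 := lagrangeBasisDeriv 1 s
  set d2 := lagrangeBasisDeriv 2 s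
  set l0 := lagrangeBasis 0 t
  set l1 := lagrangeBasis 1 t
  set l2 := lagrangeBasis 2 t
  have h4 : d0 = -d1 - d2 := by linarith
  have h5 : d1 = 2 - 2 * d2 := by linarith
  have h6 : l0 = 1 - l1 - l2 := by linarith
  rw [h6, h4, h5]
  ring

/-- The affine Taylor polynomial at `x` is reproduced exactly, so only the remainders at the nine
nodes are left, each with a weight of at most `4 / T.side`. -/
theorem abs_jacobian_interpolant_sub_le {T : Square} {U : Plane → Plane} {x : Plane}
    (hx : x ∈ T.carrier) {J : Matrix (Fin 2) (Fin 2) ℝ} {r : ℝ}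
    (h : ∀ i, ∀ z ∈ T.carrier, |U z i - U x i - ∑ k, J i k * (z k - x k)| ≤ r) (i j : Fin 2) :
    |jacobian (interpolant T U) x i j - J i j| ≤ 36 * r / T.side := by
  have hp := T.side_pos
  have hr : 0 ≤ r := (abs_nonneg _).trans (h i x hx)
  set z : Fin 3 → Fin 3 → Plane := fun a b => pt j (T.gridLine j a) (T.gridLine (1 - j) b) with hz
  have hzT : ∀ a b, z a b ∈ T.carrier := fun a b =>
    Square.pt_mem_carrier.2 ⟨T.gridLine_mem _ _, T.gridLine_mem _ _⟩
  have hsum : ∀ a b, U x i + ∑ k, J i k * (z a b k - x k) =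
      (U x i - J i j * x j - J i (1 - j) * x (1 - j)) + J i j * T.gridLine j a +
        J i (1 - j) * T.gridLine (1 - j) b := by
    intro a b
    have : ∑ k, J i k * (z a b k - x k) = J i j * (z a b j - x j) +
        J i (1 - j) * (z a b (1 - j) - x (1 - j)) := by
      fin_cases j <;> simp [Fin.sum_univ_two, add_comm]
    rw [this, hz]
    simp only [pt_self, pt_other]
    ring
  have hJ := sum_lagrangeBasisDeriv_affine T j (T.localCoord j x) (T.localCoord (1 - j) x)
    (U x i - J i j * x j - J i (1 - j) * x (1 - j)) (J i j) (J i (1 - j))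
  rw [jacobian_interpolant]
  conv_lhs => rw [← hJ]
  rw [← Finset.sum_sub_distrib]
  simp only [← Finset.sum_sub_distrib, ← mul_sub, ← hsum]
  have hterm : ∀ a b, |lagrangeBasisDeriv a (T.localCoord j x) *
      lagrangeBasis b (T.localCoord (1 - j) x) / T.side *
      (U (z a b) i - (U x i + ∑ k, J i k * (z a b k - x k)))| ≤ 4 * r / T.side := by
    intro a b
    rw [abs_mul, abs_div, abs_mul, abs_of_pos hp, ← sub_sub]
    have h1 := abs_lagrangeBasisDeriv_le (a := a) (Square.localCoord_mem hx j)
    have h2 := abs_lagrangeBasis_le (a := b) (Square.localCoord_mem hx (1 - j))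
    have h3 := h i (z a b) (hzT a b)
    rw [div_mul_eq_mul_div]
    refine div_le_div_of_nonneg_right ?_ hp.le
    refine mul_le_mul ((mul_le_mul h1 h2 (abs_nonneg _) (by norm_num)).trans_eq (mul_one 4)) h3
      (abs_nonneg _) (by norm_num)
  calc _ ≤ ∑ a : Fin 3, ∑ b : Fin 3, 4 * r / T.side :=
        (Finset.abs_sum_le_sum_abs _ _).trans (Finset.sum_le_sum fun a _ =>
          (Finset.abs_sum_le_sum_abs _ _).trans (Finset.sum_le_sum fun b _ => hterm a b))
    _ = 36 * r / T.side := by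
        simp only [Finset.sum_const, Finset.card_univ, Fintype.card_fin, nsmul_eq_mul]
        push_cast
        ring

/-! ### Bounds for the effective tensor -/

/-- The denominator has no positive lower bound, but the numerators vanish with it. Writing `1 - θ(1
- m) = (1 - θ) + θm` splits a diagonal numerator into a multiple of the first term of the
denominator and a part which `4κμ ≤ (κ + μ)²` bounds by the second. The off-diagonal entry needs the
first term only. Where the denominator is zero, the quotient is zero by convention and the bound
persists. -/
theorem abs_referenceTensor_le {lam mu m θ : ℝ} (hmu : 0 < mu) (hk : 0 < lam + mu)
    (hm : m ∈ Set.Icc (0 : ℝ) 1) (hθ : θ ∈ Set.Icc (0 : ℝ) 1) (i j k l : Fin 2) :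
    |referenceTensor lam mu m θ i j k l| ≤ lam + 2 * mu + |lam| := by
  obtain ⟨hm0, hm1⟩ := hm
  obtain ⟨hθ0, hθ1⟩ := hθ
  have h1m : 0 ≤ 1 - m := by linarith
  have h1θ : 0 ≤ 1 - θ := by linarith
  set κ := lam + mu with hκ
  have hden : 0 ≤ 4 * κ * mu * m * (1 - m) * θ ^ 2 + (κ + mu) ^ 2 * (1 - θ) := by positivity
  have hK : lam + 2 * mu + |lam| = κ + mu + |lam| := by rw [hκ]; ring
  have habs := abs_nonneg lam
  have hdiv : ∀ {n K : ℝ}, 0 ≤ n → 0 ≤ K →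
      n ≤ K * (4 * κ * mu * m * (1 - m) * θ ^ 2 + (κ + mu) ^ 2 * (1 - θ)) →
      |n / (4 * κ * mu * m * (1 - m) * θ ^ 2 + (κ + mu) ^ 2 * (1 - θ))| ≤ K := by
    intro n K hn hK0 h
    rw [abs_of_nonneg (div_nonneg hn hden)]
    exact div_le_of_le_mul₀ hden hK0 h
  have h4 : 4 * κ * mu ≤ (κ + mu) ^ 2 := by nlinarith [sq_nonneg (κ - mu)]
  have hdiag : ∀ s, 0 ≤ s → s ≤ 1 → 4 * κ * mu * (κ + mu) * θ * ((1 - θ) * s) ≤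
      (κ + mu) * ((κ + mu) ^ 2 * (1 - θ)) := by
    intro s hs0 hs1
    calc 4 * κ * mu * (κ + mu) * θ * ((1 - θ) * s)
        = 4 * κ * mu * ((κ + mu) * (1 - θ)) * (θ * s) := by ring
      _ ≤ 4 * κ * mu * ((κ + mu) * (1 - θ)) * 1 := by
          gcongr
          exact mul_le_one₀ hθ1 hs0 hs1
      _ ≤ (κ + mu) ^ 2 * ((κ + mu) * (1 - θ)) := by rw [mul_one]; gcongr
      _ = _ := by ring
  rw [hK]
  simp only [referenceTensor, ← hκ]
  split_ifs
  · refine (hdiv (K := κ + mu) ?_ (by positivity) ?_).trans (by linarith)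
    · have : 0 ≤ 1 - θ * (1 - m) := by nlinarith
      positivity
    · have := hdiag (1 - m) h1m (by linarith)
      linear_combination this
  · refine (hdiv (K := κ + mu) ?_ (by positivity) ?_).trans (by linarith)
    · have : 0 ≤ 1 - θ * m := by nlinarith
      positivity
    · have := hdiag m hm0 hm1
      linear_combination this
  · rw [abs_div, abs_of_nonneg hden]
    refine (div_le_of_le_mul₀ hden habs ?_).trans (by linarith)
    rw [show 4 * κ * mu * lam * θ ^ 2 * m * (1 - m) = lam * (4 * κ * mu * m * (1 - m) * θ ^ 2) by
      ring, abs_mul, abs_of_nonneg (a := 4 * κ * mu * m * (1 - m) * θ ^ 2) (by positivity)]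
    gcongr
    have : 0 ≤ (κ + mu) ^ 2 * (1 - θ) := by positivity
    linarith
  · rw [abs_zero]; positivity

theorem abs_rotMatrix_le (α : ℝ) (i j : Fin 2) : |rotMatrix α i j| ≤ 1 := by
  fin_cases i <;> fin_cases j <;>
    simp [rotMatrix, Real.abs_cos_le_one, Real.abs_sin_le_one]

theorem abs_effectiveTensor_le {lam mu α m θ B : ℝ}
    (h : ∀ i j k l, |referenceTensor lam mu m θ i j k l| ≤ B) (i j k l : Fin 2) :
    |effectiveTensor lam mu α m θ i j k l| ≤ 16 * B := by
  have hB : 0 ≤ B := (abs_nonneg _).trans (h 0 0 0 0)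
  have hterm : ∀ a b c d, |rotMatrix α i a * rotMatrix α j b * rotMatrix α k c * rotMatrix α l d *
      referenceTensor lam mu m θ a b c d| ≤ B := by
    intro a b c d
    simp only [abs_mul]
    have h1 := abs_rotMatrix_le α i a
    have h2 := abs_rotMatrix_le α j b
    have h3 := abs_rotMatrix_le α k c
    have h4 := abs_rotMatrix_le α l d
    calc _ ≤ 1 * 1 * 1 * 1 * B := by
          gcongr
          exact h a b c d
      _ = B := by ring
  have hs : ∀ {F : Fin 2 → ℝ} {K : ℝ}, (∀ a, |F a| ≤ K) → |∑ a, F a| ≤ 2 * K := by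
    intro F K hF
    rw [Fin.sum_univ_two]
    linarith [abs_add_le (F 0) (F 1), hF 0, hF 1]
  unfold effectiveTensor
  refine (hs fun a => hs fun b => hs fun c => hs fun d => hterm a b c d).trans (le_of_eq ?_)
  ring

theorem abs_stress_sub_le {lam mu α m θ B δ : ℝ}
    (h : ∀ i j k l, |referenceTensor lam mu m θ i j k l| ≤ B) {J J' : Matrix (Fin 2) (Fin 2) ℝ}
    (hJ : ∀ i j, |J i j - J' i j| ≤ δ) (i j : Fin 2) :
    |stress lam mu α m θ J i j - stress lam mu α m θ J' i j| ≤ 64 * B * δ := by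
  have hδ : 0 ≤ δ := (abs_nonneg _).trans (hJ 0 0)
  have hterm : ∀ k l, |effectiveTensor lam mu α m θ i j k l * (strain J k l - strain J' k l)| ≤
      16 * B * δ := by
    intro k l
    rw [abs_mul]
    refine mul_le_mul (abs_effectiveTensor_le h i j k l) ?_ (abs_nonneg _)
      ((abs_nonneg _).trans (abs_effectiveTensor_le (α := α) h i j k l))
    have e : strain J k l - strain J' k l = (1 / 2) * (J k l - J' k l) + (1 / 2) *
        (J l k - J' l k) := by
      simp [strain]
      ring
    rw [e, abs_le]
    have h1 := abs_le.1 (hJ k l)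
    have h2 := abs_le.1 (hJ l k)
    constructor <;> linarith
  have e : stress lam mu α m θ J i j - stress lam mu α m θ J' i j =
      ∑ k, ∑ l, effectiveTensor lam mu α m θ i j k l * (strain J k l - strain J' k l) := by
    simp only [stress, Tensor4.apply, Matrix.of_apply, mul_sub, Finset.sum_sub_distrib]
  rw [e]
  have hs : ∀ {F : Fin 2 → ℝ} {K : ℝ}, (∀ a, |F a| ≤ K) → |∑ a, F a| ≤ 2 * K := by
    intro F K hF
    rw [Fin.sum_univ_two]
    linarith [abs_add_le (F 0) (F 1), hF 0, hF 1]
  refine (hs fun k => hs fun l => hterm k l).trans (le_of_eq ?_)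
  ring

/-! ### Lipschitz estimates for the lamination parameters -/

/-- The triangle inequality of the Euclidean plane; it makes the eigenvalues Lipschitz even where
they coincide. -/
theorem sqrt_sq_add_sq_le (a b a' b' : ℝ) :
    Real.sqrt (a ^ 2 + b ^ 2) ≤ Real.sqrt (a' ^ 2 + b' ^ 2) + (|a - a'| + |b - b'|) := by
  have h : ∀ x y : ℝ, Real.sqrt (x ^ 2 + y ^ 2) = ‖(!₂[x, y] : Plane)‖ := by
    intro x y
    rw [EuclideanSpace.norm_eq]
    simp [Fin.sum_univ_two]
  have h2 : ‖(!₂[a - a', b - b'] : Plane)‖ ≤ |a - a'| + |b - b'| := by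
    rw [← h, Real.sqrt_le_left (by positivity)]
    nlinarith [sq_abs (a - a'), sq_abs (b - b'), abs_nonneg (a - a'), abs_nonneg (b - b')]
  rw [h, h]
  have e : (!₂[a, b] : Plane) = !₂[a', b'] + !₂[a - a', b - b'] := by
    ext k
    fin_cases k <;> simp
  rw [e]
  exact (norm_add_le _ _).trans (by linarith)

theorem abs_sqrt_sub_le {a b a' b' d : ℝ} (ha : |a - a'| ≤ d) (hb : |b - b'| ≤ d) :
    |Real.sqrt (a ^ 2 + b ^ 2) - Real.sqrt (a' ^ 2 + b' ^ 2)| ≤ 2 * d := by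
  have h1 := sqrt_sq_add_sq_le a b a' b'
  have h2 := sqrt_sq_add_sq_le a' b' a b
  rw [abs_sub_comm a' a, abs_sub_comm b' b] at h2
  rw [abs_le]
  constructor <;> linarith

theorem abs_eig_sub_le {σ τ : Matrix (Fin 2) (Fin 2) ℝ} {d : ℝ}
    (h : ∀ i j, |σ i j - τ i j| ≤ d) :
    |eig₁ σ - eig₁ τ| ≤ 3 * d ∧ |eig₂ σ - eig₂ τ| ≤ 3 * d := by
  have h0 := abs_le.1 (h 0 0)
  have h1 := abs_le.1 (h 1 1)
  have hs := abs_le.1 (abs_sqrt_sub_le (a := (σ 0 0 - σ 1 1) / 2) (a' := (τ 0 0 - τ 1 1) / 2)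
    (b := σ 0 1) (b' := τ 0 1) (d := d) (by rw [abs_le]; constructor <;> linarith) (h 0 1))
  unfold eig₁ eig₂
  constructor <;> rw [abs_le] <;> constructor <;> linarith

/-- Only the first denominator enters the bound, so the interpolated stress may be small or zero.
With the second ratio `r` in `[0, 1]`, the numerator of the difference is `(1 - r)(B - B') - r(A -
A')`. -/
theorem abs_ratio_sub_le {a b a' b' e : ℝ} (ha : |a - a'| ≤ e) (hb : |b - b'| ≤ e)
    (hs : 0 < |a| + |b|) :
    |(|b| / (|a| + |b|) - |b'| / (|a'| + |b'|))| ≤ 3 * e / (|a| + |b|) := by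
  have h1 := abs_le.1 ((abs_abs_sub_abs_le_abs_sub a a').trans ha)
  have h2 := abs_le.1 ((abs_abs_sub_abs_le_abs_sub b b').trans hb)
  set A := |a|
  set B := |b|
  have hA' : 0 ≤ |a'| := abs_nonneg _
  have hB' : 0 ≤ |b'| := abs_nonneg _
  set A' := |a'|
  set B' := |b'|
  set r := B' / (A' + B') with hr
  have hr0 : 0 ≤ r := div_nonneg hB' (by linarith)
  have hr1 : r ≤ 1 := div_le_one_of_le₀ (by linarith) (by linarith)
  -- This also holds when both primed values are zero, where `r` is zero by the convention for
  -- division.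
  have hrB : r * (A' + B') = B' := by
    rcases (add_nonneg hA' hB').eq_or_lt with h0 | h0
    · rw [← h0, mul_zero]; linarith
    · exact div_mul_cancel₀ _ h0.ne'
  have e1 : B / (A + B) - r = (B - r * (A + B)) / (A + B) := by
    field_simp
  rw [e1, abs_div, abs_of_pos hs]
  gcongr
  have e2 : B - r * (A + B) = (1 - r) * (B - B') - r * (A - A') := by linear_combination -hrB
  have he : 0 ≤ e := (abs_nonneg _).trans ha
  rw [e2, abs_le]
  constructor <;> nlinarith

theorem abs_ratioOf_sub_le {σ τ : Matrix (Fin 2) (Fin 2) ℝ} {d : ℝ}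
    (h : ∀ i j, |σ i j - τ i j| ≤ d) (hs : 0 < |eig₁ σ| + |eig₂ σ|) :
    |ratioOf σ - ratioOf τ| ≤ 9 * d / (|eig₁ σ| + |eig₂ σ|) := by
  have h' := abs_eig_sub_le h
  have := abs_ratio_sub_le h'.1 h'.2 hs
  rw [show 9 * d = 3 * (3 * d) by ring]
  exact this

theorem abs_densityOf_sub_le (lam mu l : ℝ) {σ τ : Matrix (Fin 2) (Fin 2) ℝ} {d : ℝ}
    (h : ∀ i j, |σ i j - τ i j| ≤ d) :
    |densityOf lam mu l σ - densityOf lam mu l τ| ≤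
      Real.sqrt ((2 * mu + lam) / (4 * mu * (mu + lam) * l)) * (6 * d) := by
  have h' := abs_eig_sub_le h
  have h1 := abs_le.1 ((abs_abs_sub_abs_le_abs_sub _ _).trans h'.1)
  have h2 := abs_le.1 ((abs_abs_sub_abs_le_abs_sub _ _).trans h'.2)
  unfold densityOf
  set c := Real.sqrt ((2 * mu + lam) / (4 * mu * (mu + lam) * l))
  have hc : 0 ≤ c := Real.sqrt_nonneg _
  refine (abs_min_sub_min_le_max _ _ _ _).trans ?_
  rw [sub_self, abs_zero, ← mul_sub, abs_mul, abs_of_nonneg hc]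
  have hd : 0 ≤ d := (abs_nonneg _).trans (h 0 0)
  refine max_le (by positivity) ?_
  gcongr
  rw [abs_le]
  constructor <;> linarith

theorem ratioOf_mem (σ : Matrix (Fin 2) (Fin 2) ℝ) : ratioOf σ ∈ Set.Icc (0 : ℝ) 1 := by
  unfold ratioOf
  refine ⟨by positivity, div_le_one_of_le₀ ?_ (by positivity)⟩
  linarith [abs_nonneg (eig₁ σ)]

theorem densityOf_mem (lam mu l : ℝ) (σ : Matrix (Fin 2) (Fin 2) ℝ) :
    densityOf lam mu l σ ∈ Set.Icc (0 : ℝ) 1 := by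
  unfold densityOf
  exact ⟨le_min zero_le_one (by positivity), min_le_left _ _⟩

/-! ### The control weights -/

section Control

variable {M : Mesh} {u : Plane → Plane} {G : Plane → Matrix (Fin 2) (Fin 2) ℝ}
  {H : Plane → Fin 2 → Fin 2 → Fin 2 → ℝ}

theorem restrict_carrier_eq (T : Square) : (volume : Measure Plane).restrict T.carrier =
    volume.restrict (obox T.lo T.hi) :=
  Measure.restrict_congr_set (obox_ae_eq_box T.lo T.hi).symm

theorem norm_sub_sq_le {T : Square} {x z : Plane} (hx : x ∈ T.carrier) (hz : z ∈ T.carrier) :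
    ‖z - x‖ ^ 2 ≤ 2 * T.side ^ 2 := by
  have h : ∀ k, (z k - x k) ^ 2 ≤ T.side ^ 2 := by
    intro k
    have h1 := hx k
    have h2 := hz k
    exact sq_le_sq' (by linarith) (by linarith)
  rw [EuclideanSpace.norm_sq_eq, Fin.sum_univ_two]
  simp only [Real.norm_eq_abs, sq_abs, PiLp.sub_apply]
  linarith [h 0, h 1]

theorem ae_abs_jacobian_sub_le (hW : IsW2Inf M.domain u G H) {T : Square} (hT : T ∈ M.elems)
    (hS : seminormTwoInf H T.carrier ≠ ⊤) :
    ∀ᵐ x ∂volume.restrict T.carrier, ∀ i j, |G x i j - jacobian (interpolant T u) x i j| ≤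
      288 * (seminormTwoInf H T.carrier).toReal * T.side := by
  set B := (seminormTwoInf H T.carrier).toReal with hB
  have hB0 : 0 ≤ B := ENNReal.toReal_nonneg
  have hp := T.side_pos
  have hΩ := M.carrier_subset hT
  have hUD : obox T.lo T.hi ⊆ M.domain := M.obox_subset_domain hΩ
  have hmono := Measure.restrict_mono hUD (le_refl (volume : Measure Plane))
  have hD := measurableSet_domain M
  have hH : ∀ i k l, ∀ᵐ x ∂volume.restrict (obox T.lo T.hi), |H x i k l| ≤ B := by
    intro i k l
    rw [← restrict_carrier_eq]
    filter_upwards [ae_le_eLpNormEssSup (μ := volume.restrict T.carrier)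
      (f := fun x => Real.sqrt (∑ i, ∑ j, ∑ k, H x i j k ^ 2))] with x hx
    have h1 := ENNReal.toReal_mono hS
      (hx.trans_eq (eLpNorm_exponent_top (μ := volume.restrict T.carrier)
        (f := fun x => Real.sqrt (∑ i, ∑ j, ∑ k, H x i j k ^ 2))).symm)
    rw [toReal_enorm, Real.norm_of_nonneg (Real.sqrt_nonneg _)] at h1
    refine (Real.abs_le_sqrt ?_).trans h1
    calc H x i k l ^ 2 ≤ ∑ l, H x i k l ^ 2 :=
          Finset.single_le_sum (f := fun l => H x i k l ^ 2) (fun _ _ => sq_nonneg _)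
            (Finset.mem_univ l)
      _ ≤ ∑ k, ∑ l, H x i k l ^ 2 :=
          Finset.single_le_sum (f := fun k => ∑ l, H x i k l ^ 2) (fun _ _ => by positivity)
            (Finset.mem_univ k)
      _ ≤ _ := Finset.single_le_sum (f := fun i => ∑ k, ∑ l, H x i k l ^ 2)
            (fun _ _ => by positivity) (Finset.mem_univ i)
  have htaylor : ∀ i, ∀ᵐ x ∂volume.restrict (obox T.lo T.hi), ∀ z ∈ box T.lo T.hi,
      |u z i - u x i - ∑ k, G x i k * (z k - x k)| ≤ 4 * B * ‖z - x‖ ^ 2 := fun i =>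
    ae_taylor T.lo_lt_hi (f := fun x => u x i) (g := fun k x => G x i k)
      (h := fun k l x => H x i k l)
      ((continuous_coord i).comp_continuousOn
        (hW.continuousOn.mono (M.box_subset_closure_domain T.lo_lt_hi hΩ)))
      ((hW.memLp i).mono_measure hmono) (fun k => (hW.memLp_grad i k).mono_measure hmono)
      (fun k => (hW.weak_grad i k).mono hD hUD) (fun k l => (hW.weak_hess i k l).mono hD hUD)
      hB0 (hH i)
  rw [← restrict_carrier_eq] at htaylor
  filter_upwards [ae_all_iff.2 htaylor, ae_restrict_mem T.isClosed_carrier.measurableSet]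
    with x hx hxT i j
  -- The Taylor remainder is at most `4B` times the squared diameter `2h²`; then `36·8 = 288`.
  have h := abs_jacobian_interpolant_sub_le (U := u) (J := G x) (r := 8 * B * T.side ^ 2) hxT
    (fun i z hz => by
      refine (hx i z hz).trans ?_
      have := norm_sub_sq_le hxT hz
      calc 4 * B * ‖z - x‖ ^ 2 ≤ 4 * B * (2 * T.side ^ 2) := by gcongr
        _ = _ := by ring) i j
  rw [abs_sub_comm]
  refine h.trans (le_of_eq ?_)
  field_simp
  ring

theorem weightControl_le {T : Square} {p q : Plane → ℝ} {B : ℝ}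
    (h : ∀ᵐ x ∂volume.restrict T.carrier, |p x - q x| ≤ B) :
    weightControl T p q ≤ ENNReal.ofReal B := by
  rw [weightControl, eLpNorm_exponent_top]
  exact eLpNormEssSup_le_of_ae_bound h

theorem control_weights {lam mu l θ₀ h₀ : ℝ} (hmu : 0 < mu) (hk : 0 < lam + mu) (hl : 0 < l)
    (hθ₀ : 0 < θ₀) (hh₀ : 0 < h₀) (hh₁ : h₀ < 1) :
    ∃ C : ℝ, 0 < C ∧ ∀ (M : Mesh) (u : Plane → Plane)
        (G : Plane → Matrix (Fin 2) (Fin 2) ℝ) (H : Plane → Fin 2 → Fin 2 → Fin 2 → ℝ)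
        (α m θ : Plane → ℝ),
        IsW2Inf M.domain u G H → IsOptimal lam mu l M.domain G α m θ →
        (∀ᵐ x ∂(volume.restrict M.domain), θ₀ ≤ θ x) →
        ∀ T ∈ M.elems, T.side ≤ h₀ →
          weightControl T m (fun x => ratioOf (interpolatedStress lam mu α m θ T u x)) ≤
            ENNReal.ofReal (C * (T.side * |Real.log T.side|)) * seminormTwoInf H T.carrier ∧
          weightControl T θ (fun x => densityOf lam mu l (interpolatedStress lam mu α m θ T u x)) ≤
            ENNReal.ofReal (C * (T.side * |Real.log T.side|)) * seminormTwoInf H T.carrier := by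
  set c := Real.sqrt ((2 * mu + lam) / (4 * mu * (mu + lam) * l)) with hc
  have hc0 : 0 < c := Real.sqrt_pos.2 (div_pos (by linarith) (by
    have : 0 < mu + lam := by linarith
    positivity))
  set K := lam + 2 * mu + |lam| with hK
  have hK0 : 0 < K := by have := abs_nonneg lam; linarith
  have hlog₀ : Real.log h₀ < 0 := Real.log_neg hh₀ hh₁
  set Λ := |Real.log h₀| with hΛ
  have hΛ0 : 0 < Λ := abs_pos.2 hlog₀.ne
  set D := 64 * K * 288 with hD
  have hD0 : 0 < D := by positivity
  -- `D` bounds the stress error per unit of `h |u|_{2,∞}`. The summands are the Lipschitz constants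
  -- of the ratio and of the density, and division by `Λ` pays for the logarithm.
  refine ⟨(9 * c / θ₀ + 6 * c) * D / Λ, by positivity, ?_⟩
  intro M u G H α m θ hW hopt hθ T hT hTh
  have hp := T.side_pos
  have hlogT : Λ ≤ |Real.log T.side| := by
    have h1 := Real.log_le_log hp hTh
    rw [hΛ, abs_of_neg hlog₀, abs_of_neg (h1.trans_lt hlog₀)]
    linarith
  have hcoef : 0 < (9 * c / θ₀ + 6 * c) * D / Λ * (T.side * |Real.log T.side|) := by
    have := hΛ0.trans_le hlogT
    positivity
  -- In the infinite case the bound is trivial, because its coefficient is positive.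
  by_cases hS : seminormTwoInf H T.carrier = ⊤
  · rw [hS, ENNReal.mul_top (by simpa using hcoef)]
    exact ⟨le_top, le_top⟩
  set B := (seminormTwoInf H T.carrier).toReal with hB
  have hB0 : 0 ≤ B := ENNReal.toReal_nonneg
  have hSB : seminormTwoInf H T.carrier = ENNReal.ofReal B := (ENNReal.ofReal_toReal hS).symm
  have hUD : obox T.lo T.hi ⊆ M.domain := M.obox_subset_domain (M.carrier_subset hT)
  have hres : (volume : Measure Plane).restrict T.carrier ≤ volume.restrict M.domain := by
    rw [restrict_carrier_eq]
    exact Measure.restrict_mono hUD le_rfl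
  have hmain : ∀ᵐ x ∂volume.restrict T.carrier,
      |m x - ratioOf (interpolatedStress lam mu α m θ T u x)| ≤ 9 * c / θ₀ * D * (T.side * B) ∧
      |θ x - densityOf lam mu l (interpolatedStress lam mu α m θ T u x)| ≤
        6 * c * D * (T.side * B) := by
    filter_upwards [ae_mono hres hopt, ae_mono hres hθ, ae_abs_jacobian_sub_le hW hT hS]
      with x ⟨_, hm, hθx⟩ hθge hJ
    have hm01 : m x ∈ Set.Icc (0 : ℝ) 1 := by
      have := ratioOf_mem (stress lam mu (α x) (m x) (θ x) (G x))
      rwa [← hm] at this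
    have hθ01 : θ x ∈ Set.Icc (0 : ℝ) 1 := by
      have := densityOf_mem lam mu l (stress lam mu (α x) (m x) (θ x) (G x))
      rwa [← hθx] at this
    have hstress := abs_stress_sub_le (α := α x) (abs_referenceTensor_le hmu hk hm01 hθ01) hJ
    set σ := stress lam mu (α x) (m x) (θ x) (G x) with hσ
    set τ := stress lam mu (α x) (m x) (θ x) (jacobian (interpolant T u) x) with hτ
    have hτ' : interpolatedStress lam mu α m θ T u x = τ := rfl
    set d := 64 * K * (288 * B * T.side) with hd
    have hd' : d = D * (T.side * B) := by rw [hd, hD]; ring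
    -- The density is at most `c (|λ₁| + |λ₂|)` and, by optimality, equals `θ ≥ θ₀`; the exact
    -- stress is therefore bounded away from zero.
    have hlow : θ₀ / c ≤ |eig₁ σ| + |eig₂ σ| := by
      rw [div_le_iff₀' hc0]
      have : densityOf lam mu l σ ≤ c * (|eig₁ σ| + |eig₂ σ|) := min_le_right _ _
      linarith
    have hpos : 0 < |eig₁ σ| + |eig₂ σ| := (div_pos hθ₀ hc0).trans_le hlow
    have hd0 : 0 ≤ d := (abs_nonneg _).trans (hstress 0 0)
    rw [hτ']
    constructor
    · rw [hm]
      refine (abs_ratioOf_sub_le hstress hpos).trans ?_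
      calc 9 * d / (|eig₁ σ| + |eig₂ σ|) ≤ 9 * d / (θ₀ / c) := by gcongr
        _ = 9 * c / θ₀ * D * (T.side * B) := by
          rw [hd']
          field_simp
    · rw [hθx]
      refine (abs_densityOf_sub_le lam mu l hstress).trans (le_of_eq ?_)
      rw [hd']
      ring
  have hfin : ∀ {p q : Plane → ℝ} {e : ℝ}, 0 ≤ e → e ≤ 9 * c / θ₀ + 6 * c →
      (∀ᵐ x ∂volume.restrict T.carrier, |p x - q x| ≤ e * D * (T.side * B)) →
      weightControl T p q ≤ ENNReal.ofReal ((9 * c / θ₀ + 6 * c) * D / Λ *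
        (T.side * |Real.log T.side|)) * seminormTwoInf H T.carrier := by
    intro p q e he0 he h
    refine (weightControl_le h).trans ?_
    rw [hSB, ← ENNReal.ofReal_mul hcoef.le]
    refine ENNReal.ofReal_le_ofReal ?_
    calc e * D * (T.side * B) ≤ (9 * c / θ₀ + 6 * c) * D * (T.side * B) := by gcongr
      _ = (9 * c / θ₀ + 6 * c) * D / Λ * (T.side * Λ) * B := by field_simp
      _ ≤ _ := by gcongr
  exact ⟨hfin (by positivity) (by linarith [show 0 ≤ 6 * c by positivity])
      (hmain.mono fun x hx => hx.1),
    hfin (by positivity) (by linarith [show 0 ≤ 9 * c / θ₀ by positivity])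
      (hmain.mono fun x hx => hx.2)⟩

end Control

end Laminate

end

theorem mainTheorem2 :
    -- primal weights: the constant is universal
    (∃ C : ℝ, 0 < C ∧ ∀ (M : Mesh) (u : Plane → Plane)
      (G : Plane → Matrix (Fin 2) (Fin 2) ℝ) (H : Plane → Fin 2 → Fin 2 → Fin 2 → ℝ),
      IsW2Inf M.domain u G H →
        ∃ v : Plane → Plane, IsFiniteElement M v ∧ ∀ T ∈ M.elems,
          weightU T u v ≤ ENNReal.ofReal (C * T.side) * seminormOneTwo G (M.patch T) ∧
          weightBoundary T u v ≤
            ENNReal.ofReal (C * Real.sqrt T.side) * seminormOneTwo G (M.patch T)) ∧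
    -- control weights: the constant depends on the material, the density threshold and the
    -- bound for the mesh size
    (∀ lam mu l θ₀ h₀ : ℝ, 0 < mu → 0 < lam + mu → 0 < l → 0 < θ₀ → 0 < h₀ → h₀ < 1 →
      ∃ C : ℝ, 0 < C ∧ ∀ (M : Mesh) (u : Plane → Plane)
        (G : Plane → Matrix (Fin 2) (Fin 2) ℝ) (H : Plane → Fin 2 → Fin 2 → Fin 2 → ℝ)
        (α m θ : Plane → ℝ),
        IsW2Inf M.domain u G H → IsOptimal lam mu l M.domain G α m θ →
        (∀ᵐ x ∂(volume.restrict M.domain), θ₀ ≤ θ x) →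
        ∀ T ∈ M.elems, T.side ≤ h₀ →
          weightControl T m (fun x => ratioOf (interpolatedStress lam mu α m θ T u x)) ≤
            ENNReal.ofReal (C * (T.side * |Real.log T.side|)) * seminormTwoInf H T.carrier ∧
          weightControl T θ (fun x => densityOf lam mu l (interpolatedStress lam mu α m θ T u x)) ≤
            ENNReal.ofReal (C * (T.side * |Real.log T.side|)) * seminormTwoInf H T.carrier) := by
  refine ⟨⟨40000, by norm_num, fun M u G H hW => exists_quasiInterpolant hW⟩, ?_⟩
  intro lam mu l θ₀ h₀ hmu hk hl hθ₀ hh₀ hh₁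
  exact control_weights hmu hk hl hθ₀ hh₀ hh₁
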